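/- Let $p$ be a prime, $n\ge 1$, $G=\mathrm{GL}_{2n}(\mathbb{Q}_p)$, and let $\psi:\mathbb{Q}_p\to\mathbb{C}^\times$ be an additive character of conductor $\mathbb{Z}_p$ (for $x\in\mathbb{Q}_p$, $\psi$ is trivial on $x\mathbb{Z}_p$ if and only if $x\in\mathbb{Z}_p$), for instance the standard one. Let $\eta:\mathbb{Q}_p^\times\to\mathbb{C}^\times$ be a smooth character, let $\theta=(\theta_1,\dots,\theta_{2n})$ be unramified characters of $\mathbb{Q}_p^\times$, let $\pi=\mathrm{Ind}_B^G\theta$ be the normalised smooth induction from the upper triangular Borel subgroup, and let $$\mathcal{S}_\psi^\eta:\pi\hookrightarrow\mathrm{Ind}_{\mathcal{S}}^{G}(\eta\otimes\psi)$$ be a Shalika model, i.e. an injective $G$-equivariant map to the space of functions $W:G\to\mathbb{C}$ that are right invariant under some open subgroup and satisfy $$W\left[\begin{pmatrix}h&\\&h\end{pmatrix}\begin{pmatrix}1&X\\&1\end{pmatrix}g\right]=\eta(\det h)\,\psi(\mathrm{tr}\,X)\,W(g)\qquad(h\in\mathrm{GL}_n(\mathbb{Q}_p),\ X\in M_n(\mathbb{Q}_p),\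 g\in G),$$ with $G$ acting by right translation, $(g\cdot W)(x)=W(xg)$. Let $\mathrm{Iw}_G\subset\mathrm{GL}_{2n}(\mathbb{Z}_p)$ and $\mathrm{Iw}_n\subset\mathrm{GL}_n(\mathbb{Z}_p)$ be the Iwahori subgroups of matrices that are upper triangular modulo $p$. Let $w_n$ be the antidiagonal $n\times n$ matrix with ones on the antidiagonal, and let $$u=\begin{pmatrix}1&w_n\\0&1\end{pmatrix},\quad t_p=\mathrm{diag}(p^{2n-1},p^{2n-2},\dots,p,1),\quad z=\mathrm{diag}(p^{n-1},\dots,p,1).$$ Let $\chi:\mathbb{Q}_p^\times\to\mathbb{C}^\times$ be a character with $\chi(p)=1$ and of conductor $p^\beta>1$ (so $\chi$ has finite order), with Gauss sum $$\tau(\chi)=p^\beta(1-p^{-1})\int_{\mathbb{Z}_p^\times}\chi(c)\,\psi(p^{-\beta}c)\,d^\times c,$$ where $d^\times c$ is the Haar measure of total mass $1$. Fix a Haar measure $dx$ on $\mathrm{GL}_n(\mathbb{Q}_p)$ and, for $W'\in\mathcal{S}_\psi^\eta(\pi)$, write $$\zeta(s,W',\chi)=\int_{\mathrm{GL}_n(\mathbb{Q}_p)}W'\begin{pmatrix}x&\\&1\end{pmatrix}\chi(\det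 x)\,|\det x|^{s-\frac12}\,dx$$ where this converges absolutely, and continue it meromorphically to $s\in\mathbb{C}$. Then for every $W\in\mathcal{S}_\psi^\eta(\pi^{\mathrm{Iw}_G})$ the integral defining $\zeta(s,(u^{-1}t_p^\beta)\cdot W,\chi)$ converges absolutely for $\mathrm{Re}(s)$ sufficiently large and has a meromorphic continuation to $\mathbb{C}$. For every $s\in\mathbb{C}$ (the left side being the continuation, and also equal to the integral at every $s$ where the integral converges absolutely), $$\zeta\big(s,(u^{-1}t_p^\beta)\cdot W,\chi\big)=\Upsilon'\cdot\eta(\det z^\beta)\cdot p^{-\beta\frac{n^2+n}{2}}\cdot p^{\beta n(s-\frac12)}\cdot\tau(\chi)^n\cdot\chi(\det(-w_n))\cdot W\begin{pmatrix}w_nz^{2\beta}&\\&1\end{pmatrix},$$ where $\Upsilon'=\mathrm{vol}(\mathrm{Iw}_n)\cdot(1-p^{-1})^{-n}\cdot p^{(n^2-n)/2}$ (volume with respect to $dx$) is independent of $W$, $\chi$ and $\beta$. -/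

import Mathlib

open MeasureTheory
open scoped Matrix

noncomputable section

namespace ShalikaZeta

/-- The left translation behaviour and smoothness defining an induced representation: the
representation of `G`, by right translation, on the functions `f : G → ℂ` which are right
invariant under some open subgroup and satisfy `f (h i * g) = a i * f g` for all `i` and `g`.
When `h` runs over a closed subgroup and `a` is a character of it, this is the (unnormalised)
smooth induction of that character. -/
def smoothFunctions {G I : Type*} [Group G] (h : I → G) (a : I → ℂ) [TopologicalSpace G] :
    Submodule ℂ (G → ℂ) where
  carrier := {f | (∀ i g, f (h i * g) = a i * f g) ∧
    ∃ U : Subgroup G, IsOpen (U : Set G) ∧ ∀ g, ∀ k ∈ U, f (g * k) = f g}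
  zero_mem' := ⟨by simp, ⊤, by simp⟩
  add_mem' := by
    rintro f₁ f₂ ⟨h₁, U₁, o₁, s₁⟩ ⟨h₂, U₂, o₂, s₂⟩
    refine ⟨fun i g => by simp [h₁, h₂, mul_add], U₁ ⊓ U₂, o₁.inter o₂, fun g k hk => ?_⟩
    simp [s₁ g k hk.1, s₂ g k hk.2]
  smul_mem' := by
    rintro c f ⟨h₁, U₁, o₁, s₁⟩
    exact ⟨fun i g => by simp [h₁]; ring, U₁, o₁, fun g k hk => by simp [s₁ g k hk]⟩

/-- The action of a group on functions on it by right translation, `(g • f)(x) = f (x * g)`. -/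
def rightTranslation (G : Type*) [Group G] : Representation ℂ G (G → ℂ) where
  toFun g := LinearMap.funLeft ℂ ℂ (fun x => x * g)
  map_one' := by ext; simp
  map_mul' g g' := by ext; simp [LinearMap.funLeft, mul_assoc]

/-- `smoothFunctions` is stable under right translation. -/
def smoothInduction {G I : Type*} [Group G] [TopologicalSpace G] [IsTopologicalGroup G]
    (h : I → G) (a : I → ℂ) : Subrepresentation (rightTranslation G) where
  toSubmodule := smoothFunctions h a
  apply_mem_toSubmodule := by
    rintro g f ⟨h₁, U, o, s⟩
    refine ⟨fun i x => ?_, U.comap (MulAut.conj g⁻¹).toMonoidHom, ?_, fun x k hk => ?_⟩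
    · simp [rightTranslation, LinearMap.funLeft, h₁, mul_assoc]
    · exact o.preimage (f := fun x => g⁻¹ * x * g⁻¹⁻¹) (by fun_prop)
    · have := s (x * g) _ hk
      simpa [rightTranslation, LinearMap.funLeft, mul_assoc] using this

section Matrices

variable (p : ℕ) [Fact p.Prime] (n : ℕ)

/-- `p`, as an element of `ℚ_p^×`. -/
def pUnit : ℚ_[p]ˣ := Units.mk0 (p : ℚ_[p]) (by exact_mod_cast (Fact.out : p.Prime).ne_zero)

/-- `GL_{2n}(ℚ_p)`; rows and columns are indexed by two blocks of size `n`. -/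
abbrev G2 := GL (Fin n ⊕ Fin n) ℚ_[p]

/-- The position `0, …, 2n - 1` of a row or column of a `2n × 2n` matrix in block form. -/
def pos : Fin n ⊕ Fin n → ℕ := Sum.elim (fun i => (i : ℕ)) (fun i => n + i)

variable {p n}

/-- Invertible diagonal matrices. -/
def diagGL {ι : Type*} [Fintype ι] [DecidableEq ι] (t : ι → ℚ_[p]ˣ) : GL ι ℚ_[p] where
  val := Matrix.diagonal fun i => (t i : ℚ_[p])
  inv := Matrix.diagonal fun i => ((t i)⁻¹ : ℚ_[p])
  val_inv := by simp
  inv_val := by simp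

/-- The block diagonal matrix `diag(a, b)`. -/
def blockDiag (a b : GL (Fin n) ℚ_[p]) : G2 p n where
  val := Matrix.fromBlocks a.val 0 0 b.val
  inv := Matrix.fromBlocks a⁻¹.val 0 0 b⁻¹.val
  val_inv := by simp [Matrix.fromBlocks_multiply]
  inv_val := by simp [Matrix.fromBlocks_multiply]

/-- The block unipotent matrix with upper right block `X`. -/
def blockUnip (X : Matrix (Fin n) (Fin n) ℚ_[p]) : G2 p n where
  val := Matrix.fromBlocks 1 X 0 1
  inv := Matrix.fromBlocks 1 (-X) 0 1
  val_inv := by simp [Matrix.fromBlocks_multiply]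
  inv_val := by simp [Matrix.fromBlocks_multiply]

variable (p n)

/-- `w_n`, the antidiagonal matrix with ones on the antidiagonal. -/
def longestWeyl : GL (Fin n) ℚ_[p] where
  val := (Fin.revPerm : Equiv.Perm (Fin n)).permMatrix ℚ_[p]
  inv := (Fin.revPerm : Equiv.Perm (Fin n)).permMatrix ℚ_[p]
  val_inv := by
    rw [← Matrix.permMatrix_mul]
    convert Matrix.permMatrix_one
    ext; simp
  inv_val := by
    rw [← Matrix.permMatrix_mul]
    convert Matrix.permMatrix_one
    ext; simp

/-- `u`, the block unipotent matrix with upper right block `w_n`. -/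
def uMat : G2 p n := blockUnip (longestWeyl p n).val

/-- `t_p = diag(p^{2n-1}, p^{2n-2}, …, p, 1)`. -/
def tMat : G2 p n := diagGL fun i => pUnit p ^ (2 * n - 1 - pos n i)

/-- `z = diag(p^{n-1}, …, p, 1)`. -/
def zMat : GL (Fin n) ℚ_[p] := diagGL fun i => pUnit p ^ (n - 1 - (i : ℕ))

variable {p}

/-- The upper triangular Iwahori subgroup: invertible matrices over `ℤ_p` which are upper
triangular modulo `p`, with respect to the order of the indices given by `r`. -/
def iwahori {ι : Type*} [Fintype ι] [DecidableEq ι] (r : ι → ℕ) : Set (GL ι ℚ_[p]) :=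
  {g | (∀ i j, ‖g.val i j‖ ≤ 1) ∧ ‖g.val.det‖ = 1 ∧ ∀ i j, r j < r i → ‖g.val i j‖ < 1}

variable (p)

/-- The Iwahori subgroup of `GL_{2n}(ℤ_p)`. -/
abbrev Iw2 : Set (G2 p n) := iwahori (pos n)

/-- The Iwahori subgroup of `GL_n(ℤ_p)`. -/
abbrev Iw : Set (GL (Fin n) ℚ_[p]) := iwahori (fun i => (i : ℕ))

/-- The unipotent radical `N` of the upper triangular Borel subgroup of `GL_{2n}(ℚ_p)`. -/
def upperUnipotent : Set (G2 p n) :=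
  {g | (∀ i, g.val i i = 1) ∧ ∀ i j, pos n j < pos n i → g.val i j = 0}

end Matrices

section Representations

variable {p : ℕ} [Fact p.Prime] {n : ℕ}

/-- Characters of `ℚ_p^×` trivial on `ℤ_p^×`. -/
def IsUnramified (θ : ℚ_[p]ˣ →* ℂˣ) : Prop := ∀ c : ℚ_[p]ˣ, ‖(c : ℚ_[p])‖ = 1 → θ c = 1

/-- `δ_B^{1/2}`, where `δ_B(t) = |t_1|^{2n-1} |t_2|^{2n-3} ⋯ |t_{2n}|^{1-2n}`. -/
def sqrtModulus (t : Fin n ⊕ Fin n → ℚ_[p]ˣ) : ℝ :=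
  ∏ i, ‖(t i : ℚ_[p])‖ ^ ((2 * (n : ℝ) - 1 - 2 * (pos n i : ℝ)) / 2)

/-- The normalised parabolic induction `Ind_B^G θ` from the upper triangular Borel subgroup
`B = T N` of `GL_{2n}(ℚ_p)`: smooth functions `f` with
`f (t ν g) = δ_B^{1/2}(t) θ(t) f(g)` for `t ∈ T`, `ν ∈ N`. -/
def principalSeries (θ : Fin n ⊕ Fin n → ℚ_[p]ˣ →* ℂˣ) :
    Subrepresentation (rightTranslation (G2 p n)) :=
  smoothInduction
    (fun b : (Fin n ⊕ Fin n → ℚ_[p]ˣ) × upperUnipotent p n => diagGL b.1 * b.2.val)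
    (fun b => (sqrtModulus b.1 : ℂ) * ∏ i, (θ i (b.1 i) : ℂ))

/-- Smooth functions `W` on `GL_{2n}(ℚ_p)` with
`W (diag(h, h) (1 X; 0 1) g) = η(det h) ψ(tr X) W(g)` for `h ∈ GL_n(ℚ_p)`, `X ∈ M_n(ℚ_p)`, that
is, the induction of `η ⊗ ψ` from the Shalika subgroup. -/
def shalikaInduction (n : ℕ) (η : ℚ_[p]ˣ →* ℂˣ) (ψ : AddChar ℚ_[p] ℂ) :
    Subrepresentation (rightTranslation (G2 p n)) :=
  smoothInduction
    (fun s : GL (Fin n) ℚ_[p] × Matrix (Fin n) (Fin n) ℚ_[p] =>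
      blockDiag s.1 s.1 * blockUnip s.2)
    (fun s => (η (Matrix.GeneralLinearGroup.det s.1) : ℂ) * ψ s.2.trace)

/-- The additive character `ψ` has conductor `ℤ_p`: it is trivial on `x ℤ_p` exactly when
`x ∈ ℤ_p`. -/
def HasConductorOne (ψ : AddChar ℚ_[p] ℂ) : Prop :=
  ∀ x : ℚ_[p], (∀ y : ℚ_[p], ‖y‖ ≤ 1 → ψ (x * y) = 1) ↔ ‖x‖ ≤ 1

/-- The multiplicative character `χ` has conductor `p^β`: `β` is the least `m` such that `χ` is
trivial on the units of `ℤ_p` congruent to `1` modulo `p^m`. -/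
def HasConductor (χ : ℚ_[p]ˣ →* ℂˣ) (β : ℕ) : Prop :=
  IsLeast {m : ℕ | ∀ c : ℚ_[p]ˣ, ‖(c : ℚ_[p])‖ = 1 →
    ‖(c : ℚ_[p]) - 1‖ ≤ (p : ℝ) ^ (-(m : ℤ)) → χ c = 1} β

/-- The Gauss sum `p^β (1 - p⁻¹) ∫_{ℤ_p^×} χ(c) ψ(p^{-β} c) d^×c`, the Haar measure having total
mass one. -/
def gaussSum (χ : ℚ_[p]ˣ →* ℂˣ) (ψ : AddChar ℚ_[p] ℂ) (β : ℕ) : ℂ :=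
  letI : MeasurableSpace ℤ_[p]ˣ := borel _
  haveI : BorelSpace ℤ_[p]ˣ := ⟨rfl⟩
  (p : ℂ) ^ β * (1 - (p : ℂ)⁻¹) *
    ∫ c : ℤ_[p]ˣ, (χ (Units.map (PadicInt.Coe.ringHom (p := p)).toMonoidHom c) : ℂ) *
      ψ ((p : ℚ_[p])⁻¹ ^ β * ((c : ℤ_[p]) : ℚ_[p])) ∂(Measure.haarMeasure ⊤)

/-- The integrand `W(diag(x, 1)) χ(det x) |det x|^{s - 1/2}` of the local Friedberg–Jacquet
integral. -/
def zetaIntegrand (W : G2 p n → ℂ) (χ : ℚ_[p]ˣ →* ℂˣ) (s : ℂ) (x : GL (Fin n) ℚ_[p]) : ℂ :=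
  W (blockDiag x 1) * (χ (Matrix.GeneralLinearGroup.det x) : ℂ) *
    (‖x.val.det‖ : ℂ) ^ (s - 1 / 2)

/-- `Z` is the local Friedberg–Jacquet zeta function of `W` and `χ`: the integral converges
absolutely in some right half-plane, and `Z` is its meromorphic continuation to `ℂ` (in normal
form, so that `Z` is unique, also at removable singularities). -/
def IsZetaFunction [MeasurableSpace (GL (Fin n) ℚ_[p])] (μ : Measure (GL (Fin n) ℚ_[p]))
    (W : G2 p n → ℂ) (χ : ℚ_[p]ˣ →* ℂˣ) (Z : ℂ → ℂ) : Prop :=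
  MeromorphicNFOn Z Set.univ ∧ ∃ σ : ℝ, ∀ s : ℂ, σ < s.re →
    Integrable (zetaIntegrand W χ s) μ ∧ Z s = ∫ x, zetaIntegrand W χ s x ∂μ

open Classical in
/-- The local Friedberg–Jacquet zeta function `ζ(s, W, χ)` (zero if it does not exist). -/
def zeta [MeasurableSpace (GL (Fin n) ℚ_[p])] (μ : Measure (GL (Fin n) ℚ_[p]))
    (s : ℂ) (W : G2 p n → ℂ) (χ : ℚ_[p]ˣ →* ℂˣ) : ℂ :=
  if h : ∃ Z, IsZetaFunction μ W χ Z then h.choose s else 0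

/-- `Υ' = vol(Iw_n) (1 - p⁻¹)^{-n} p^{(n² - n)/2}`. -/
def upsilon' [MeasurableSpace (GL (Fin n) ℚ_[p])] (μ : Measure (GL (Fin n) ℚ_[p])) : ℂ :=
  (μ.real (Iw p n) : ℂ) * ((1 - (p : ℂ)⁻¹) ^ n)⁻¹ * (p : ℂ) ^ (((n : ℂ) ^ 2 - n) / 2)

/-- `Υ' η(det z^β) p^{-β(n²+n)/2} p^{βn(s-1/2)} τ(χ)^n χ(det(-w_n)) W(diag(w_n z^{2β}, 1))`. -/
def zetaValue [MeasurableSpace (GL (Fin n) ℚ_[p])] (μ : Measure (GL (Fin n) ℚ_[p]))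
    (η : ℚ_[p]ˣ →* ℂˣ) (ψ : AddChar ℚ_[p] ℂ) (χ : ℚ_[p]ˣ →* ℂˣ) (β : ℕ)
    (W : G2 p n → ℂ) (s : ℂ) : ℂ :=
  upsilon' μ * (η (Matrix.GeneralLinearGroup.det (zMat p n ^ β)) : ℂ) *
    (p : ℂ) ^ (-(β : ℂ) * (((n : ℂ) ^ 2 + n) / 2)) *
    (p : ℂ) ^ ((β : ℂ) * n * (s - 1 / 2)) *
    gaussSum χ ψ β ^ n *
    (χ (Matrix.GeneralLinearGroup.det (-longestWeyl p n)) : ℂ) *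
    W (blockDiag (longestWeyl p n * zMat p n ^ (2 * β)) 1)

end Representations

end ShalikaZeta

end

/-! The zeta integral becomes explicit after one change of variables. Conjugating `u⁻¹` past
`diag(x, 1)` produces `ψ(-tr(x w_n))`, and `t_p = diag(p^n z, z)`. The substitution `x ↦ -p^{-β} z^β
x z^{-β} w_n` then turns the integrand into a constant times `ψ(p^{-β} tr x) χ(det x) |det
x|^{s-1/2} F(x)`, where `F(x) = W(diag(x w_n z^{2β}, 1))`. When `η` is unramified, `F` is left
invariant under `Iw_n`: the Shalika property moves `k` into the lower block, where the Iwahori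
invariance of `W` absorbs it.

The domain is split into the group `Γ₀(p^β)` of integral matrices upper triangular modulo `p^β` and
its complement. On `Γ₀(p^β)` the determinant is congruent to the product of the diagonal entries, so
`χ(det k) ψ(tr(b k))` is a product of functions of single entries (`prod_entryFactor`). Averaging
the integrand over left translations by `k` in `Γ₀(p^β)` therefore gives a product of one-variable
character sums. By orthogonality these vanish unless `x` itself lies in `Γ₀(p^β)`
(`entryCondition_of_residueSum_ne_zero`), so the complement contributes nothing. On `Γ₀(p^β)`, `F`
is the constant `F(1)`, each diagonal entry contributes a Gauss sum, and counting residues turns the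
remaining volume into `Υ'` and a power of `p` (`volume_identity`).

A ramified `η` is harmless: any `y` conjugates some element of `Iw_n` of prescribed unit determinant
into `Iw_n` (`exists_iwahori_conj`), which forces `W(diag(y, 1)) = 0`, and both sides vanish.

For convergence, `W(diag(y, 1))` is supported on integral `y` and grows at most like a power of
`|det y|⁻¹` (`exists_growth_bound`). Indeed the vectors of the principal series fixed by the first
congruence subgroup form a finite-dimensional space, and finitely many Hecke operators acting on it
shift the exponents of a diagonal argument. The volume of the integral matrices with determinant of
valuation `v` is also at most exponential in `v`. The evaluation holds wherever the integral
converges and its value is entire in `s`, so it is the continuation. -/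

namespace ShalikaZeta

set_option linter.unusedSectionVars false
set_option linter.unusedDecidableInType false
set_option linter.unusedFintypeInType false

/-! ### Ultrametric estimates for matrix entries; congruence subgroups -/

section Entries

variable {p : ℕ} [Fact p.Prime] {ι : Type*} [Fintype ι] [DecidableEq ι]

/-- All entries of the matrix `A` have norm at most `e`. -/
def EntriesLE (e : ℝ) (A : Matrix ι ι ℚ_[p]) : Prop := ∀ i j, ‖A i j‖ ≤ e

theorem padic_norm_sum_le {α : Type*} (s : Finset α) (f : α → ℚ_[p]) {e : ℝ} (he : 0 ≤ e)
    (h : ∀ i ∈ s, ‖f i‖ ≤ e) : ‖∑ i ∈ s, f i‖ ≤ e :=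
  IsUltrametricDist.norm_sum_le_of_forall_le_of_nonneg he h

theorem padic_norm_add_le {a b : ℚ_[p]} {e : ℝ} (ha : ‖a‖ ≤ e) (hb : ‖b‖ ≤ e) : ‖a + b‖ ≤ e :=
  (IsUltrametricDist.norm_add_le_max a b).trans (max_le ha hb)

theorem padic_norm_sub_le {a b : ℚ_[p]} {e : ℝ} (ha : ‖a‖ ≤ e) (hb : ‖b‖ ≤ e) : ‖a - b‖ ≤ e := by
  rw [sub_eq_add_neg]; exact padic_norm_add_le ha (by rwa [norm_neg])

namespace EntriesLE

theorem mono {e e' : ℝ} {A : Matrix ι ι ℚ_[p]} (h : EntriesLE e A) (he : e ≤ e') :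
    EntriesLE e' A := fun i j => (h i j).trans he

theorem add {e : ℝ} {A B : Matrix ι ι ℚ_[p]} (hA : EntriesLE e A) (hB : EntriesLE e B) :
    EntriesLE e (A + B) := fun i j => padic_norm_add_le (hA i j) (hB i j)

theorem sub {e : ℝ} {A B : Matrix ι ι ℚ_[p]} (hA : EntriesLE e A) (hB : EntriesLE e B) :
    EntriesLE e (A - B) := fun i j => padic_norm_sub_le (hA i j) (hB i j)

theorem neg {e : ℝ} {A : Matrix ι ι ℚ_[p]} (hA : EntriesLE e A) : EntriesLE e (-A) :=
  fun i j => by simpa using hA i j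

theorem mul {e e' : ℝ} {A B : Matrix ι ι ℚ_[p]} (he : 0 ≤ e) (he' : 0 ≤ e')
    (hA : EntriesLE e A) (hB : EntriesLE e' B) : EntriesLE (e * e') (A * B) := fun i j => by
  rw [Matrix.mul_apply]
  refine padic_norm_sum_le _ _ (by positivity) fun k _ => ?_
  rw [norm_mul]
  exact mul_le_mul (hA i k) (hB k j) (norm_nonneg _) he

theorem one : EntriesLE 1 (1 : Matrix ι ι ℚ_[p]) := fun i j => by
  rw [Matrix.one_apply]; split_ifs <;> simp

theorem norm_det_le {A : Matrix ι ι ℚ_[p]} (hA : EntriesLE 1 A) : ‖A.det‖ ≤ 1 := by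
  rw [Matrix.det_apply]
  refine padic_norm_sum_le _ _ zero_le_one fun σ _ => ?_
  rw [Units.smul_def, zsmul_eq_mul, norm_mul, norm_prod]
  have h1 : ‖((Equiv.Perm.sign σ : ℤ) : ℚ_[p])‖ ≤ 1 := Padic.norm_int_le_one _
  have h2 : ∏ i, ‖A (σ i) i‖ ≤ 1 := Finset.prod_le_one (fun _ _ => norm_nonneg _) fun i _ => hA _ _
  exact mul_le_one₀ h1 (Finset.prod_nonneg fun _ _ => norm_nonneg _) h2

theorem adjugate {A : Matrix ι ι ℚ_[p]} (hA : EntriesLE 1 A) : EntriesLE 1 A.adjugate := by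
  intro i j
  rw [Matrix.adjugate_apply]
  apply norm_det_le
  intro a b
  rw [Matrix.updateRow_apply]
  split_ifs
  · rw [Pi.single_apply]; split_ifs <;> simp
  · exact hA a b

end EntriesLE

theorem norm_inv_apply_le {g : GL ι ℚ_[p]} (hg : EntriesLE 1 g.val) :
    EntriesLE ‖g.val.det‖⁻¹ g⁻¹.val := by
  intro i j
  rw [Matrix.coe_units_inv, Matrix.inv_def, Matrix.smul_apply, smul_eq_mul, norm_mul,
    Ring.inverse_eq_inv', norm_inv]
  exact mul_le_of_le_one_right (by positivity) (hg.adjugate i j)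

variable (p ι) in
/-- The principal congruence subgroup of level `p^m`. -/
def congruenceSubgroup (m : ℕ) : Subgroup (GL ι ℚ_[p]) where
  carrier := {g | EntriesLE 1 g.val ∧ EntriesLE 1 g⁻¹.val ∧
    EntriesLE ((p : ℝ) ^ (-(m : ℤ))) (g.val - 1)}
  one_mem' := ⟨EntriesLE.one, by simpa using EntriesLE.one, fun i j => by simp⟩
  mul_mem' := by
    rintro g h ⟨g1, g2, g3⟩ ⟨h1, h2, h3⟩
    have hp : (0 : ℝ) ≤ (p : ℝ) ^ (-(m : ℤ)) := by positivity
    refine ⟨by simpa using g1.mul zero_le_one zero_le_one h1,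
      by simpa using h2.mul zero_le_one zero_le_one g2, ?_⟩
    have : (g * h).val - 1 = (g.val - 1) * h.val + (h.val - 1) := by
      simp [sub_mul]
    rw [this]
    exact EntriesLE.add (by simpa using g3.mul hp zero_le_one h1) h3
  inv_mem' := by
    rintro g ⟨g1, g2, g3⟩
    refine ⟨g2, by simpa using g1, ?_⟩
    have hp : (0 : ℝ) ≤ (p : ℝ) ^ (-(m : ℤ)) := by positivity
    have : g⁻¹.val - 1 = -(g⁻¹.val * (g.val - 1)) := by
      rw [mul_sub, ← Units.val_mul]; simp
    rw [this]
    simpa using (g2.mul zero_le_one hp g3).neg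

theorem norm_det_eq_one {g : GL ι ℚ_[p]} (h : EntriesLE 1 g.val) (h' : EntriesLE 1 g⁻¹.val) :
    ‖g.val.det‖ = 1 := by
  have h1 := h.norm_det_le
  have h2 := h'.norm_det_le
  have h3 : ‖g.val.det‖ * ‖g⁻¹.val.det‖ = 1 := by
    rw [← norm_mul, ← Matrix.det_mul, ← Units.val_mul]; simp
  have := norm_nonneg g.val.det
  nlinarith

theorem mem_congruenceSubgroup {m : ℕ} {g : GL ι ℚ_[p]} :
    g ∈ congruenceSubgroup p ι m ↔ EntriesLE 1 g.val ∧ ‖g.val.det‖ = 1 ∧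
      EntriesLE ((p : ℝ) ^ (-(m : ℤ))) (g.val - 1) := by
  constructor
  · rintro ⟨h1, h2, h3⟩
    exact ⟨h1, norm_det_eq_one h1 h2, h3⟩
  · rintro ⟨h1, h2, h3⟩
    exact ⟨h1, by simpa [h2] using norm_inv_apply_le h1, h3⟩

/-- At level `0` the congruence is implied by integrality, so this group is the maximal compact
subgroup over `ℤ_p`. -/
theorem mem_congruenceSubgroup_zero {g : GL ι ℚ_[p]} :
    g ∈ congruenceSubgroup p ι 0 ↔ EntriesLE 1 g.val ∧ ‖g.val.det‖ = 1 := by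
  rw [mem_congruenceSubgroup]
  refine ⟨fun h => ⟨h.1, h.2.1⟩, fun h => ⟨h.1, h.2, ?_⟩⟩
  simpa using h.1.sub EntriesLE.one

theorem congruenceSubgroup_le_zero (m : ℕ) :
    congruenceSubgroup p ι m ≤ congruenceSubgroup p ι 0 := fun _ h =>
  mem_congruenceSubgroup_zero.2 ⟨(mem_congruenceSubgroup.1 h).1, (mem_congruenceSubgroup.1 h).2.1⟩

theorem zpow_neg_lt_one {m : ℕ} (hm : 1 ≤ m) : (p : ℝ) ^ (-(m : ℤ)) < 1 := by
  have hp : (1 : ℝ) < p := by exact_mod_cast (Fact.out : p.Prime).one_lt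
  rw [zpow_neg, zpow_natCast]
  exact inv_lt_one_of_one_lt₀ (one_lt_pow₀ hp (by omega))

theorem zpow_neg_le_one (m : ℕ) : (p : ℝ) ^ (-(m : ℤ)) ≤ 1 := by
  rcases Nat.eq_zero_or_pos m with rfl | hm
  · simp
  · exact (zpow_neg_lt_one hm).le

/-- The determinant of an integral matrix whose entries below the diagonal are small is close to
the product of the diagonal entries. -/
theorem norm_det_sub_prod_le {n : ℕ} {A : Matrix (Fin n) (Fin n) ℚ_[p]} {e : ℝ} (he : 0 ≤ e)
    (hA : EntriesLE 1 A) (hl : ∀ i j, j < i → ‖A i j‖ ≤ e) : ‖A.det - ∏ i, A i i‖ ≤ e := by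
  rw [Matrix.det_apply, ← Finset.sum_erase_add _ _ (Finset.mem_univ (1 : Equiv.Perm (Fin n)))]
  simp only [Equiv.Perm.sign_one, one_smul, Equiv.Perm.one_apply, add_sub_cancel_right]
  refine padic_norm_sum_le _ _ he fun σ hσ => ?_
  -- A permutation with `σ i ≤ i` everywhere is the identity, by comparing sums; every other term of
  -- the determinant thus contains an entry below the diagonal.
  obtain ⟨i, hi⟩ : ∃ i, i < σ i := by
    by_contra! h
    refine (Finset.mem_erase.1 hσ).1 (Equiv.ext fun i => ?_)
    have hs : ∑ i, (σ i : ℕ) = ∑ i : Fin n, (i : ℕ) := Equiv.sum_comp σ (fun i : Fin n => (i : ℕ))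
    exact Fin.ext ((Finset.sum_eq_sum_iff_of_le fun i _ => Fin.le_def.1 (h i)).1 hs i
      (Finset.mem_univ i))
  rw [Units.smul_def, zsmul_eq_mul, norm_mul, norm_prod]
  have h1 : ‖((Equiv.Perm.sign σ : ℤ) : ℚ_[p])‖ ≤ 1 := Padic.norm_int_le_one _
  have h2 : ∏ i, ‖A (σ i) i‖ ≤ e := by
    rw [← Finset.mul_prod_erase _ _ (Finset.mem_univ i)]
    calc _ ≤ e * 1 := mul_le_mul (hl _ _ hi)
          (Finset.prod_le_one (fun _ _ => norm_nonneg _) fun i _ => hA _ _)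
          (Finset.prod_nonneg fun _ _ => norm_nonneg _) he
      _ = e := mul_one e
  calc _ ≤ 1 * e := mul_le_mul h1 h2 (Finset.prod_nonneg fun _ _ => norm_nonneg _) zero_le_one
    _ = e := one_mul e

theorem norm_eq_one_of_norm_sub_lt {a b : ℚ_[p]} (hb : ‖b‖ = 1) (h : ‖a - b‖ < 1) : ‖a‖ = 1 := by
  have := IsUltrametricDist.norm_eq_of_add_norm_lt_max (x := a) (y := -b)
    (by rw [← sub_eq_add_neg]; exact h.trans_le (by simp [hb]))
  rwa [norm_neg, hb] at this

end Entries

/-! ### Iwahori conjugation, Iwasawa and Cartan decompositions by elimination -/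

section Decompositions

variable {p : ℕ} [Fact p.Prime] {ι : Type*} [Fintype ι] [DecidableEq ι]

theorem vecMulVec_mul_vecMulVec' (u v u' v' : ι → ℚ_[p]) :
    Matrix.vecMulVec u v * Matrix.vecMulVec u' v' = (v ⬝ᵥ u') • Matrix.vecMulVec u v' := by
  ext i j
  simp only [Matrix.mul_apply, Matrix.vecMulVec_apply, Matrix.smul_apply, smul_eq_mul, dotProduct,
    Finset.sum_mul]
  exact Finset.sum_congr rfl fun _ _ => by ring

/-- The matrix acting by `c` on the line spanned by `u`, and trivially on the kernel of `v`. -/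
noncomputable def rankOneGL (u v : ι → ℚ_[p]) (h : v ⬝ᵥ u = 1) (c : ℚ_[p]ˣ) : GL ι ℚ_[p] where
  val := 1 + ((c : ℚ_[p]) - 1) • Matrix.vecMulVec u v
  inv := 1 + ((c⁻¹ : ℚ_[p]) - 1) • Matrix.vecMulVec u v
  val_inv := by
    have hc : (c : ℚ_[p]) ≠ 0 := c.ne_zero
    simp only [mul_add, add_mul, mul_one, one_mul, Matrix.smul_mul, Matrix.mul_smul,
      vecMulVec_mul_vecMulVec', h, one_smul, smul_smul]
    rw [add_assoc, ← add_smul, ← add_smul]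
    convert add_zero _
    convert zero_smul ℚ_[p] _
    field_simp; ring
  inv_val := by
    have hc : (c : ℚ_[p]) ≠ 0 := c.ne_zero
    simp only [mul_add, add_mul, mul_one, one_mul, Matrix.smul_mul, Matrix.mul_smul,
      vecMulVec_mul_vecMulVec', h, one_smul, smul_smul]
    rw [add_assoc, ← add_smul, ← add_smul]
    convert add_zero _
    convert zero_smul ℚ_[p] _
    field_simp; ring

theorem rankOneGL_det (u v : ι → ℚ_[p]) (h : v ⬝ᵥ u = 1) (c : ℚ_[p]ˣ) :
    (rankOneGL u v h c).val.det = c := by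
  have : (rankOneGL u v h c).val = 1 + Matrix.replicateCol Unit (((c : ℚ_[p]) - 1) • u) *
      Matrix.replicateRow Unit v := by
    rw [← Matrix.vecMulVec_eq]; simp [rankOneGL, Matrix.smul_vecMulVec]
  rw [this, Matrix.det_one_add_replicateCol_mul_replicateRow]
  simp [h]

/-- Among the entries of maximal norm, take the lowest row and then the leftmost column. The strict
inequalities are what places the rank one matrices built from this entry in the Iwahori subgroup
rather than only in `GL_n(ℤ_p)`. -/
theorem exists_dominant_entry {n : ℕ} (hn : 0 < n) (A : Matrix (Fin n) (Fin n) ℚ_[p]) :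
    ∃ i j, (∀ a b, ‖A a b‖ ≤ ‖A i j‖) ∧ (∀ a, i < a → ‖A a j‖ < ‖A i j‖) ∧
      ∀ b, b < j → ‖A i b‖ < ‖A i j‖ := by
  have : Nonempty (Fin n) := ⟨⟨0, hn⟩⟩
  obtain ⟨⟨i₀, j₀⟩, -, h₀⟩ := Finset.exists_max_image Finset.univ
    (fun x : Fin n × Fin n => ‖A x.1 x.2‖) Finset.univ_nonempty
  let s := Finset.univ.filter fun x : Fin n × Fin n => ‖A x.1 x.2‖ = ‖A i₀ j₀‖
  obtain ⟨⟨i, j⟩, hs, h⟩ := Finset.exists_max_image s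
    (fun x : Fin n × Fin n => (x.1 : ℕ) * n + (n - x.2)) ⟨(i₀, j₀), by simp [s]⟩
  have hij : ‖A i j‖ = ‖A i₀ j₀‖ := by simpa [s] using hs
  have hmax : ∀ a b, ‖A a b‖ ≤ ‖A i j‖ := fun a b => hij ▸ h₀ (a, b) (Finset.mem_univ _)
  refine ⟨i, j, hmax, fun a ha => lt_of_le_of_ne (hmax a j) fun he => ?_,
    fun b hb => lt_of_le_of_ne (hmax i b) fun he => ?_⟩
  · have h1 := h (a, j) (by simp [s, he, hij])
    have h2 : (i : ℕ) < a := ha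
    have h3 : (i : ℕ) * n < a * n := Nat.mul_lt_mul_of_pos_right h2 hn
    simp only at h1
    omega
  · have h1 := h (i, b) (by simp [s, he, hij])
    have h2 : (b : ℕ) < j := hb
    have h3 := j.2
    simp only at h1
    omega

/-- Every element `y` of `GL_n(ℚ_p)` conjugates some element of the Iwahori subgroup, of given
determinant, into the Iwahori subgroup. -/
theorem exists_iwahori_conj {n : ℕ} (hn : 0 < n) (y : GL (Fin n) ℚ_[p]) (c : ℚ_[p]ˣ)
    (hc : ‖(c : ℚ_[p])‖ = 1) :
    ∃ k ∈ Iw p n, ∃ k' ∈ Iw p n, k * y = y * k' ∧ Matrix.GeneralLinearGroup.det k = c := by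
  obtain ⟨i, j, h1, h2, h3⟩ := exists_dominant_entry hn y.val
  have hy : y.val i j ≠ 0 := by
    intro h0
    have hy0 : y.val = 0 := by
      ext a b; simpa [h0] using h1 a b
    have : Nonempty (Fin n) := ⟨i⟩
    have h4 := y.isUnit.map (Matrix.detMonoidHom)
    simp only [Matrix.coe_detMonoidHom] at h4
    exact h4.ne_zero (by rw [hy0]; exact Matrix.det_zero)
  have hy' : 0 < ‖y.val i j‖ := norm_pos_iff.2 hy
  have hc1 : ‖(c : ℚ_[p]) - 1‖ ≤ 1 := padic_norm_sub_le hc.le (by simp)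
  -- With `u` and `v` the normalised pivot column and row of `y`, both `k * y` and `y * k'` equal
  -- `y` plus `c - 1` times (column `j`)(row `i`) divided by the pivot.
  set u : Fin n → ℚ_[p] := fun a => y.val a j / y.val i j
  set v : Fin n → ℚ_[p] := fun b => y.val i b / y.val i j
  have hu : (Pi.single i 1 : Fin n → ℚ_[p]) ⬝ᵥ u = 1 := by simp [u, hy]
  have hv : v ⬝ᵥ (Pi.single j 1 : Fin n → ℚ_[p]) = 1 := by simp [v, hy]
  have hu1 : ∀ a, ‖u a‖ ≤ 1 := fun a => by
    simp only [u, norm_div]; exact div_le_one_of_le₀ (h1 a j) (norm_nonneg _)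
  have hv1 : ∀ a, ‖v a‖ ≤ 1 := fun a => by
    simp only [v, norm_div]; exact div_le_one_of_le₀ (h1 i a) (norm_nonneg _)
  have hk1 : ‖(rankOneGL u (Pi.single i 1) hu c).val.det‖ = 1 := by rw [rankOneGL_det, hc]
  have hk2 : ‖(rankOneGL (Pi.single j 1) v hv c).val.det‖ = 1 := by rw [rankOneGL_det, hc]
  refine ⟨rankOneGL u (Pi.single i 1) hu c, ⟨fun a b => ?_, hk1, fun a b hab => ?_⟩,
    rankOneGL (Pi.single j 1) v hv c, ⟨fun a b => ?_, hk2, fun a b hab => ?_⟩, ?_, ?_⟩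
  · simp only [rankOneGL, Matrix.add_apply, Matrix.smul_apply, Matrix.vecMulVec_apply, smul_eq_mul]
    refine padic_norm_add_le (EntriesLE.one a b) ?_
    rw [norm_mul, norm_mul, Pi.single_apply]
    refine mul_le_one₀ hc1 (by positivity) (mul_le_one₀ (hu1 a) (norm_nonneg _) ?_)
    split_ifs <;> simp
  · have hne : a ≠ b := by rintro rfl; exact lt_irrefl _ hab
    simp only [rankOneGL, Matrix.add_apply, Matrix.smul_apply, Matrix.vecMulVec_apply, smul_eq_mul,
      Matrix.one_apply_ne hne, zero_add, Pi.single_apply]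
    split_ifs with hb
    · subst hb
      rw [mul_one, norm_mul]
      refine (mul_le_of_le_one_left (norm_nonneg _) hc1).trans_lt ?_
      simp only [u, norm_div]
      exact (div_lt_one hy').2 (h2 a hab)
    · simp
  · simp only [rankOneGL, Matrix.add_apply, Matrix.smul_apply, Matrix.vecMulVec_apply, smul_eq_mul]
    refine padic_norm_add_le (EntriesLE.one a b) ?_
    rw [norm_mul, norm_mul, Pi.single_apply]
    refine mul_le_one₀ hc1 (by positivity) (mul_le_one₀ ?_ (norm_nonneg _) (hv1 b))
    split_ifs <;> simp
  · have hne : a ≠ b := by rintro rfl; exact lt_irrefl _ hab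
    simp only [rankOneGL, Matrix.add_apply, Matrix.smul_apply, Matrix.vecMulVec_apply, smul_eq_mul,
      Matrix.one_apply_ne hne, zero_add, Pi.single_apply]
    split_ifs with hb
    · subst hb
      rw [one_mul, norm_mul]
      refine (mul_le_of_le_one_left (norm_nonneg _) hc1).trans_lt ?_
      simp only [v, norm_div]
      exact (div_lt_one hy').2 (h3 b hab)
    · simp
  · ext1
    simp only [Units.val_mul, rankOneGL, add_mul, mul_add, one_mul, mul_one, Matrix.smul_mul,
      Matrix.mul_smul, add_right_inj]
    congr 1
    ext a b
    rw [Matrix.vecMulVec_mul, Matrix.mul_vecMulVec]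
    simp only [Matrix.vecMulVec_apply, Matrix.single_one_vecMul, Matrix.mulVec_single_one, u, v,
      Matrix.row, Matrix.col_apply]
    ring
  · ext; exact rankOneGL_det _ _ _ _

/-- Adding `u a` times row `c` to row `a`, for all `a ≠ c`. -/
noncomputable def rowOp (c : ι) (u : ι → ℚ_[p]) (h : u c = 0) : GL ι ℚ_[p] where
  val := 1 + Matrix.vecMulVec u (Pi.single c 1)
  inv := 1 - Matrix.vecMulVec u (Pi.single c 1)
  val_inv := by simp [mul_sub, add_mul, vecMulVec_mul_vecMulVec', h]
  inv_val := by simp [mul_add, sub_mul, vecMulVec_mul_vecMulVec', h]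

/-- Adding `v b` times column `c` to column `b`, for all `b ≠ c`. -/
noncomputable def colOp (c : ι) (v : ι → ℚ_[p]) (h : v c = 0) : GL ι ℚ_[p] where
  val := 1 + Matrix.vecMulVec (Pi.single c 1) v
  inv := 1 - Matrix.vecMulVec (Pi.single c 1) v
  val_inv := by simp [mul_sub, add_mul, vecMulVec_mul_vecMulVec', h]
  inv_val := by simp [mul_add, sub_mul, vecMulVec_mul_vecMulVec', h]

theorem rowOp_mul_apply (c : ι) (u : ι → ℚ_[p]) (h : u c = 0) (g : GL ι ℚ_[p]) (a b : ι) :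
    (rowOp c u h * g).val a b = g.val a b + u a * g.val c b := by
  simp [rowOp, add_mul, Matrix.vecMulVec_mul, Matrix.vecMulVec_apply, Matrix.row]

theorem mul_colOp_apply (c : ι) (v : ι → ℚ_[p]) (h : v c = 0) (g : GL ι ℚ_[p]) (a b : ι) :
    (g * colOp c v h).val a b = g.val a b + g.val a c * v b := by
  simp [colOp, mul_add, Matrix.mul_vecMulVec, Matrix.vecMulVec_apply]

theorem norm_single_le (c a : ι) : ‖(Pi.single c 1 : ι → ℚ_[p]) a‖ ≤ 1 := by
  rw [Pi.single_apply]; split_ifs <;> simp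

theorem rowOp_mem (c : ι) (u : ι → ℚ_[p]) (h : u c = 0) (hu : ∀ a, ‖u a‖ ≤ 1) :
    rowOp c u h ∈ congruenceSubgroup p ι 0 := by
  have key : EntriesLE 1 (Matrix.vecMulVec u (Pi.single c 1)) := fun a b => by
    rw [Matrix.vecMulVec_apply, norm_mul]
    exact mul_le_one₀ (hu a) (norm_nonneg _) (norm_single_le c b)
  refine ⟨EntriesLE.one.add key, EntriesLE.one.sub key, ?_⟩
  simpa [rowOp] using key

theorem colOp_mem (c : ι) (v : ι → ℚ_[p]) (h : v c = 0) (hv : ∀ a, ‖v a‖ ≤ 1) :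
    colOp c v h ∈ congruenceSubgroup p ι 0 := by
  have key : EntriesLE 1 (Matrix.vecMulVec (Pi.single c 1) v) := fun a b => by
    rw [Matrix.vecMulVec_apply, norm_mul]
    exact mul_le_one₀ (norm_single_le c a) (norm_nonneg _) (hv b)
  refine ⟨EntriesLE.one.add key, EntriesLE.one.sub key, ?_⟩
  simpa [colOp] using key

/-- The Iwasawa decomposition: column operations over `ℤ_p` make a matrix upper triangular. -/
theorem exists_mul_upperTriangular (r : ι → ℕ) (hr : Function.Injective r) (g : GL ι ℚ_[p]) :
    ∃ k ∈ congruenceSubgroup p ι 0, ∀ a b, r b < r a → (g * k).val a b = 0 := by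
  -- The rows are cleared from the bottom upwards: `N` is the first position already treated, and
  -- `m` bounds the number of positions from `N` on.
  suffices H : ∀ m N : ℕ, (∀ i, r i < N + m) → ∃ k ∈ congruenceSubgroup p ι 0,
      ∀ a b, N ≤ r a → r b < r a → (g * k).val a b = 0 by
    obtain ⟨M, hM⟩ : ∃ M, ∀ i, r i < M := by
      refine ⟨∑ i, r i + 1, fun i => Nat.lt_succ_of_le ?_⟩
      exact Finset.single_le_sum (f := r) (fun _ _ => Nat.zero_le _) (Finset.mem_univ i)
    obtain ⟨k, hk, h⟩ := H M 0 (by simpa using hM)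
    exact ⟨k, hk, fun a b => h a b (Nat.zero_le _)⟩
  intro m
  induction m with
  | zero => exact fun N hN => ⟨1, one_mem _, fun a b h => absurd (hN a) (by omega)⟩
  | succ m ih =>
    intro N hN
    obtain ⟨k, hk, h⟩ := ih (N + 1) fun i => by have := hN i; omega
    by_cases hi : ∃ i, r i = N
    swap
    · refine ⟨k, hk, fun a b hNa => h a b ?_⟩
      rcases hNa.lt_or_eq with h' | h'
      · exact h'
      · exact absurd ⟨a, h'.symm⟩ hi
    obtain ⟨i, rfl⟩ := hi
    obtain ⟨j, hj, hmax⟩ := Finset.exists_max_image (Finset.univ.filter fun b => r b ≤ r i)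
      (fun b => ‖(g * k).val i b‖) ⟨i, by simp⟩
    have hj : r j ≤ r i := by simpa using hj
    have hmax : ∀ b, r b ≤ r i → ‖(g * k).val i b‖ ≤ ‖(g * k).val i j‖ := by simpa using hmax
    -- If the maximum of the row is not on the diagonal, adding its column to column `i` puts it
    -- there, since the sum of two entries of different norms has the larger norm. The rows below
    -- are unaffected, both columns being zero there.
    obtain ⟨k₁, hk₁, h₁, hmax₁⟩ : ∃ k₁ ∈ congruenceSubgroup p ι 0,
        (∀ a b, r i + 1 ≤ r a → r b < r a → (g * k₁).val a b = 0) ∧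
        ∀ b, r b ≤ r i → ‖(g * k₁).val i b‖ ≤ ‖(g * k₁).val i i‖ := by
      rcases (hmax i le_rfl).lt_or_eq with hlt | heq
      swap
      · exact ⟨k, hk, h, heq ▸ hmax⟩
      have hji : j ≠ i := by rintro rfl; exact lt_irrefl _ hlt
      have hs : (Pi.single i 1 : ι → ℚ_[p]) j = 0 := by simp [hji]
      refine ⟨k * colOp j _ hs, mul_mem hk (colOp_mem _ _ hs (norm_single_le i)), fun a b ha hb => ?_,
        fun b hb => ?_⟩
      · rw [← mul_assoc, mul_colOp_apply, h a b ha hb, h a j ha (by omega)]; simp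
      · have hii : ‖(g * k).val i i + (g * k).val i j‖ = ‖(g * k).val i j‖ := by
          rw [IsUltrametricDist.norm_add_eq_max_of_norm_ne_norm hlt.ne, max_eq_right hlt.le]
        rw [← mul_assoc, mul_colOp_apply, mul_colOp_apply, Pi.single_eq_same, mul_one, hii]
        refine padic_norm_add_le (hmax b hb) ?_
        rw [norm_mul]
        exact mul_le_of_le_one_right (norm_nonneg _) (norm_single_le i b)
    set v : ι → ℚ_[p] := fun b => if r b < r i then -((g * k₁).val i b / (g * k₁).val i i) else 0
    have hv : v i = 0 := by simp [v]
    refine ⟨k₁ * colOp i v hv, mul_mem hk₁ (colOp_mem _ _ hv fun b => ?_), fun a b ha hb => ?_⟩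
    · simp only [v]
      split_ifs with hb
      · rw [norm_neg, norm_div]
        exact div_le_one_of_le₀ (hmax₁ b hb.le) (norm_nonneg _)
      · simp
    · rw [← mul_assoc, mul_colOp_apply]
      rcases ha.lt_or_eq with ha | ha
      · rw [h₁ a b ha hb, h₁ a i ha ha]; simp
      · obtain rfl := hr ha
        simp only [v, if_pos hb]
        -- A zero pivot is maximal, so the entries to be cleared are already zero.
        by_cases h0 : (g * k₁).val i i = 0
        · have := hmax₁ b hb.le
          rw [h0, norm_zero] at this
          rw [norm_le_zero_iff.1 this]; simp
        · field_simp; ring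

/-- Elimination with complete pivoting: an entry of maximal norm divides all others over `ℤ_p`, so
the multipliers are integral. The finite set `s` consists of the indices whose row and column are
already reduced to the diagonal entry. -/
theorem exists_mul_mul_diagonal (g : GL ι ℚ_[p]) (s : Finset ι) :
    ∃ k₁ ∈ congruenceSubgroup p ι 0, ∃ k₂ ∈ congruenceSubgroup p ι 0, ∀ i ∈ s, ∀ j, j ≠ i →
      (k₁ * g * k₂).val i j = 0 ∧ (k₁ * g * k₂).val j i = 0 := by
  induction s using Finset.induction_on with
  | empty => exact ⟨1, one_mem _, 1, one_mem _, by simp⟩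
  | insert c s hc ih =>
    obtain ⟨k₁, hk₁, k₂, hk₂, h⟩ := ih
    -- The maximal entry of the remaining block is brought to `(c, c)` by adding one row and one
    -- column, each only when this strictly increases the norm.
    obtain ⟨k₁, hk₁, k₂, hk₂, h, hmax⟩ : ∃ k₁ ∈ congruenceSubgroup p ι 0,
        ∃ k₂ ∈ congruenceSubgroup p ι 0, (∀ i ∈ s, ∀ j, j ≠ i →
          (k₁ * g * k₂).val i j = 0 ∧ (k₁ * g * k₂).val j i = 0) ∧
        ∀ a b, a ∉ s → b ∉ s → ‖(k₁ * g * k₂).val a b‖ ≤ ‖(k₁ * g * k₂).val c c‖ := by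
      obtain ⟨⟨a, b⟩, hab, hmax⟩ := Finset.exists_max_image (sᶜ ×ˢ sᶜ)
        (fun x : ι × ι => ‖(k₁ * g * k₂).val x.1 x.2‖) ⟨(c, c), by simp [hc]⟩
      have hab : a ∉ s ∧ b ∉ s := by simpa using hab
      have hmax : ∀ a' b', a' ∉ s → b' ∉ s →
          ‖(k₁ * g * k₂).val a' b'‖ ≤ ‖(k₁ * g * k₂).val a b‖ :=
        fun a' b' h1 h2 => hmax (a', b') (by simp [h1, h2])
      obtain ⟨k₁, hk₁, h, hmax⟩ : ∃ k₁ ∈ congruenceSubgroup p ι 0, (∀ i ∈ s, ∀ j, j ≠ i →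
          (k₁ * g * k₂).val i j = 0 ∧ (k₁ * g * k₂).val j i = 0) ∧
          ∀ a' b', a' ∉ s → b' ∉ s →
            ‖(k₁ * g * k₂).val a' b'‖ ≤ ‖(k₁ * g * k₂).val c b‖ := by
        rcases (hmax c b hc hab.2).lt_or_eq with hlt | heq
        swap
        · exact ⟨k₁, hk₁, h, heq ▸ hmax⟩
        have hac : a ≠ c := by rintro rfl; exact lt_irrefl _ hlt
        have hs : (Pi.single c 1 : ι → ℚ_[p]) a = 0 := by simp [hac]
        refine ⟨rowOp a _ hs * k₁, mul_mem (rowOp_mem _ _ hs (norm_single_le c)) hk₁,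
          fun i hi j hj => ?_, fun a' b' ha' hb' => ?_⟩
        · have hic : i ≠ c := by rintro rfl; exact hc hi
          have hia : a ≠ i := by rintro rfl; exact hab.1 hi
          rw [mul_assoc, mul_assoc, rowOp_mul_apply, rowOp_mul_apply, ← mul_assoc, (h i hi j hj).1,
            (h i hi j hj).2, (h i hi a hia).2]
          simp [hic]
        · have hcb : ‖(k₁ * g * k₂).val c b + (k₁ * g * k₂).val a b‖ =
              ‖(k₁ * g * k₂).val a b‖ := by
            rw [IsUltrametricDist.norm_add_eq_max_of_norm_ne_norm hlt.ne, max_eq_right hlt.le]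
          rw [mul_assoc, mul_assoc, rowOp_mul_apply, rowOp_mul_apply, Pi.single_eq_same, one_mul,
            ← mul_assoc, hcb]
          refine padic_norm_add_le (hmax _ _ ha' hb') ?_
          rw [norm_mul]
          exact (mul_le_of_le_one_left (norm_nonneg _) (norm_single_le c a')).trans
            (hmax _ _ hab.1 hb')
      rcases (hmax c c hc hc).lt_or_eq with hlt | heq
      swap
      · exact ⟨k₁, hk₁, k₂, hk₂, h, heq ▸ hmax⟩
      have hbc : b ≠ c := by rintro rfl; exact lt_irrefl _ hlt
      have hs : (Pi.single c 1 : ι → ℚ_[p]) b = 0 := by simp [hbc]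
      refine ⟨k₁, hk₁, k₂ * colOp b _ hs, mul_mem hk₂ (colOp_mem _ _ hs (norm_single_le c)),
        fun i hi j hj => ?_, fun a' b' ha' hb' => ?_⟩
      · have hic : i ≠ c := by rintro rfl; exact hc hi
        have hib : b ≠ i := by rintro rfl; exact hab.2 hi
        rw [← mul_assoc, mul_colOp_apply, mul_colOp_apply, (h i hi j hj).1,
          (h i hi j hj).2, (h i hi b hib).1]
        simp [hic]
      · have hcb : ‖(k₁ * g * k₂).val c c + (k₁ * g * k₂).val c b‖ =
            ‖(k₁ * g * k₂).val c b‖ := by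
          rw [IsUltrametricDist.norm_add_eq_max_of_norm_ne_norm hlt.ne, max_eq_right hlt.le]
        rw [← mul_assoc, mul_colOp_apply, mul_colOp_apply, Pi.single_eq_same, mul_one, hcb]
        refine padic_norm_add_le (hmax _ _ ha' hb') ?_
        rw [norm_mul]
        exact (mul_le_of_le_one_right (norm_nonneg _) (norm_single_le c b')).trans
          (hmax _ _ ha' hab.2)
    set B := k₁ * g * k₂
    set u : ι → ℚ_[p] := fun a => if a = c then 0 else -(B.val a c / B.val c c)
    set v : ι → ℚ_[p] := fun b => if b = c then 0 else -(B.val c b / B.val c c)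
    have hu : u c = 0 := by simp [u]
    have hv : v c = 0 := by simp [v]
    have hus : ∀ i ∈ s, u i = 0 := fun i hi => by
      have hic : c ≠ i := by rintro rfl; exact hc hi
      simp [u, (h i hi c hic).1]
    have hvs : ∀ i ∈ s, v i = 0 := fun i hi => by
      have hic : c ≠ i := by rintro rfl; exact hc hi
      simp [v, (h i hi c hic).2]
    have hu1 : ∀ a, ‖u a‖ ≤ 1 := fun a => by
      by_cases ha : a ∈ s
      · simp [hus a ha]
      simp only [u]
      split_ifs with hac
      · simp
      · rw [norm_neg, norm_div]
        exact div_le_one_of_le₀ (hmax a c ha hc) (norm_nonneg _)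
    have hv1 : ∀ a, ‖v a‖ ≤ 1 := fun a => by
      by_cases ha : a ∈ s
      · simp [hvs a ha]
      simp only [v]
      split_ifs with hac
      · simp
      · rw [norm_neg, norm_div]
        exact div_le_one_of_le₀ (hmax c a hc ha) (norm_nonneg _)
    have hBu : ∀ a, a ≠ c → B.val a c + u a * B.val c c = 0 := fun a hac => by
      by_cases h0 : B.val c c = 0
      · by_cases ha : a ∈ s
        · rw [h0, (h a ha c (fun h => hac h.symm)).1]; simp
        · have := hmax a c ha hc
          rw [h0, norm_zero] at this
          rw [norm_le_zero_iff.1 this, h0]; simp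
      · simp only [u, if_neg hac]; field_simp; ring
    have hBv : ∀ a, a ≠ c → B.val c a + B.val c c * v a = 0 := fun a hac => by
      by_cases h0 : B.val c c = 0
      · by_cases ha : a ∈ s
        · rw [h0, (h a ha c (fun h => hac h.symm)).2]; simp
        · have := hmax c a hc ha
          rw [h0, norm_zero] at this
          rw [norm_le_zero_iff.1 this, h0]; simp
      · simp only [v, if_neg hac]; field_simp; ring
    refine ⟨rowOp c u hu * k₁, mul_mem (rowOp_mem _ _ hu hu1) hk₁, k₂ * colOp c v hv,
      mul_mem hk₂ (colOp_mem _ _ hv hv1), fun i hi j hj => ?_⟩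
    have hform : ∀ a b, (rowOp c u hu * k₁ * g * (k₂ * colOp c v hv)).val a b =
        B.val a b + u a * B.val c b + (B.val a c + u a * B.val c c) * v b := fun a b => by
      rw [show rowOp c u hu * k₁ * g * (k₂ * colOp c v hv) = rowOp c u hu * B * colOp c v hv by
        simp only [B, mul_assoc], mul_colOp_apply, rowOp_mul_apply, rowOp_mul_apply]
    rw [hform, hform]
    rcases Finset.mem_insert.1 hi with rfl | hi
    · rw [hu, hv, hBu j hj]
      simpa using hBv j hj
    · have hic : c ≠ i := by rintro rfl; exact hc hi
      rw [hus i hi, hvs i hi, (h i hi j hj).1, (h i hi j hj).2, (h i hi c hic).1,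
        (h i hi c hic).2]
      simp

/-- The Cartan decomposition of integral matrices. -/
theorem exists_cartan (g : GL ι ℚ_[p]) (hg : EntriesLE 1 g.val) :
    ∃ k₁ ∈ congruenceSubgroup p ι 0, ∃ k₂ ∈ congruenceSubgroup p ι 0, ∃ l : ι → ℕ,
      g = k₁ * diagGL (fun i => pUnit p ^ l i) * k₂ := by
  obtain ⟨k₁, hk₁, k₂, hk₂, h⟩ := exists_mul_mul_diagonal g Finset.univ
  set D := k₁ * g * k₂
  have hD : D.val = Matrix.diagonal fun i => D.val i i := by
    ext i j
    rw [Matrix.diagonal_apply]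
    split_ifs with hij
    · rw [hij]
    · exact (h i (Finset.mem_univ _) j (Ne.symm hij)).1
  have hD0 : ∀ i, D.val i i ≠ 0 := by
    have h1 := D.isUnit.map Matrix.detMonoidHom
    simp only [Matrix.coe_detMonoidHom] at h1
    rw [hD, Matrix.det_diagonal] at h1
    exact fun i => Finset.prod_ne_zero_iff.1 h1.ne_zero i (Finset.mem_univ i)
  have hD1 : EntriesLE 1 D.val := by
    have := ((hk₁.1.mul zero_le_one zero_le_one hg).mul (by simp) zero_le_one hk₂.1)
    simpa [D] using this
  have hl : ∀ i, ∃ l : ℕ, ‖D.val i i‖ = (p : ℝ) ^ (-(l : ℤ)) := fun i => by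
    have := hD1 i i
    rw [Padic.norm_le_one_iff_val_nonneg] at this
    obtain ⟨l, hl⟩ := Int.eq_ofNat_of_zero_le this
    exact ⟨l, by rw [Padic.norm_eq_zpow_neg_valuation (hD0 i), hl]⟩
  choose l hl using hl
  have hp : ‖(p : ℚ_[p])‖ = (p : ℝ)⁻¹ := Padic.norm_p
  -- `U` collects the unit parts of the diagonal entries and is absorbed into the right factor.
  set U : GL ι ℚ_[p] := diagGL (fun i => (pUnit p ^ l i)⁻¹ * Units.mk0 _ (hD0 i))
  have hu : ∀ i, ‖((pUnit p ^ l i)⁻¹ : ℚ_[p]ˣ) * D.val i i‖ = 1 := fun i => by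
    have hp0 : (p : ℝ) ≠ 0 := by exact_mod_cast (Fact.out : p.Prime).ne_zero
    rw [norm_mul, hl, Units.val_inv_eq_inv_val, norm_inv, Units.val_pow_eq_pow_val, norm_pow]
    simp [pUnit, hp0]
  have hU : U ∈ congruenceSubgroup p ι 0 := by
    refine mem_congruenceSubgroup_zero.2 ⟨fun i j => ?_, ?_⟩
    · simp only [U, diagGL, Matrix.diagonal_apply]
      split_ifs
      · simpa using (hu i).le
      · simp
    · simp only [U, diagGL, Matrix.det_diagonal, norm_prod]
      exact Finset.prod_eq_one fun i _ => by simpa using hu i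
  refine ⟨k₁⁻¹, inv_mem hk₁, U * k₂⁻¹, mul_mem hU (inv_mem hk₂), l, ?_⟩
  have : diagGL (fun i => pUnit p ^ l i) * U = D := by
    ext1
    rw [Units.val_mul, hD]
    simp [diagGL, U, Matrix.diagonal_mul_diagonal]
  rw [show k₁⁻¹ * diagGL (fun i => pUnit p ^ l i) * (U * k₂⁻¹) =
    k₁⁻¹ * (diagGL (fun i => pUnit p ^ l i) * U) * k₂⁻¹ by simp only [mul_assoc], this]
  simp [D, mul_assoc]

end Decompositions

/-! ### Topology of `GL` over `ℚ_p`: congruence subgroups are open and compact -/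

section Topology

variable {p : ℕ} [Fact p.Prime] {ι : Type*} [Fintype ι] [DecidableEq ι]

instance : LocallyCompactSpace (GL ι ℚ_[p]) :=
  have : LocallyCompactSpace (Matrix ι ι ℚ_[p]) :=
    inferInstanceAs (LocallyCompactSpace (ι → ι → ℚ_[p]))
  inferInstanceAs (LocallyCompactSpace (Matrix ι ι ℚ_[p])ˣ)

instance : SecondCountableTopology (GL ι ℚ_[p]) :=
  have : SecondCountableTopology (Matrix ι ι ℚ_[p]) :=
    inferInstanceAs (SecondCountableTopology (ι → ι → ℚ_[p]))
  have : SecondCountableTopology (Matrix ι ι ℚ_[p])ᵐᵒᵖ :=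
    MulOpposite.opHomeomorph.symm.isEmbedding.secondCountableTopology
  Units.isEmbedding_embedProduct.secondCountableTopology

theorem continuous_apply_GL (i j : ι) : Continuous fun g : GL ι ℚ_[p] => g.val i j :=
  Units.continuous_val.matrix_elem i j

theorem continuous_det_GL : Continuous fun g : GL ι ℚ_[p] => g.val.det :=
  Units.continuous_val.matrix_det

theorem isOpen_entriesLE_sub {e : ℝ} (he : 0 < e) (A : Matrix ι ι ℚ_[p]) :
    IsOpen {g : GL ι ℚ_[p] | EntriesLE e (g.val - A)} := by
  have : {g : GL ι ℚ_[p] | EntriesLE e (g.val - A)} =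
      ⋂ i, ⋂ j, (fun g : GL ι ℚ_[p] => g.val i j) ⁻¹' Metric.closedBall (A i j) e := by
    ext g; simp [EntriesLE, dist_eq_norm]
  rw [this]
  exact isOpen_iInter_of_finite fun i => isOpen_iInter_of_finite fun j =>
    (IsUltrametricDist.isOpen_closedBall _ he.ne').preimage (continuous_apply_GL i j)

/-- The determinant is close to the product of the diagonal entries, which is close to `1` factor by
factor; the index set is ordered only to apply `norm_det_sub_prod_le`. -/
theorem norm_det_sub_one_le {A : Matrix ι ι ℚ_[p]} {e : ℝ} (he : 0 ≤ e) (he1 : e ≤ 1)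
    (hA : EntriesLE e (A - 1)) : ‖A.det - 1‖ ≤ e := by
  let φ := Fintype.equivFin ι
  have hA1 : EntriesLE 1 A := by simpa using (hA.mono he1).add EntriesLE.one
  have hd : ∀ i, ‖A i i - 1‖ ≤ e := fun i => by simpa using hA i i
  have h1 := norm_det_sub_prod_le (A := A.reindex φ φ) he (fun i j => hA1 _ _) fun i j hij => by
    have : φ.symm i ≠ φ.symm j := fun h => hij.ne' (φ.symm.injective h)
    simpa [Matrix.one_apply_ne this] using hA (φ.symm i) (φ.symm j)
  rw [Matrix.det_reindex_self] at h1
  have h2 : ∀ s : Finset (Fin (Fintype.card ι)),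
      ‖∏ i ∈ s, (A.reindex φ φ) i i - 1‖ ≤ e := fun s => by
    induction s using Finset.induction_on with
    | empty => simpa using he
    | insert i s hi ih =>
      rw [Finset.prod_insert hi, show ∀ a b : ℚ_[p], a * b - 1 = a * (b - 1) + (a - 1) by
        intros; ring]
      refine padic_norm_add_le ?_ (hd _)
      rw [norm_mul]
      exact (mul_le_of_le_one_left (norm_nonneg _) (hA1 _ _)).trans ih
  simpa using padic_norm_add_le h1 (h2 Finset.univ)

theorem mem_congruenceSubgroup_of_pos {m : ℕ} (hm : 1 ≤ m) {g : GL ι ℚ_[p]} :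
    g ∈ congruenceSubgroup p ι m ↔ EntriesLE ((p : ℝ) ^ (-(m : ℤ))) (g.val - 1) := by
  rw [mem_congruenceSubgroup]
  refine ⟨fun h => h.2.2, fun h => ⟨?_, ?_, h⟩⟩
  · simpa using (h.mono (zpow_neg_le_one m)).add EntriesLE.one
  · exact norm_eq_one_of_norm_sub_lt norm_one
      ((norm_det_sub_one_le (by positivity) (zpow_neg_le_one m) h).trans_lt (zpow_neg_lt_one hm))

theorem prime_zpow_pos (m : ℤ) : 0 < (p : ℝ) ^ m := by
  have : (0 : ℝ) < p := by exact_mod_cast (Fact.out : p.Prime).pos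
  positivity

variable (p ι) in
theorem isOpen_congruenceSubgroup (m : ℕ) :
    IsOpen (congruenceSubgroup p ι m : Set (GL ι ℚ_[p])) := by
  have key : ∀ m, 1 ≤ m → IsOpen (congruenceSubgroup p ι m : Set (GL ι ℚ_[p])) := fun m hm => by
    have : (congruenceSubgroup p ι m : Set (GL ι ℚ_[p])) = _ :=
      Set.ext fun g => mem_congruenceSubgroup_of_pos hm
    rw [this]
    exact isOpen_entriesLE_sub (prime_zpow_pos _) 1
  rcases Nat.eq_zero_or_pos m with rfl | hm
  · exact Subgroup.isOpen_mono (congruenceSubgroup_le_zero 1) (key 1 le_rfl)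
  · exact key m hm

theorem isCompact_entriesLE (e : ℝ) : IsCompact {A : Matrix ι ι ℚ_[p] | EntriesLE e A} := by
  have : {A : Matrix ι ι ℚ_[p] | EntriesLE e A} =
      Set.univ.pi fun _ => Set.univ.pi fun _ => Metric.closedBall (0 : ℚ_[p]) e := by
    ext A
    change _ ↔ ∀ i ∈ Set.univ, ∀ j ∈ Set.univ, A i j ∈ Metric.closedBall (0 : ℚ_[p]) e
    simp [EntriesLE]
  rw [this]
  exact isCompact_univ_pi fun _ => isCompact_univ_pi fun _ => isCompact_closedBall _ _

-- Through `g ↦ (g, g⁻¹)`, level `0` becomes the closed subset `AB = BA = 1` of a product of two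
-- compact sets. The other levels are open, hence closed, subgroups of it.
variable (p ι) in
theorem isCompact_congruenceSubgroup (m : ℕ) :
    IsCompact (congruenceSubgroup p ι m : Set (GL ι ℚ_[p])) := by
  suffices h : IsCompact (congruenceSubgroup p ι 0 : Set (GL ι ℚ_[p])) from
    h.of_isClosed_subset (Subgroup.isClosed_of_isOpen _ (isOpen_congruenceSubgroup p ι m))
      (congruenceSubgroup_le_zero m)
  rw [Units.isInducing_embedProduct.isCompact_iff]
  have : (Units.embedProduct _) '' (congruenceSubgroup p ι 0 : Set (GL ι ℚ_[p])) =
      ({A | EntriesLE 1 A} ×ˢ (MulOpposite.op '' {A | EntriesLE 1 A})) ∩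
        {x | x.1 * x.2.unop = 1 ∧ x.2.unop * x.1 = 1} := by
    ext ⟨A, B⟩
    constructor
    · rintro ⟨g, hg, h⟩
      obtain ⟨rfl, rfl⟩ := Prod.ext_iff.1 h
      exact ⟨⟨hg.1, _, hg.2.1, rfl⟩, by simp, by simp⟩
    · rintro ⟨⟨h1, ⟨B, h2, rfl⟩⟩, h3, h4⟩
      refine ⟨⟨A, B, h3, h4⟩, ⟨h1, h2, ?_⟩, rfl⟩
      simpa using h1.sub EntriesLE.one
  rw [this]
  refine ((isCompact_entriesLE 1).prod
    ((isCompact_entriesLE 1).image MulOpposite.continuous_op)).inter_right ?_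
  have h1 : Continuous fun x : Matrix ι ι ℚ_[p] × (Matrix ι ι ℚ_[p])ᵐᵒᵖ => x.1 * x.2.unop :=
    continuous_fst.mul (MulOpposite.continuous_unop.comp continuous_snd)
  have h2 : Continuous fun x : Matrix ι ι ℚ_[p] × (Matrix ι ι ℚ_[p])ᵐᵒᵖ => x.2.unop * x.1 :=
    (MulOpposite.continuous_unop.comp continuous_snd).mul continuous_fst
  exact (isClosed_eq h1 continuous_const).inter (isClosed_eq h2 continuous_const)

end Topology

/-! ### Right translations by `w_n`, `z` and scalars preserve Haar measure -/

section Unimodular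

variable {p : ℕ} [Fact p.Prime]

/-- The pushforward of `μ` under a right translation is left invariant, hence a multiple of `μ`, and
the factor is the modular character. -/
theorem measurePreserving_mul_right_of_modularCharacter {G : Type*} [Group G] [TopologicalSpace G]
    [IsTopologicalGroup G] [LocallyCompactSpace G] [SecondCountableTopology G] [MeasurableSpace G]
    [BorelSpace G] (μ : Measure G) [μ.IsHaarMeasure] {g : G}
    (hg : Measure.modularCharacterFun g = 1) : MeasurePreserving (· * g) μ μ := by
  refine ⟨measurable_mul_const g, ?_⟩
  rw [Measure.isMulLeftInvariant_eq_smul (Measure.map (· * g) μ) μ,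
    ← Measure.modularCharacterFun_eq_haarScalarFactor μ g, hg, one_smul]

theorem longestWeyl_mul_self (n : ℕ) : longestWeyl p n * longestWeyl p n = 1 := by
  ext1; exact (longestWeyl p n).val_inv

theorem longestWeyl_mul_apply {n : ℕ} (A : Matrix (Fin n) (Fin n) ℚ_[p]) (i j : Fin n) :
    ((longestWeyl p n).val * A) i j = A i.rev j := by
  simp [longestWeyl, Equiv.Perm.permMatrix, PEquiv.toMatrix_toPEquiv_mul]

theorem mul_longestWeyl_apply {n : ℕ} (A : Matrix (Fin n) (Fin n) ℚ_[p]) (i j : Fin n) :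
    (A * (longestWeyl p n).val) i j = A i j.rev := by
  simp [longestWeyl, Equiv.Perm.permMatrix, PEquiv.mul_toMatrix_toPEquiv]

variable (p) in
/-- Scalar matrices. -/
noncomputable def scalarGL (n : ℕ) (c : ℚ_[p]ˣ) : GL (Fin n) ℚ_[p] := diagGL fun _ => c

theorem scalarGL_mul_apply {n : ℕ} (c : ℚ_[p]ˣ) (g : GL (Fin n) ℚ_[p]) (i j : Fin n) :
    (scalarGL p n c * g).val i j = c * g.val i j := by
  simp [scalarGL, diagGL]

theorem scalarGL_comm {n : ℕ} (c : ℚ_[p]ˣ) (g : GL (Fin n) ℚ_[p]) :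
    scalarGL p n c * g = g * scalarGL p n c := by
  ext i j; simp [scalarGL, diagGL, mul_comm]

/-- Reversing the order of the diagonal replaces the exponent `n - 1 - i` by `i`, and the two add up
to `n - 1`. -/
theorem longestWeyl_zMat (n : ℕ) :
    longestWeyl p n * zMat p n * longestWeyl p n * zMat p n =
      scalarGL p n (pUnit p ^ (n - 1)) := by
  ext i j
  have h : ((longestWeyl p n * zMat p n * longestWeyl p n).val * (zMat p n).val) i j =
      (zMat p n).val i.rev j.rev * (pUnit p ^ (n - 1 - (j : ℕ)) : ℚ_[p]ˣ) := by
    rw [zMat, diagGL, Matrix.mul_diagonal, ← diagGL, ← zMat]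
    congr 1
    rw [Units.val_mul, mul_longestWeyl_apply, Units.val_mul, longestWeyl_mul_apply]
  rw [Units.val_mul, h]
  by_cases hij : i = j
  · subst hij
    have h1 := i.2
    have h2 : (n - 1 - (i.rev : ℕ)) + (n - 1 - (i : ℕ)) = n - 1 := by rw [Fin.val_rev]; omega
    simp only [zMat, diagGL, scalarGL, Matrix.diagonal_apply_eq]
    rw [← Units.val_mul, ← pow_add, h2]
  · have : i.rev ≠ j.rev := fun h => hij (Fin.rev_injective h)
    simp [zMat, diagGL, scalarGL, hij]

variable {n : ℕ} [MeasurableSpace (GL (Fin n) ℚ_[p])] [BorelSpace (GL (Fin n) ℚ_[p])]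
    (μ : Measure (GL (Fin n) ℚ_[p])) [μ.IsHaarMeasure]

theorem modularCharacter_longestWeyl :
    Measure.modularCharacter (longestWeyl p n) = 1 := by
  have : Measure.modularCharacter (longestWeyl p n) ^ 2 = 1 := by
    rw [← map_pow, pow_two, longestWeyl_mul_self, map_one]
  exact (pow_eq_one_iff_of_nonneg zero_le two_ne_zero).1 this

theorem modularCharacter_scalarGL (c : ℚ_[p]ˣ) : Measure.modularCharacter (scalarGL p n c) = 1 := by
  borelize (GL (Fin n) ℚ_[p])
  let ν : Measure (GL (Fin n) ℚ_[p]) := Measure.haar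
  change Measure.modularCharacterFun _ = 1
  -- Right translation by a central element is left translation, so the pushed measure is `ν`. It
  -- also occurs in instance arguments and is generalised before substituting.
  have key : ∀ (ν' : Measure (GL (Fin n) ℚ_[p])) (_ : IsFiniteMeasureOnCompacts ν')
      (_ : ν'.IsMulLeftInvariant), ν' = ν → ν'.haarScalarFactor ν = 1 := by
    rintro _ _ _ rfl; exact Measure.haarScalarFactor_self _
  rw [Measure.modularCharacterFun_eq_haarScalarFactor ν]
  refine key _ _ _ ?_
  rw [show (fun x => x * scalarGL p n c) = fun x => scalarGL p n c * x from
      funext fun x => (scalarGL_comm c x).symm, map_mul_left_eq_self]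

/-- Since `w_n z w_n z` is a scalar matrix, the square of the character at `z` is `1`; its values
are nonnegative. The full unimodularity of `GL_n` is not needed. -/
theorem modularCharacter_zMat : Measure.modularCharacter (zMat p n) = 1 := by
  have h := congrArg Measure.modularCharacter (longestWeyl_zMat (p := p) n)
  rw [map_mul, map_mul, map_mul, modularCharacter_longestWeyl, modularCharacter_scalarGL, one_mul,
    mul_one, ← pow_two] at h
  exact (pow_eq_one_iff_of_nonneg zero_le two_ne_zero).1 h

theorem measurePreserving_mul_right {g : GL (Fin n) ℚ_[p]}
    (hg : Measure.modularCharacter g = 1) : MeasurePreserving (· * g) μ μ :=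
  measurePreserving_mul_right_of_modularCharacter μ hg

end Unimodular

/-! ### Functions on `ℤ_p` modulo `p^m` -/

section Residues

variable {p : ℕ} [Fact p.Prime]

instance (m : ℕ) : NeZero (p ^ m) := ⟨pow_ne_zero _ (Fact.out : p.Prime).ne_zero⟩

theorem norm_natCast_sub_le_iff (m a b : ℕ) :
    ‖(a : ℚ_[p]) - b‖ ≤ (p : ℝ) ^ (-(m : ℤ)) ↔ (a : ZMod (p ^ m)) = b := by
  have h := Padic.norm_int_le_pow_iff_dvd (p := p) ((a : ℤ) - b) m
  push_cast at h
  rw [h]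
  have h2 := ZMod.intCast_eq_intCast_iff_dvd_sub (b : ℤ) (a : ℤ) (p ^ m)
  push_cast at h2
  rw [← h2, eq_comm]

theorem norm_natCast_le_one (a : ℕ) : ‖(a : ℚ_[p])‖ ≤ 1 := by
  simpa using Padic.norm_int_le_one (p := p) (a : ℤ)

theorem exists_natCast_norm_sub_le (m : ℕ) {x : ℚ_[p]} (hx : ‖x‖ ≤ 1) :
    ∃ a : ℕ, ‖x - a‖ ≤ (p : ℝ) ^ (-(m : ℤ)) := by
  refine ⟨PadicInt.appr ⟨x, hx⟩ m, ?_⟩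
  have := PadicInt.appr_spec m (⟨x, hx⟩ : ℤ_[p])
  rw [← PadicInt.norm_le_pow_iff_mem_span_pow, PadicInt.norm_def] at this
  exact this

theorem exists_zmod_norm_sub_le (m : ℕ) {x : ℚ_[p]} (hx : ‖x‖ ≤ 1) :
    ∃ a : ZMod (p ^ m), ‖x - a.val‖ ≤ (p : ℝ) ^ (-(m : ℤ)) := by
  obtain ⟨a, ha⟩ := exists_natCast_norm_sub_le m hx
  refine ⟨a, ?_⟩
  rw [← sub_add_sub_cancel x a]
  refine padic_norm_add_le ha ((norm_natCast_sub_le_iff m _ _).2 ?_)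
  simp

theorem zmod_eq_of_norm_sub_le {m : ℕ} {x : ℚ_[p]} {a b : ZMod (p ^ m)}
    (ha : ‖x - a.val‖ ≤ (p : ℝ) ^ (-(m : ℤ))) (hb : ‖x - b.val‖ ≤ (p : ℝ) ^ (-(m : ℤ))) :
    a = b := by
  have : ‖(a.val : ℚ_[p]) - b.val‖ ≤ (p : ℝ) ^ (-(m : ℤ)) := by
    rw [show (a.val : ℚ_[p]) - b.val = (x - b.val) - (x - a.val) by ring]
    exact padic_norm_sub_le hb ha
  simpa using (norm_natCast_sub_le_iff m _ _).1 this

/-- `h` is supported on `ℤ_p` and invariant under translations by `p^m ℤ_p`. -/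
def IsResidual (p : ℕ) [Fact p.Prime] (m : ℕ) (h : ℚ_[p] → ℂ) : Prop :=
  (∀ x, ¬‖x‖ ≤ 1 → h x = 0) ∧ ∀ x y, ‖x - y‖ ≤ (p : ℝ) ^ (-(m : ℤ)) → h x = h y

/-- An integral `x` lies in exactly one residue class and a non-integral `x` in none. In this form
products over matrix entries can be expanded into sums over matrices of residues. -/
theorem IsResidual.eq_sum {m : ℕ} {h : ℚ_[p] → ℂ} (hh : IsResidual p m h) (x : ℚ_[p]) :
    h x = ∑ a : ZMod (p ^ m),
      if ‖x - a.val‖ ≤ (p : ℝ) ^ (-(m : ℤ)) then h a.val else 0 := by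
  by_cases hx : ‖x‖ ≤ 1
  · obtain ⟨a, ha⟩ := exists_zmod_norm_sub_le m hx
    rw [Finset.sum_eq_single a, if_pos ha]
    · exact hh.2 _ _ ha
    · exact fun b _ hb => if_neg fun hb' => hb (zmod_eq_of_norm_sub_le hb' ha)
    · simp
  · rw [hh.1 x hx, eq_comm]
    refine Finset.sum_eq_zero fun a _ => if_neg fun ha => hx ?_
    rw [← sub_add_cancel x a.val]
    exact padic_norm_add_le (ha.trans (zpow_neg_le_one m)) (norm_natCast_le_one _)

/-- Sum over the residue classes modulo `p^m`. -/
noncomputable def residueSum (p : ℕ) [Fact p.Prime] (m : ℕ) (h : ℚ_[p] → ℂ) : ℂ :=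
  ∑ a : ZMod (p ^ m), h a.val

end Residues

/-! ### Haar integrals and volumes by counting residues -/

section Cosets

variable {p : ℕ} [Fact p.Prime] {ι : Type*} [Fintype ι] [DecidableEq ι]
  [MeasurableSpace (GL ι ℚ_[p])] [BorelSpace (GL ι ℚ_[p])]
  (μ : Measure (GL ι ℚ_[p])) [μ.IsHaarMeasure]

theorem measure_congruenceSubgroup_lt_top (m : ℕ) :
    μ (congruenceSubgroup p ι m : Set (GL ι ℚ_[p])) < ⊤ :=
  (isCompact_congruenceSubgroup p ι m).measure_lt_top

/-- The ball around an element of `GL(ℤ_p)` is its left coset of the congruence subgroup. -/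
theorem measure_entriesLE_sub {m : ℕ} (hm : 1 ≤ m) {A : Matrix ι ι ℚ_[p]} (hA : EntriesLE 1 A)
    (hdet : ‖A.det‖ = 1) :
    μ {g : GL ι ℚ_[p] | EntriesLE ((p : ℝ) ^ (-(m : ℤ))) (g.val - A)} =
      μ (congruenceSubgroup p ι m : Set (GL ι ℚ_[p])) := by
  have hne : A.det ≠ 0 := fun h => by simp [h] at hdet
  let a : GL ι ℚ_[p] := Matrix.GeneralLinearGroup.mkOfDetNeZero A hne
  have ha : a.val = A := rfl
  have ha' : EntriesLE 1 a⁻¹.val := by simpa [ha, hdet] using norm_inv_apply_le (g := a) hA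
  have : {g : GL ι ℚ_[p] | EntriesLE ((p : ℝ) ^ (-(m : ℤ))) (g.val - A)} =
      (fun g => a⁻¹ * g) ⁻¹' (congruenceSubgroup p ι m : Set (GL ι ℚ_[p])) := by
    ext g
    rw [Set.mem_preimage, SetLike.mem_coe, mem_congruenceSubgroup_of_pos hm, Set.mem_ofPred_eq]
    have h1 : (a⁻¹ * g).val - 1 = a⁻¹.val * (g.val - A) := by
      rw [mul_sub, ← ha, ← Units.val_mul, ← Units.val_mul]; simp
    have h2 : g.val - A = A * ((a⁻¹ * g).val - 1) := by
      rw [h1, ← mul_assoc, ← ha, ← Units.val_mul]; simp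
    have hp := (prime_zpow_pos (p := p) (-(m : ℤ))).le
    refine ⟨fun h => ?_, fun h => ?_⟩
    · rw [h1]; simpa using ha'.mul zero_le_one hp h
    · rw [h2]; simpa using hA.mul zero_le_one hp h
  rw [this, measure_preimage_mul]

/-- Integration of a product of functions of the entries which only depend on the entries
modulo `p^m`. -/
theorem integral_prod_entries {m : ℕ} (hm : 1 ≤ m) (h : ι → ι → ℚ_[p] → ℂ)
    (hh : ∀ i j, IsResidual p m (h i j))
    (hdet : ∀ A : Matrix ι ι ℚ_[p], (∀ i j, h i j (A i j) ≠ 0) → ‖A.det‖ = 1) :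
    ∫ g : GL ι ℚ_[p], ∏ i, ∏ j, h i j (g.val i j) ∂μ =
      μ.real (congruenceSubgroup p ι m : Set (GL ι ℚ_[p])) *
        ∏ i, ∏ j, residueSum p m (h i j) := by
  classical
  let C : (ι → ι → ZMod (p ^ m)) → Set (GL ι ℚ_[p]) := fun a =>
    {g | EntriesLE ((p : ℝ) ^ (-(m : ℤ))) (g.val - Matrix.of fun i j => ((a i j).val : ℚ_[p]))}
  have hC : ∀ a, MeasurableSet (C a) := fun a =>
    (isOpen_entriesLE_sub (prime_zpow_pos _) _).measurableSet
  let w : (ι → ι → ZMod (p ^ m)) → ℂ := fun a => ∏ i, ∏ j, h i j (a i j).val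
  have hpt : ∀ g : GL ι ℚ_[p], ∏ i, ∏ j, h i j (g.val i j) =
      ∑ a, (C a).indicator (fun _ => w a) g := fun g => by
    simp_rw [fun i j => (hh i j).eq_sum (g.val i j)]
    simp_rw [Finset.prod_univ_sum, Fintype.piFinset_univ]
    refine Finset.sum_congr rfl fun a _ => ?_
    by_cases hg : g ∈ C a
    · rw [Set.indicator_of_mem hg]
      exact Finset.prod_congr rfl fun i _ => Finset.prod_congr rfl fun j _ => if_pos (hg i j)
    · rw [Set.indicator_of_notMem hg]
      simp only [C, EntriesLE, Set.mem_ofPred_eq, not_forall] at hg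
      obtain ⟨i, j, hij⟩ := hg
      exact Finset.prod_eq_zero (Finset.mem_univ i) (Finset.prod_eq_zero (Finset.mem_univ j)
        (if_neg hij))
  -- Only classes of nonzero weight matter, and `hdet` makes their representatives invertible over
  -- `ℤ_p`.
  have hw : ∀ a, w a ≠ 0 → μ (C a) = μ (congruenceSubgroup p ι m : Set (GL ι ℚ_[p])) :=
    fun a ha => measure_entriesLE_sub μ hm (fun i j => norm_natCast_le_one _) <| hdet _
      fun i j => (Finset.prod_ne_zero_iff.1 (Finset.prod_ne_zero_iff.1 ha i (Finset.mem_univ i)) j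
        (Finset.mem_univ j))
  simp_rw [hpt]
  rw [integral_finsetSum]
  · simp_rw [residueSum, Finset.prod_univ_sum, Fintype.piFinset_univ, Finset.mul_sum]
    refine Finset.sum_congr rfl fun a _ => ?_
    rw [integral_indicator_const _ (hC a)]
    by_cases ha : w a = 0
    · rw [ha, smul_zero]; exact (mul_eq_zero_of_right _ ha).symm
    · rw [Measure.real, hw a ha, Complex.real_smul]; rfl
  · intro a _
    by_cases ha : w a = 0
    · simp [ha]
    · refine (integrable_indicator_iff (hC a)).2 (integrableOn_const ?_)
      rw [hw a ha]
      exact (measure_congruenceSubgroup_lt_top μ m).ne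

/-- The integral matrices with determinant of valuation `v` have at most exponential volume. -/
theorem measure_integral_det_le (v : ℕ) :
    μ {g : GL ι ℚ_[p] | EntriesLE 1 g.val ∧ ‖g.val.det‖ = (p : ℝ) ^ (-(v : ℤ))} ≤
      ((p ^ (v + 1)) ^ (Fintype.card ι * Fintype.card ι) : ℕ) *
        μ (congruenceSubgroup p ι 1 : Set (GL ι ℚ_[p])) := by
  classical
  set S := {g : GL ι ℚ_[p] | EntriesLE 1 g.val ∧ ‖g.val.det‖ = (p : ℝ) ^ (-(v : ℤ))}
  let C : (ι → ι → ZMod (p ^ (v + 1))) → Set (GL ι ℚ_[p]) := fun a =>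
    {g | EntriesLE ((p : ℝ) ^ (-((v + 1 : ℕ) : ℤ)))
      (g.val - Matrix.of fun i j => ((a i j).val : ℚ_[p]))}
  have hp0 : (p : ℝ) ≠ 0 := by exact_mod_cast (Fact.out : p.Prime).ne_zero
  have hcov : S ⊆ ⋃ a, S ∩ C a := fun g hg => by
    choose a ha using fun i j => exists_zmod_norm_sub_le (v + 1) (hg.1 i j)
    exact Set.mem_iUnion.2 ⟨a, hg, fun i j => ha i j⟩
  -- For `y` in `S` the entries of `y⁻¹` have norm at most `p^v`, so elements congruent to `y`
  -- modulo `p^(v+1)` lie in `y` times the congruence subgroup of level `1`.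
  have hle : ∀ a, μ (S ∩ C a) ≤ μ (congruenceSubgroup p ι 1 : Set (GL ι ℚ_[p])) := fun a => by
    rcases (S ∩ C a).eq_empty_or_nonempty with h | ⟨y, hyS, hyC⟩
    · simp [h]
    rw [← measure_preimage_mul μ y⁻¹ (congruenceSubgroup p ι 1 : Set (GL ι ℚ_[p]))]
    refine measure_mono fun g hg => ?_
    rw [Set.mem_preimage, SetLike.mem_coe, mem_congruenceSubgroup_of_pos le_rfl]
    have h1 : (y⁻¹ * g).val - 1 = y⁻¹.val * (g.val - y.val) := by
      rw [mul_sub, ← Units.val_mul, ← Units.val_mul]; simp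
    have h2 : EntriesLE ((p : ℝ) ^ (-((v + 1 : ℕ) : ℤ))) (g.val - y.val) := by
      have := EntriesLE.sub hg.2 hyC
      rwa [sub_sub_sub_cancel_right] at this
    have h3 := (norm_inv_apply_le hyS.1).mul (by positivity) (prime_zpow_pos _).le h2
    rw [h1]
    convert h3 using 1
    rw [hyS.2, ← zpow_neg, ← zpow_add₀ hp0]
    congr 1
    push_cast; ring
  calc μ S ≤ ∑ a, μ (S ∩ C a) := (measure_mono hcov).trans (measure_iUnion_fintype_le _ _)
    _ ≤ ∑ _a : ι → ι → ZMod (p ^ (v + 1)), μ (congruenceSubgroup p ι 1 : Set (GL ι ℚ_[p])) :=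
      Finset.sum_le_sum fun a _ => hle a
    _ = _ := by
      rw [Finset.sum_const, Finset.card_univ, nsmul_eq_mul]
      simp [ZMod.card, pow_mul]

end Cosets

/-! ### Finite dimensionality of fixed vectors in the principal series -/

section FiniteDimension

theorem exists_finset_cover {G : Type*} [Group G] [TopologicalSpace G] [IsTopologicalGroup G]
    {K U : Subgroup G} (hK : IsCompact (K : Set G)) (hU : IsOpen (U : Set G)) :
    ∃ R : Finset G, ∀ k ∈ K, ∃ x ∈ R, x ∈ K ∧ x⁻¹ * k ∈ U := by
  obtain ⟨R, hRK, hR⟩ := hK.elim_nhds_subcover (fun x => (fun y => x⁻¹ * y) ⁻¹' (U : Set G))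
    fun x _ => (hU.preimage (continuous_const_mul x⁻¹)).mem_nhds (by simp)
  refine ⟨R, fun k hk => ?_⟩
  obtain ⟨x, hx, hxk⟩ := Set.mem_iUnion₂.1 (hR hk)
  exact ⟨x, hx, hRK x hx, hxk⟩

/-- The vectors fixed by a subgroup. -/
def fixedSubmodule {G V : Type*} [Group G] [AddCommGroup V] [Module ℂ V]
    (ρ : Representation ℂ G V) (K : Subgroup G) : Submodule ℂ V where
  carrier := {f | ∀ k ∈ K, ρ k f = f}
  zero_mem' := by simp
  add_mem' := fun ha hb k hk => by rw [map_add, ha k hk, hb k hk]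
  smul_mem' := fun c f hf k hk => by rw [map_smul, hf k hk]

variable {p : ℕ} [Fact p.Prime] {n : ℕ}

theorem diag_ne_zero_of_triangular {ι : Type*} [Fintype ι] [DecidableEq ι] (r : ι → ℕ)
    (hr : Function.Injective r) (g : GL ι ℚ_[p]) (hg : ∀ a b, r b < r a → g.val a b = 0) (i : ι) :
    g.val i i ≠ 0 := by
  have h1 := g.isUnit.map Matrix.detMonoidHom
  simp only [Matrix.coe_detMonoidHom] at h1
  let : LinearOrder ι := LinearOrder.lift' r hr
  have h2 : g.val.BlockTriangular id := fun a b hab => hg a b hab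
  rw [show g.val.det = ∏ i, g.val i i by convert Matrix.det_of_isUpperTriangular h2] at h1
  exact Finset.prod_ne_zero_iff.1 h1.ne_zero i (Finset.mem_univ i)

variable (n) in
theorem pos_injective : Function.Injective (pos n) := by
  rintro (a | a) (b | b) h <;> simp only [pos, Sum.elim_inl, Sum.elim_inr] at h
  · exact congrArg Sum.inl (Fin.ext h)
  · have := a.2; omega
  · have := b.2; omega
  · exact congrArg Sum.inr (Fin.ext (by omega))

theorem exists_diag_mul_unipotent (b : G2 p n) (hb : ∀ i j, pos n j < pos n i → b.val i j = 0) :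
    ∃ t : Fin n ⊕ Fin n → ℚ_[p]ˣ, ∃ ν : upperUnipotent p n, b = diagGL t * ν.val := by
  have h0 := diag_ne_zero_of_triangular (pos n) (pos_injective n) b hb
  let t : Fin n ⊕ Fin n → ℚ_[p]ˣ := fun i => Units.mk0 _ (h0 i)
  have hv : ∀ i j, ((diagGL t)⁻¹ * b).val i j = (b.val i i)⁻¹ * b.val i j := fun i j => by
    change (Matrix.diagonal (fun i => ((t i)⁻¹ : ℚ_[p])) * b.val) i j = _
    rw [Matrix.diagonal_mul]; rfl
  refine ⟨t, ⟨(diagGL t)⁻¹ * b, fun i => ?_, fun i j hij => ?_⟩, by simp⟩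
  · rw [hv, inv_mul_cancel₀ (h0 i)]
  · rw [hv, hb i j hij, mul_zero]

/-- By the Iwasawa decomposition a function is determined by its values on `GL_{2n}(ℤ_p)`, and a
fixed one by its values on the finitely many cosets of the level `1` subgroup. -/
theorem finiteDimensional_principalSeries (θ : Fin n ⊕ Fin n → ℚ_[p]ˣ →* ℂˣ) :
    FiniteDimensional ℂ (fixedSubmodule (principalSeries θ).toRepresentation
      (congruenceSubgroup p (Fin n ⊕ Fin n) 1)) := by
  obtain ⟨R, hR⟩ := exists_finset_cover (isCompact_congruenceSubgroup p (Fin n ⊕ Fin n) 0)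
    (isOpen_congruenceSubgroup p (Fin n ⊕ Fin n) 1)
  let L : fixedSubmodule (principalSeries θ).toRepresentation
      (congruenceSubgroup p (Fin n ⊕ Fin n) 1) →ₗ[ℂ] (R → ℂ) :=
    { toFun := fun f x => f.val.val x.val
      map_add' := fun _ _ => rfl
      map_smul' := fun _ _ => rfl }
  refine Module.Finite.of_injective L fun f f' hf => ?_
  refine Subtype.ext (Subtype.ext (funext fun g => ?_))
  obtain ⟨k, hk, hb⟩ := exists_mul_upperTriangular (pos n) (pos_injective n) g
  obtain ⟨t, ν, hg⟩ := exists_diag_mul_unipotent (g * k) hb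
  obtain ⟨x, hxR, -, hx⟩ := hR k⁻¹ (inv_mem hk)
  have h1 : f.val.val x = f'.val.val x := congrFun hf ⟨x, hxR⟩
  have h2 : f.val.val (g * k * x) = f'.val.val (g * k * x) := by
    have e := f.val.prop.1 (t, ν) x
    have e' := f'.val.prop.1 (t, ν) x
    beta_reduce at e e'
    rw [← hg] at e e'
    rw [e, e', h1]
  have h3 : ∀ f : fixedSubmodule (principalSeries θ).toRepresentation
      (congruenceSubgroup p (Fin n ⊕ Fin n) 1), f.val.val g = f.val.val (g * k * x) := fun f => by
    have h4 := congrFun (congrArg Subtype.val (f.prop _ hx)) (g * k * x)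
    change f.val.val (g * k * x * (x⁻¹ * k⁻¹)) = f.val.val (g * k * x) at h4
    rw [← h4]
    simp [mul_assoc]
  rw [h3, h3, h2]

end FiniteDimension

/-! ### Hecke operators on fixed vectors -/

section Hecke

variable {G V : Type*} [Group G] [AddCommGroup V] [Module ℂ V] (ρ : Representation ℂ G V)

/-- The intersection of `K` with its conjugate by `g`, as a subgroup of `K`. -/
def conjStabilizer (K : Subgroup G) (g : G) : Subgroup K :=
  (K.comap (MulAut.conj g⁻¹).toMonoidHom).subgroupOf K

theorem mem_conjStabilizer {K : Subgroup G} {g : G} {k : K} :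
    k ∈ conjStabilizer K g ↔ g⁻¹ * k * g ∈ K := by
  simp [conjStabilizer, Subgroup.mem_subgroupOf]

/-- The Hecke operator of the double coset `K g K`. -/
noncomputable def heckeOperator (K : Subgroup G) (g : G) [Fintype (K ⧸ conjStabilizer K g)] :
    V →ₗ[ℂ] V :=
  ∑ q : K ⧸ conjStabilizer K g, ρ ((q.out : K) * g)

/-- Left multiplication by `k` permutes the cosets. The chosen representatives change by elements
that `g` conjugates into `K`, and these fix `f`. -/
theorem heckeOperator_mem (K : Subgroup G) (g : G) [Fintype (K ⧸ conjStabilizer K g)] {f : V}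
    (hf : f ∈ fixedSubmodule ρ K) : heckeOperator ρ K g f ∈ fixedSubmodule ρ K := by
  intro k hk
  simp only [heckeOperator, LinearMap.sum_apply, map_sum]
  refine Fintype.sum_equiv (MulAction.toPerm (⟨k, hk⟩ : K)) _ _ fun q => ?_
  have h1 : ((⟨k, hk⟩ : K) * q.out)⁻¹ * ((⟨k, hk⟩ : K) • q).out ∈ conjStabilizer K g := by
    rw [← QuotientGroup.eq]
    conv_lhs => rw [← smul_eq_mul, ← MulAction.Quotient.smul_coe, QuotientGroup.out_eq']
    rw [QuotientGroup.out_eq']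
  rw [mem_conjStabilizer] at h1
  rw [MulAction.toPerm_apply]
  have h2 := hf _ h1
  rw [← Module.End.mul_apply, ← map_mul]
  conv_lhs => rw [← h2, ← Module.End.mul_apply, ← map_mul]
  congr 2
  simp [mul_assoc]

theorem finite_quotient_conjStabilizer [TopologicalSpace G] [IsTopologicalGroup G]
    {K : Subgroup G} (hK : IsCompact (K : Set G)) (hK' : IsOpen (K : Set G)) (g : G) :
    Finite (K ⧸ conjStabilizer K g) := by
  have : CompactSpace K := isCompact_iff_compactSpace.1 hK
  refine Subgroup.quotient_finite_of_isOpen _ ?_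
  have hc : Continuous fun k : K => g⁻¹ * (k : G) * g := by fun_prop
  convert hK'.preimage hc using 1
  ext k
  exact mem_conjStabilizer

/-- The sum of the absolute values of the coordinates in a basis. It replaces a norm on the purely
algebraic space of fixed vectors. -/
theorem exists_bounding_function (E : Type*) [AddCommGroup E] [Module ℂ E]
    [FiniteDimensional ℂ E] : ∃ N : E → ℝ, (∀ v, 0 ≤ N v) ∧
      (∀ T : E →ₗ[ℂ] E, ∃ B, ∀ v, N (T v) ≤ B * N v) ∧
      ∀ l : E →ₗ[ℂ] ℂ, ∃ C, 0 ≤ C ∧ ∀ v, ‖l v‖ ≤ C * N v := by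
  let b := Module.finBasis ℂ E
  let N : E → ℝ := fun v => ∑ i, ‖b.repr v i‖
  have hl : ∀ l : E →ₗ[ℂ] ℂ, ∃ C, 0 ≤ C ∧ ∀ v, ‖l v‖ ≤ C * N v := fun l => by
    refine ⟨∑ i, ‖l (b i)‖, Finset.sum_nonneg fun _ _ => norm_nonneg _, fun v => ?_⟩
    conv_lhs => rw [← b.sum_repr v, map_sum]
    refine (norm_sum_le _ _).trans ?_
    rw [Finset.mul_sum]
    refine Finset.sum_le_sum fun i _ => ?_
    rw [map_smul, norm_smul, mul_comm]
    exact mul_le_mul_of_nonneg_right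
      (Finset.single_le_sum (f := fun i => ‖l (b i)‖) (fun _ _ => norm_nonneg _)
        (Finset.mem_univ i)) (norm_nonneg _)
  refine ⟨N, fun v => Finset.sum_nonneg fun _ _ => norm_nonneg _, fun T => ?_, hl⟩
  choose C _ hC using fun i => hl (b.coord i ∘ₗ T)
  refine ⟨∑ i, C i, fun v => ?_⟩
  rw [Finset.sum_mul]
  exact Finset.sum_le_sum fun i _ => hC i v

end Hecke

/-! ### Coset representatives for the Hecke operator of `stepGL` -/

section SquareZero

variable {p : ℕ} [Fact p.Prime] {ι : Type*} [Fintype ι] [DecidableEq ι]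

/-- `1 + X` for a matrix `X` of square zero. -/
noncomputable def oneAddGL (X : Matrix ι ι ℚ_[p]) (hX : X * X = 0) : GL ι ℚ_[p] where
  val := 1 + X
  inv := 1 - X
  val_inv := by simp [mul_sub, add_mul, hX]
  inv_val := by simp [mul_add, sub_mul, hX]

/-- The part of a matrix with rows in `J` and columns outside of `J`. -/
noncomputable def cornerPart (J : Finset ι) (A : Matrix ι ι ℚ_[p]) : Matrix ι ι ℚ_[p] :=
  fun a b => if a ∈ J ∧ b ∉ J then A a b else 0

theorem cornerPart_mul_self (J : Finset ι) (A : Matrix ι ι ℚ_[p]) :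
    cornerPart J A * cornerPart J A = 0 := by
  ext a b
  rw [Matrix.mul_apply, Matrix.zero_apply]
  refine Finset.sum_eq_zero fun k _ => ?_
  by_cases hk : k ∈ J <;> simp [cornerPart, hk]

/-- The diagonal matrix with entries `p` at the positions in `J` and `1` elsewhere. -/
noncomputable def stepGL (J : Finset ι) : GL ι ℚ_[p] :=
  diagGL fun a => if a ∈ J then pUnit p else 1

theorem inv_diagGL_mul_mul_apply (t : ι → ℚ_[p]ˣ) (A : Matrix ι ι ℚ_[p]) (a b : ι) :
    ((diagGL t)⁻¹.val * A * (diagGL t).val) a b = (t a : ℚ_[p])⁻¹ * A a b * t b := by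
  change (Matrix.diagonal (fun i => ((t i)⁻¹ : ℚ_[p])) * A *
    Matrix.diagonal (fun i => (t i : ℚ_[p])) : Matrix ι ι ℚ_[p]) a b = _
  rw [Matrix.mul_diagonal, Matrix.diagonal_mul]

theorem diagGL_mul_mul_inv_apply (t : ι → ℚ_[p]ˣ) (A : Matrix ι ι ℚ_[p]) (a b : ι) :
    ((diagGL t).val * A * (diagGL t)⁻¹.val) a b = (t a : ℚ_[p]) * A a b * (t b : ℚ_[p])⁻¹ := by
  change (Matrix.diagonal (fun i => (t i : ℚ_[p])) * A *
    Matrix.diagonal (fun i => ((t i)⁻¹ : ℚ_[p])) : Matrix ι ι ℚ_[p]) a b = _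
  rw [Matrix.mul_diagonal, Matrix.diagonal_mul]

theorem norm_pUnit : ‖(pUnit p : ℚ_[p])‖ = (p : ℝ)⁻¹ := Padic.norm_p

/-- Representatives for the double coset of `stepGL J` under the principal congruence subgroup. -/
theorem mul_stepGL (J : Finset ι) {c : GL ι ℚ_[p]}
    (hc : c ∈ congruenceSubgroup p ι 1) :
    ∃ q ∈ congruenceSubgroup p ι 1, c * stepGL J =
      oneAddGL (cornerPart J (c.val - 1)) (cornerPart_mul_self J _) * stepGL J * q := by
  set X := cornerPart J (c.val - 1)
  set ν := oneAddGL X (cornerPart_mul_self J _)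
  have hc1 := (mem_congruenceSubgroup_of_pos le_rfl).1 hc
  have hp := (prime_zpow_pos (p := p) (-((1 : ℕ) : ℤ))).le
  have hX : EntriesLE ((p : ℝ) ^ (-((1 : ℕ) : ℤ))) X := fun a b => by
    simp only [X, cornerPart]
    split_ifs
    · exact hc1 a b
    · simp
  have hD : EntriesLE ((p : ℝ) ^ (-((1 : ℕ) : ℤ))) (c.val - 1 - X) := hc1.sub hX
  have hq : (ν⁻¹ * c).val - 1 = (c.val - 1 - X) - X * (c.val - 1 - X) := by
    have hXX : X * X = 0 := cornerPart_mul_self J _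
    change (1 - X) * c.val - 1 = _
    simp only [mul_sub, sub_mul, hXX]
    noncomm_ring
  have hXD := hX.mul hp hp hD
  have hpp : (p : ℝ) ^ (-((1 : ℕ) : ℤ)) * (p : ℝ) ^ (-((1 : ℕ) : ℤ)) =
      (p : ℝ)⁻¹ * (p : ℝ)⁻¹ := by simp
  have hq1 : EntriesLE ((p : ℝ) ^ (-((1 : ℕ) : ℤ))) ((ν⁻¹ * c).val - 1) := by
    rw [hq]
    refine hD.sub (hXD.mono ?_)
    exact mul_le_of_le_one_left hp (zpow_neg_le_one 1)
  -- In the corner only the product of two small matrices survives, which gains a second factor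
  -- `p⁻¹`. Conjugation by `stepGL J` loses a factor `p` at these positions and at no others.
  have hq2 : ∀ a b, a ∈ J → b ∉ J → ‖((ν⁻¹ * c).val - 1) a b‖ ≤ (p : ℝ)⁻¹ * (p : ℝ)⁻¹ :=
    fun a b ha hb => by
      rw [hq, Matrix.sub_apply, show (c.val - 1 - X) a b = 0 by simp [X, cornerPart, ha, hb],
        zero_sub, norm_neg, ← hpp]
      exact hXD a b
  have hp1 : (1 : ℝ) ≤ p := by exact_mod_cast (Fact.out : p.Prime).one_lt.le
  have hp0 : (p : ℝ) ≠ 0 := by positivity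
  refine ⟨(stepGL J)⁻¹ * (ν⁻¹ * c) * stepGL J, ?_, by simp [mul_assoc]⟩
  rw [mem_congruenceSubgroup_of_pos le_rfl]
  have hval : ((stepGL J)⁻¹ * (ν⁻¹ * c) * stepGL J).val - 1 =
      (stepGL J)⁻¹.val * ((ν⁻¹ * c).val - 1) * (stepGL J).val := by
    rw [mul_sub, sub_mul, mul_one, ← Units.val_mul, ← Units.val_mul, ← Units.val_mul]; simp
  rw [hval]
  intro a b
  rw [stepGL, inv_diagGL_mul_mul_apply, norm_mul, norm_mul, norm_inv]
  have h1 := hq1 a b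
  simp only [Nat.cast_one, zpow_neg, zpow_one] at h1 ⊢
  by_cases ha : a ∈ J <;> by_cases hb : b ∈ J
  · simp only [ha, hb, if_true, norm_pUnit, inv_inv]
    calc _ = ‖((ν⁻¹ * c).val - 1) a b‖ * (p * (p : ℝ)⁻¹) := by ring
      _ ≤ _ := by rw [mul_inv_cancel₀ hp0, mul_one]; exact h1
  · simp only [ha, hb, if_true, if_false, norm_pUnit, inv_inv, Units.val_one, norm_one, mul_one]
    calc _ ≤ (p : ℝ) * ((p : ℝ)⁻¹ * (p : ℝ)⁻¹) :=
          mul_le_mul_of_nonneg_left (hq2 a b ha hb) (by positivity)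
      _ = _ := by field_simp
  · simp only [ha, hb, if_true, if_false, norm_pUnit, Units.val_one, norm_one, inv_one, one_mul]
    exact (mul_le_of_le_one_right (norm_nonneg _) (inv_le_one_of_one_le₀ hp1)).trans h1
  · simpa only [ha, hb, if_false, Units.val_one, norm_one, inv_one, one_mul, mul_one] using h1

end SquareZero

/-! ### Block matrices and the Shalika property -/

section Blocks

variable {p : ℕ} [Fact p.Prime] {n : ℕ}

theorem blockDiag_mul (a b c d : GL (Fin n) ℚ_[p]) :
    blockDiag a b * blockDiag c d = blockDiag (a * c) (b * d) := by
  ext1; simp [blockDiag, Matrix.fromBlocks_multiply]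

theorem blockDiag_one : blockDiag (1 : GL (Fin n) ℚ_[p]) 1 = 1 := by
  ext1; simp [blockDiag]

theorem blockDiag_mul_blockUnip (a b : GL (Fin n) ℚ_[p]) (X : Matrix (Fin n) (Fin n) ℚ_[p]) :
    blockDiag a b * blockUnip X = blockUnip (a.val * X * b⁻¹.val) * blockDiag a b := by
  ext1; simp [blockDiag, blockUnip, Matrix.fromBlocks_multiply, mul_assoc]

theorem blockDiag_mem {m : ℕ} {a b : GL (Fin n) ℚ_[p]} (ha : a ∈ congruenceSubgroup p (Fin n) m)
    (hb : b ∈ congruenceSubgroup p (Fin n) m) :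
    blockDiag a b ∈ congruenceSubgroup p (Fin n ⊕ Fin n) m := by
  have key : ∀ {e : ℝ} {A B : Matrix (Fin n) (Fin n) ℚ_[p]}, 0 ≤ e → EntriesLE e A →
      EntriesLE e B → EntriesLE e (Matrix.fromBlocks A 0 0 B) := by
    rintro e A B he hA hB (i | i) (j | j)
    · exact hA i j
    · simpa using he
    · simpa using he
    · exact hB i j
  refine ⟨key zero_le_one ha.1 hb.1, key zero_le_one ha.2.1 hb.2.1, ?_⟩
  have : (blockDiag a b).val - 1 = Matrix.fromBlocks (a.val - 1) 0 0 (b.val - 1) := by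
    ext (i | i) (j | j) <;> simp [blockDiag, Matrix.one_apply]
  rw [this]
  exact key (prime_zpow_pos _).le ha.2.2 hb.2.2

/-- The transformation behaviour of functions in a Shalika model. -/
def IsShalika (η : ℚ_[p]ˣ →* ℂˣ) (ψ : AddChar ℚ_[p] ℂ) (W : G2 p n → ℂ) : Prop :=
  ∀ (h : GL (Fin n) ℚ_[p]) (X : Matrix (Fin n) (Fin n) ℚ_[p]) (g : G2 p n),
    W (blockDiag h h * blockUnip X * g) =
      (η (Matrix.GeneralLinearGroup.det h) : ℂ) * ψ X.trace * W g

namespace IsShalika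

variable {η : ℚ_[p]ˣ →* ℂˣ} {ψ : AddChar ℚ_[p] ℂ} {W : G2 p n → ℂ}

theorem blockUnip_mul (hW : IsShalika η ψ W) (X : Matrix (Fin n) (Fin n) ℚ_[p]) (g : G2 p n) :
    W (blockUnip X * g) = ψ X.trace * W g := by
  simpa [blockDiag_one] using hW 1 X g

theorem blockDiag_mul (hW : IsShalika η ψ W) (h : GL (Fin n) ℚ_[p]) (g : G2 p n) :
    W (blockDiag h h * g) = (η (Matrix.GeneralLinearGroup.det h) : ℂ) * W g := by
  have h0 : blockUnip (0 : Matrix (Fin n) (Fin n) ℚ_[p]) = 1 := by ext1; simp [blockUnip]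
  simpa [h0] using hW h 0 g

theorem apply_blockDiag (hW : IsShalika η ψ W) (a b : GL (Fin n) ℚ_[p]) (g : G2 p n) :
    W (blockDiag a b * g) = (η (Matrix.GeneralLinearGroup.det b) : ℂ) *
      W (blockDiag (b⁻¹ * a) 1 * g) := by
  rw [← hW.blockDiag_mul, ← mul_assoc, ShalikaZeta.blockDiag_mul]; simp

end IsShalika

theorem psi_eq_one {ψ : AddChar ℚ_[p] ℂ} (hψ : HasConductorOne ψ) {x : ℚ_[p]} (hx : ‖x‖ ≤ 1) :
    ψ x = 1 := by
  simpa using (hψ x).2 hx 1 (by simp)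

theorem norm_trace_le {A : Matrix (Fin n) (Fin n) ℚ_[p]} (hA : EntriesLE 1 A) : ‖A.trace‖ ≤ 1 :=
  padic_norm_sum_le _ _ zero_le_one fun i _ => hA i i

theorem unramified_det {η : ℚ_[p]ˣ →* ℂˣ} (hη : IsUnramified η) {m : ℕ} {k : GL (Fin n) ℚ_[p]}
    (hk : k ∈ congruenceSubgroup p (Fin n) m) : η (Matrix.GeneralLinearGroup.det k) = 1 :=
  hη _ (by simpa using norm_det_eq_one hk.1 hk.2.1)

end Blocks

/-! ### Growth of `W` on block diagonal matrices -/

section Growth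

variable {p : ℕ} [Fact p.Prime] {n : ℕ} {η : ℚ_[p]ˣ →* ℂˣ} {ψ : AddChar ℚ_[p] ℂ}

theorem stepGL_inl (J : Finset (Fin n)) :
    (stepGL (J.map Function.Embedding.inl) : G2 p n) = blockDiag (stepGL J) 1 := by
  ext1
  simp only [stepGL, diagGL, blockDiag]
  ext (i | i) (j | j) <;> simp [Matrix.diagonal_apply, Matrix.one_apply]

/-- All terms of the Hecke operator take the same value here. By `mul_stepGL` the representative is
a block unipotent matrix with integral block `Y` times `diag(1 + X, 1)`. With `d` the integral
diagonal matrix, the former contributes `ψ(tr(d Y)) = 1`. As `X` has columns outside `J`, where `d`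
has entry `1`, the matrix `d (1 + X) d⁻¹` stays in the congruence subgroup and is absorbed. -/
theorem shalika_apply_mul_stepGL (hη : IsUnramified η) (hψ : HasConductorOne ψ) {W : G2 p n → ℂ}
    (hW : IsShalika η ψ W)
    (hK : ∀ k ∈ congruenceSubgroup p (Fin n ⊕ Fin n) 1, ∀ g, W (g * k) = W g)
    (J : Finset (Fin n)) (l : Fin n → ℕ) (hl : ∀ i, i ∉ J → l i = 0)
    {c : G2 p n} (hc : c ∈ congruenceSubgroup p (Fin n ⊕ Fin n) 1) :
    W (blockDiag (diagGL fun i => pUnit p ^ l i) 1 *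
        (c * stepGL (J.map Function.Embedding.inl))) =
      W (blockDiag ((diagGL fun i => pUnit p ^ l i) * stepGL J) 1) := by
  obtain ⟨q, hq, hcq⟩ := mul_stepGL (J.map Function.Embedding.inl) hc
  set d : GL (Fin n) ℚ_[p] := diagGL fun i => pUnit p ^ l i
  have hc1 := (mem_congruenceSubgroup_of_pos le_rfl).1 hc
  set X : Matrix (Fin n) (Fin n) ℚ_[p] := cornerPart J (c.val - 1).toBlocks₁₁
  have hXX : X * X = 0 := cornerPart_mul_self J _
  set Y : Matrix (Fin n) (Fin n) ℚ_[p] := fun a b =>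
    if a ∈ J then (c.val - 1) (Sum.inl a) (Sum.inr b) else 0
  have hX : EntriesLE ((p : ℝ) ^ (-((1 : ℕ) : ℤ))) X := fun a b => by
    simp only [X, cornerPart]
    split_ifs
    · exact hc1 (Sum.inl a) (Sum.inl b)
    · simp
  have hY : EntriesLE 1 Y := fun a b => by
    simp only [Y]
    split_ifs
    · exact (hc1.mono (zpow_neg_le_one 1)) (Sum.inl a) (Sum.inr b)
    · simp
  have hν : oneAddGL (cornerPart (J.map Function.Embedding.inl) (c.val - 1))
      (cornerPart_mul_self _ _) = blockUnip Y * blockDiag (oneAddGL X hXX) 1 := by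
    have e : (blockUnip Y * blockDiag (oneAddGL X hXX) 1).val = Matrix.fromBlocks (1 + X) Y 0 1 := by
      simp [blockUnip, blockDiag, oneAddGL, Matrix.fromBlocks_multiply]
    ext1
    rw [e]
    ext (i | i) (j | j)
    · rw [Matrix.fromBlocks_apply₁₁]
      simp [oneAddGL, cornerPart, X, Matrix.toBlocks₁₁, Matrix.one_apply]
    · rw [Matrix.fromBlocks_apply₁₂]
      simp [oneAddGL, cornerPart, Y]
    · rw [Matrix.fromBlocks_apply₂₁]
      simp [oneAddGL, cornerPart]
    · rw [Matrix.fromBlocks_apply₂₂]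
      simp [oneAddGL, cornerPart, Matrix.one_apply]
  have hnorm : ∀ i, ‖((pUnit p ^ l i : ℚ_[p]ˣ) : ℚ_[p])‖ ≤ 1 := fun i => by
    rw [Units.val_pow_eq_pow_val, norm_pow, norm_pUnit]
    exact pow_le_one₀ (by positivity)
      (inv_le_one_of_one_le₀ (by exact_mod_cast (Fact.out : p.Prime).one_lt.le))
  have hd : EntriesLE 1 d.val := fun i j => by
    simp only [d, diagGL, Matrix.diagonal_apply]
    split_ifs
    · exact hnorm i
    · simp
  set k := d * oneAddGL X hXX * d⁻¹
  have hk : k ∈ congruenceSubgroup p (Fin n) 1 := by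
    rw [mem_congruenceSubgroup_of_pos le_rfl]
    have hval : k.val - 1 = d.val * X * d⁻¹.val := by
      simp only [k, Units.val_mul, oneAddGL, mul_add, add_mul, mul_one]
      rw [← Units.val_mul]; simp
    rw [hval]
    intro a b
    rw [diagGL_mul_mul_inv_apply, norm_mul, norm_mul]
    by_cases hb : b ∈ J
    · simp only [X, cornerPart, hb, not_true, and_false, if_false, norm_zero, mul_zero, zero_mul]
      exact (prime_zpow_pos _).le
    · rw [hl b hb]
      simp only [pow_zero, Units.val_one, inv_one, norm_one, mul_one]
      exact (mul_le_of_le_one_left (norm_nonneg _) (hnorm a)).trans (hX a b)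
  have hdk : d * oneAddGL X hXX = k * d := by simp [k]
  rw [hcq, hν, stepGL_inl, ← mul_assoc, hK q hq, ← mul_assoc, ← mul_assoc,
    blockDiag_mul_blockUnip, mul_assoc, mul_assoc, blockDiag_mul, blockDiag_mul, ← mul_assoc d, hdk,
    hW.blockUnip_mul, psi_eq_one hψ (norm_trace_le ?_), one_mul, mul_one, mul_one, mul_assoc k,
    show blockDiag (k * (d * stepGL J)) 1 = blockDiag k k * (blockDiag (d * stepGL J) k⁻¹) by
      rw [blockDiag_mul]; simp,
    hW.blockDiag_mul, unramified_det hη hk, Units.val_one, one_mul,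
    show blockDiag (d * stepGL J) k⁻¹ = blockDiag (d * stepGL J) 1 * blockDiag 1 k⁻¹ by
      rw [blockDiag_mul]; simp,
    hK _ (blockDiag_mem (one_mem _) (inv_mem hk))]
  simpa using (hd.mul zero_le_one zero_le_one hY)

end Growth

section Growth

variable {p : ℕ} [Fact p.Prime] {n : ℕ} {η : ℚ_[p]ˣ →* ℂˣ} {ψ : AddChar ℚ_[p] ℂ}
  {V : Type*} [AddCommGroup V] [Module ℂ V] {ρ : Representation ℂ (G2 p n) V}
  {L : V →ₗ[ℂ] (G2 p n → ℂ)}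

theorem apply_mul_of_mem_fixedSubmodule (hL : ∀ g f x, L (ρ g f) x = L f (x * g))
    {K : Subgroup (G2 p n)} {f : V} (hf : f ∈ fixedSubmodule ρ K) {k : G2 p n} (hk : k ∈ K)
    (g : G2 p n) : L f (g * k) = L f g := by
  rw [← hL, hf k hk]

/-- The Hecke operator of `stepGL J` thus raises the exponents in `J` by one, which drives the
induction for the growth bound. -/
theorem heckeOperator_apply (hL : ∀ g f x, L (ρ g f) x = L f (x * g))
    (hSh : ∀ f, IsShalika η ψ (L f)) (hη : IsUnramified η) (hψ : HasConductorOne ψ)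
    (J : Finset (Fin n)) (l : Fin n → ℕ) (hl : ∀ i, i ∉ J → l i = 0)
    [Fintype (congruenceSubgroup p (Fin n ⊕ Fin n) 1 ⧸ conjStabilizer
      (congruenceSubgroup p (Fin n ⊕ Fin n) 1) (stepGL (J.map Function.Embedding.inl)))] {f : V}
    (hf : f ∈ fixedSubmodule ρ (congruenceSubgroup p (Fin n ⊕ Fin n) 1)) :
    L (heckeOperator ρ (congruenceSubgroup p (Fin n ⊕ Fin n) 1)
        (stepGL (J.map Function.Embedding.inl)) f) (blockDiag (diagGL fun i => pUnit p ^ l i) 1) =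
      (Fintype.card (congruenceSubgroup p (Fin n ⊕ Fin n) 1 ⧸ conjStabilizer
        (congruenceSubgroup p (Fin n ⊕ Fin n) 1) (stepGL (J.map Function.Embedding.inl))) : ℂ) *
        L f (blockDiag ((diagGL fun i => pUnit p ^ l i) * stepGL J) 1) := by
  simp only [heckeOperator, LinearMap.sum_apply, map_sum, Finset.sum_apply, hL]
  rw [Finset.sum_congr rfl fun q _ => shalika_apply_mul_stepGL hη hψ (hSh f)
    (fun k hk g => apply_mul_of_mem_fixedSubmodule hL hf hk g) J l hl q.out.prop]
  simp

/-- The congruence subgroup of level `1` is normalised by the one of level `0`. -/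
theorem rho_mem_fixedSubmodule {f : V}
    (hf : f ∈ fixedSubmodule ρ (congruenceSubgroup p (Fin n ⊕ Fin n) 1)) {κ : G2 p n}
    (hκ : κ ∈ congruenceSubgroup p (Fin n ⊕ Fin n) 0) :
    ρ κ f ∈ fixedSubmodule ρ (congruenceSubgroup p (Fin n ⊕ Fin n) 1) := by
  intro k hk
  have h1 : κ⁻¹ * k * κ ∈ congruenceSubgroup p (Fin n ⊕ Fin n) 1 := by
    rw [mem_congruenceSubgroup_of_pos le_rfl] at hk ⊢
    have : (κ⁻¹ * k * κ).val - 1 = κ⁻¹.val * (k.val - 1) * κ.val := by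
      rw [mul_sub, sub_mul, mul_one, ← Units.val_mul, ← Units.val_mul, ← Units.val_mul]; simp
    rw [this]
    have hp := (prime_zpow_pos (p := p) (-((1 : ℕ) : ℤ))).le
    simpa using (hκ.2.1.mul zero_le_one hp hk).mul (by positivity) zero_le_one hκ.1
  conv_rhs => rw [← hf _ h1]
  rw [← Module.End.mul_apply, ← map_mul, ← Module.End.mul_apply, ← map_mul]
  simp [mul_assoc]

/-- The value at a diagonal matrix is reached from the value at `1` by as many Hecke operators as
its largest exponent, and each of the finitely many operators is bounded on the finite-dimensional
space of fixed vectors. The Cartan decomposition reduces a general `y` to this case, at the cost of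
replacing `f` by one of finitely many translates. -/
theorem exists_growth_bound (hL : ∀ g f x, L (ρ g f) x = L f (x * g))
    (hSh : ∀ f, IsShalika η ψ (L f)) (hη : IsUnramified η) (hψ : HasConductorOne ψ)
    [FiniteDimensional ℂ (fixedSubmodule ρ (congruenceSubgroup p (Fin n ⊕ Fin n) 1))] {f : V}
    (hf : f ∈ fixedSubmodule ρ (congruenceSubgroup p (Fin n ⊕ Fin n) 1)) :
    ∃ (C : ℝ) (A : ℕ), 0 ≤ C ∧ ∀ y : GL (Fin n) ℚ_[p], EntriesLE 1 y.val →
      ‖L f (blockDiag y 1)‖ ≤ C * (‖y.val.det‖⁻¹) ^ A := by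
  classical
  set K := congruenceSubgroup p (Fin n ⊕ Fin n) 1
  have hfin : ∀ g, Finite (K ⧸ conjStabilizer K g) :=
    finite_quotient_conjStabilizer (isCompact_congruenceSubgroup p _ 1)
      (isOpen_congruenceSubgroup p _ 1)
  let : ∀ g, Fintype (K ⧸ conjStabilizer K g) := fun g => Fintype.ofFinite _
  let T : Finset (Fin n) → fixedSubmodule ρ K →ₗ[ℂ] fixedSubmodule ρ K := fun J =>
    (heckeOperator ρ K (stepGL (J.map Function.Embedding.inl))).restrict
      fun f hf => heckeOperator_mem ρ K _ hf
  obtain ⟨N, hN0, hN, hNl⟩ := exists_bounding_function (fixedSubmodule ρ K)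
  choose B₀ hB₀ using fun J => hN (T J)
  obtain ⟨A, hA⟩ : ∃ A : ℕ, ∀ J, B₀ J ≤ (p : ℝ) ^ A := by
    have hp : (1 : ℝ) < p := by exact_mod_cast (Fact.out : p.Prime).one_lt
    obtain ⟨A, hA⟩ := pow_unbounded_of_one_lt (∑ J, |B₀ J|) hp
    exact ⟨A, fun J => (le_abs_self _).trans ((Finset.single_le_sum (f := fun J => |B₀ J|)
      (fun _ _ => abs_nonneg _) (Finset.mem_univ J)).trans hA.le)⟩
  have hp1 : (1 : ℝ) ≤ p := by exact_mod_cast (Fact.out : p.Prime).one_lt.le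
  obtain ⟨C₀, hC₀, hC⟩ := hNl
    ((LinearMap.proj (1 : G2 p n)) ∘ₗ L ∘ₗ (fixedSubmodule ρ K).subtype)
  have main : ∀ (m : ℕ) (l : Fin n → ℕ), (∀ i, l i ≤ m) → ∀ f : fixedSubmodule ρ K,
      ‖L f (blockDiag (diagGL fun i => pUnit p ^ l i) 1)‖ ≤ C₀ * ((p : ℝ) ^ A) ^ m * N f := by
    intro m
    induction m with
    | zero =>
      intro l hl f
      have : (diagGL fun i => pUnit p ^ l i : GL (Fin n) ℚ_[p]) = 1 := by
        ext1
        simp [diagGL, fun i => Nat.le_zero.1 (hl i)]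
      rw [this, blockDiag_one]
      simpa using hC f
    | succ m ih =>
      intro l hl f
      let J : Finset (Fin n) := Finset.univ.filter fun i => 1 ≤ l i
      let l' : Fin n → ℕ := fun i => l i - 1
      have hl' : ∀ i, i ∉ J → l' i = 0 := fun i hi => by
        simp only [J, Finset.mem_filter, Finset.mem_univ, true_and, not_le] at hi
        simp only [l']; omega
      have hll : (diagGL fun i => pUnit p ^ l' i) * stepGL J =
          (diagGL fun i => pUnit p ^ l i : GL (Fin n) ℚ_[p]) := by
        ext1
        simp only [Units.val_mul, diagGL, stepGL, Matrix.diagonal_mul_diagonal]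
        congr 1
        ext i
        rw [← Units.val_mul]
        congr 1
        by_cases hi : 1 ≤ l i
        · have : i ∈ J := by simp [J, hi]
          rw [if_pos this, ← pow_succ]; congr 1; simp only [l']; omega
        · have : i ∉ J := by simpa [J] using hi
          rw [if_neg this, mul_one]; congr 1; simp only [l']; omega
      have h1 := heckeOperator_apply hL hSh hη hψ J l' hl' f.prop
      rw [hll] at h1
      have h2 := ih l' (fun i => by have := hl i; simp only [l']; omega) (T J f)
      have h3 : L (T J f : V) = L (heckeOperator ρ K (stepGL (J.map Function.Embedding.inl)) f) :=
        rfl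
      rw [h3, h1, norm_mul, Complex.norm_natCast] at h2
      have hcard : (1 : ℝ) ≤ Fintype.card (K ⧸ conjStabilizer K
          (stepGL (J.map Function.Embedding.inl))) := by
        exact_mod_cast Fintype.card_pos
      calc _ ≤ _ := (le_mul_of_one_le_left (norm_nonneg _) hcard).trans h2
        _ ≤ C₀ * ((p : ℝ) ^ A) ^ m * ((p : ℝ) ^ A * N f) := by
          refine mul_le_mul_of_nonneg_left ?_ (by positivity)
          exact (hB₀ J f).trans (mul_le_mul_of_nonneg_right (hA J) (hN0 f))
        _ = _ := by rw [pow_succ]; ring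
  obtain ⟨R, hR⟩ := exists_finset_cover (isCompact_congruenceSubgroup p (Fin n ⊕ Fin n) 0)
    (isOpen_congruenceSubgroup p (Fin n ⊕ Fin n) 1)
  let D : G2 p n → ℝ := fun x => if hx : x ∈ congruenceSubgroup p (Fin n ⊕ Fin n) 0 then
    N ⟨ρ x f, rho_mem_fixedSubmodule hf hx⟩ else 0
  have hD0 : ∀ x, 0 ≤ D x := fun x => by
    simp only [D]; split_ifs
    · exact hN0 _
    · exact le_rfl
  refine ⟨C₀ * ∑ x ∈ R, D x, A, mul_nonneg hC₀ (Finset.sum_nonneg fun x _ => hD0 x),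
    fun y hy => ?_⟩
  obtain ⟨k₁, hk₁, k₂, hk₂, l, hkl⟩ := exists_cartan y hy
  -- If `y = k₁ d k₂`, then `diag(y, 1) = diag(k₁, k₁) diag(d, 1) diag(k₂, k₁⁻¹)`, where the first
  -- factor acts trivially as `η` is unramified.
  have hκ := blockDiag_mem hk₂ (inv_mem hk₁)
  obtain ⟨x, hxR, hx, hxκ⟩ := hR _ hκ
  have h1 : L f (blockDiag y 1) =
      L (ρ x f) (blockDiag (diagGL fun i => pUnit p ^ l i) 1) := by
    rw [hL, ← apply_mul_of_mem_fixedSubmodule hL hf hxκ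
      (blockDiag (diagGL fun i => pUnit p ^ l i) 1 * x), hkl]
    rw [show blockDiag (diagGL fun i => pUnit p ^ l i) 1 * x * (x⁻¹ * blockDiag k₂ k₁⁻¹) =
      blockDiag (diagGL fun i => pUnit p ^ l i) 1 * blockDiag k₂ k₁⁻¹ by group, blockDiag_mul,
      show blockDiag (k₁ * (diagGL fun i => pUnit p ^ l i) * k₂) 1 = blockDiag k₁ k₁ *
        blockDiag ((diagGL fun i => pUnit p ^ l i) * k₂) (1 * k₁⁻¹) by
        rw [blockDiag_mul]; simp [mul_assoc], (hSh f).blockDiag_mul, unramified_det hη hk₁]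
    simp
  -- The sum of the exponents bounds each of them and is the valuation of `det y`.
  have h2 := main (∑ i, l i) l (fun i => Finset.single_le_sum (f := l) (fun _ _ => Nat.zero_le _)
    (Finset.mem_univ i)) ⟨ρ x f, rho_mem_fixedSubmodule hf hx⟩
  have h3 : N ⟨ρ x f, rho_mem_fixedSubmodule hf hx⟩ ≤ ∑ x ∈ R, D x := by
    have : N ⟨ρ x f, rho_mem_fixedSubmodule hf hx⟩ = D x := by simp only [D, dif_pos hx]
    rw [this]
    exact Finset.single_le_sum (f := D) (fun x _ => hD0 x) hxR
  have hdet : ‖y.val.det‖⁻¹ = (p : ℝ) ^ (∑ i, l i) := by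
    rw [hkl, Units.val_mul, Units.val_mul, Matrix.det_mul, Matrix.det_mul, norm_mul, norm_mul,
      norm_det_eq_one hk₁.1 hk₁.2.1, norm_det_eq_one hk₂.1 hk₂.2.1]
    simp only [diagGL, Matrix.det_diagonal, Units.val_pow_eq_pow_val, norm_pow,
      norm_pUnit, Finset.prod_pow_eq_pow_sum]
    simp
  rw [h1, hdet, ← pow_mul, mul_comm (∑ i, l i), pow_mul]
  calc _ ≤ _ := h2
    _ ≤ C₀ * ((p : ℝ) ^ A) ^ (∑ i, l i) * ∑ x ∈ R, D x :=
      mul_le_mul_of_nonneg_left h3 (by positivity)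
    _ = _ := by ring

end Growth

/-! ### Absolute convergence from polynomial growth -/

section Integrability

open scoped ENNReal

variable {p : ℕ} [Fact p.Prime] {n : ℕ} [MeasurableSpace (GL (Fin n) ℚ_[p])]
  [BorelSpace (GL (Fin n) ℚ_[p])] (μ : Measure (GL (Fin n) ℚ_[p])) [μ.IsHaarMeasure]

theorem det_ne_zero_GL (g : GL (Fin n) ℚ_[p]) : g.val.det ≠ 0 :=
  (Matrix.GeneralLinearGroup.det g).ne_zero

theorem exists_norm_det_eq {g : GL (Fin n) ℚ_[p]} (hg : EntriesLE 1 g.val) :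
    ∃ v : ℕ, ‖g.val.det‖ = (p : ℝ) ^ (-(v : ℤ)) := by
  have := hg.norm_det_le
  rw [Padic.norm_le_one_iff_val_nonneg] at this
  obtain ⟨v, hv⟩ := Int.eq_ofNat_of_zero_le this
  exact ⟨v, by rw [Padic.norm_eq_zpow_neg_valuation (det_ne_zero_GL g), hv]⟩

/-- The shell where the determinant has valuation `v` contributes at most a constant times `p^{v(A +
n² - t)}`: growth gives `A`, volume gives `n²`, and the shells form a geometric series. -/
theorem integrable_norm_mul_rpow {F : GL (Fin n) ℚ_[p] → ℂ} (hF : Continuous F) {C : ℝ} {A : ℕ}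
    (hC : 0 ≤ C) (hb : ∀ y, EntriesLE 1 y.val → ‖F y‖ ≤ C * (‖y.val.det‖⁻¹) ^ A)
    (hs : ∀ y, ¬EntriesLE 1 y.val → F y = 0) {t : ℝ} (ht : (A : ℝ) + n * n < t) :
    Integrable (fun y : GL (Fin n) ℚ_[p] => ‖F y‖ * ‖y.val.det‖ ^ t) μ := by
  have hp1 : (1 : ℝ) < p := by exact_mod_cast (Fact.out : p.Prime).one_lt
  have hp0 : (0 : ℝ) < p := by linarith
  have hcont : Continuous fun y : GL (Fin n) ℚ_[p] => ‖F y‖ * ‖y.val.det‖ ^ t :=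
    hF.norm.mul (continuous_det_GL.norm.rpow_const fun y =>
      Or.inl (norm_ne_zero_iff.2 (det_ne_zero_GL y)))
  refine ⟨hcont.aestronglyMeasurable, ?_⟩
  set S : ℕ → Set (GL (Fin n) ℚ_[p]) := fun v =>
    {g | EntriesLE 1 g.val ∧ ‖g.val.det‖ = (p : ℝ) ^ (-(v : ℤ))}
  have hsupp : Function.support (fun y : GL (Fin n) ℚ_[p] => ‖‖F y‖ * ‖y.val.det‖ ^ t‖ₑ) ⊆
      ⋃ v, S v := fun y hy => by
    have hy1 : EntriesLE 1 y.val := by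
      by_contra h
      simp [hs y h] at hy
    obtain ⟨v, hv⟩ := exists_norm_det_eq hy1
    exact Set.mem_iUnion.2 ⟨v, hy1, hv⟩
  set κ : ℝ := μ.real (congruenceSubgroup p (Fin n) 1 : Set (GL (Fin n) ℚ_[p]))
  have hκ : μ (congruenceSubgroup p (Fin n) 1 : Set (GL (Fin n) ℚ_[p])) = ENNReal.ofReal κ :=
    (ENNReal.ofReal_toReal (measure_congruenceSubgroup_lt_top μ 1).ne).symm
  set c : ℝ := (p : ℝ) ^ ((A : ℝ) + n * n - t)
  have hc0 : 0 < c := Real.rpow_pos_of_pos hp0 _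
  have hc1 : c < 1 := Real.rpow_lt_one_of_one_lt_of_neg hp1 (by linarith)
  have hterm : ∀ v : ℕ, ∫⁻ y in S v, ‖‖F y‖ * ‖y.val.det‖ ^ t‖ₑ ∂μ ≤
      ENNReal.ofReal (C * (p : ℝ) ^ (n * n) * κ * c ^ v) := fun v => by
    have h1 : ∀ y ∈ S v, ‖‖F y‖ * ‖y.val.det‖ ^ t‖ₑ ≤
        ENNReal.ofReal (C * ((p : ℝ) ^ v) ^ A * ((p : ℝ) ^ v) ^ (-t)) := fun y hy => by
      rw [Real.enorm_of_nonneg (by positivity)]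
      refine ENNReal.ofReal_le_ofReal ?_
      have h2 := hb y hy.1
      rw [hy.2, zpow_neg, inv_inv, zpow_natCast] at h2
      rw [hy.2, zpow_neg, zpow_natCast, Real.inv_rpow (by positivity), ← Real.rpow_neg
        (by positivity)]
      exact mul_le_mul_of_nonneg_right h2 (by positivity)
    calc _ ≤ ∫⁻ y in S v, ENNReal.ofReal (C * ((p : ℝ) ^ v) ^ A * ((p : ℝ) ^ v) ^ (-t)) ∂μ :=
          setLIntegral_mono measurable_const h1
      _ = ENNReal.ofReal (C * ((p : ℝ) ^ v) ^ A * ((p : ℝ) ^ v) ^ (-t)) * μ (S v) := by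
          rw [setLIntegral_const]
      _ ≤ ENNReal.ofReal (C * ((p : ℝ) ^ v) ^ A * ((p : ℝ) ^ v) ^ (-t)) *
          (((p ^ (v + 1)) ^ (n * n) : ℕ) * ENNReal.ofReal κ) := by
          refine mul_le_mul_right ?_ _
          rw [← hκ]
          simpa [S] using measure_integral_det_le μ v
      _ = _ := by
          rw [← ENNReal.ofReal_natCast, ← ENNReal.ofReal_mul (by positivity),
            ← ENNReal.ofReal_mul (by positivity)]
          congr 1
          have e1 : c ^ v = ((p : ℝ) ^ v) ^ A * ((p : ℝ) ^ v) ^ (n * n) * ((p : ℝ) ^ v) ^ (-t) := by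
            simp only [c]
            rw [← Real.rpow_natCast (((p : ℝ) ^ v)) A, ← Real.rpow_natCast (((p : ℝ) ^ v)) (n * n),
              ← Real.rpow_add (by positivity), ← Real.rpow_add (by positivity),
              ← Real.rpow_natCast _ v, ← Real.rpow_natCast _ v, ← Real.rpow_mul hp0.le,
              ← Real.rpow_mul hp0.le]
            congr 1
            push_cast; ring
          rw [e1]
          push_cast
          rw [pow_succ, mul_pow]
          ring
  have hsum : Summable fun v : ℕ => C * (p : ℝ) ^ (n * n) * κ * c ^ v :=
    (summable_geometric_of_lt_one hc0.le hc1).mul_left _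
  have hκ0 : 0 ≤ κ := measureReal_nonneg
  calc ∫⁻ y, ‖‖F y‖ * ‖y.val.det‖ ^ t‖ₑ ∂μ
      = ∫⁻ y in ⋃ v, S v, ‖‖F y‖ * ‖y.val.det‖ ^ t‖ₑ ∂μ :=
        (setLIntegral_eq_of_support_subset hsupp).symm
    _ ≤ ∑' v, ∫⁻ y in S v, ‖‖F y‖ * ‖y.val.det‖ ^ t‖ₑ ∂μ := lintegral_iUnion_le _ _
    _ ≤ ∑' v, ENNReal.ofReal (C * (p : ℝ) ^ (n * n) * κ * c ^ v) := ENNReal.tsum_le_tsum hterm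
    _ = ENNReal.ofReal (∑' v, C * (p : ℝ) ^ (n * n) * κ * c ^ v) :=
        (ENNReal.ofReal_tsum_of_nonneg (fun v => by positivity) hsum).symm
    _ < ⊤ := ENNReal.ofReal_lt_top

end Integrability

/-! ### Orthogonality for residue sums -/

section Residues

variable {p : ℕ} [Fact p.Prime]

/-- An isometry mapping `ℤ_p` into itself permutes the residue classes modulo `p^m`. -/
theorem residueSum_comp {m : ℕ} {h : ℚ_[p] → ℂ} (hh : IsResidual p m h) {T : ℚ_[p] → ℚ_[p]}
    (hT : ∀ x y, ‖T x - T y‖ = ‖x - y‖) (hT1 : ∀ x, ‖x‖ ≤ 1 → ‖T x‖ ≤ 1) :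
    residueSum p m (fun x => h (T x)) = residueSum p m h := by
  choose σ hσ using fun a : ZMod (p ^ m) =>
    exists_zmod_norm_sub_le m (hT1 a.val (norm_natCast_le_one _))
  have hinj : Function.Injective σ := fun a b hab => by
    have h1 : ‖T a.val - T b.val‖ ≤ (p : ℝ) ^ (-(m : ℤ)) := by
      have h2 := padic_norm_sub_le (hσ a) (hab ▸ hσ b)
      rwa [sub_sub_sub_cancel_right] at h2
    rw [hT, norm_natCast_sub_le_iff] at h1
    simpa using h1
  simp only [residueSum]
  exact (Finset.sum_congr rfl fun a _ => hh.2 _ _ (hσ a)).trans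
    ((Equiv.ofBijective σ (Finite.injective_iff_bijective.1 hinj)).sum_comp fun a => h a.val)

theorem residueSum_eq_zero {m : ℕ} {h : ℚ_[p] → ℂ} (hh : IsResidual p m h) {T : ℚ_[p] → ℚ_[p]}
    (hT : ∀ x y, ‖T x - T y‖ = ‖x - y‖) (hT1 : ∀ x, ‖x‖ ≤ 1 → ‖T x‖ ≤ 1) {ω : ℂ} (hω : ω ≠ 1)
    (h1 : ∀ x, h (T x) = ω * h x) : residueSum p m h = 0 := by
  have h2 := residueSum_comp hh hT hT1
  simp only [h1] at h2
  rw [residueSum, ← Finset.mul_sum, ← residueSum] at h2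
  have h3 : (ω - 1) * residueSum p m h = 0 := by rw [sub_mul, h2]; ring
  exact (mul_eq_zero.1 h3).resolve_left (sub_ne_zero.2 hω)

theorem residueSum_eq_zero_of_add {m : ℕ} {h : ℚ_[p] → ℂ} (hh : IsResidual p m h) {d : ℚ_[p]}
    (hd : ‖d‖ ≤ 1) {ω : ℂ} (hω : ω ≠ 1) (h1 : ∀ x, h (x + d) = ω * h x) : residueSum p m h = 0 :=
  residueSum_eq_zero hh (T := fun x => x + d) (fun x y => by simp)
    (fun _ hx => padic_norm_add_le hx hd) hω h1

theorem residueSum_eq_zero_of_mul {m : ℕ} {h : ℚ_[p] → ℂ} (hh : IsResidual p m h) {u : ℚ_[p]}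
    (hu : ‖u‖ = 1) {ω : ℂ} (hω : ω ≠ 1) (h1 : ∀ x, h (x * u) = ω * h x) : residueSum p m h = 0 :=
  residueSum_eq_zero hh (T := fun x => x * u) (fun x y => by rw [← sub_mul, norm_mul, hu, mul_one])
    (fun x hx => by simpa [hu] using hx) hω h1

end Residues

/-! ### Character sums in a single matrix entry -/

section Characters

variable {p : ℕ} [Fact p.Prime] {n : ℕ}

open Classical in
/-- A multiplicative character of `ℚ_p^×`, extended by zero. -/
noncomputable def extendZero (χ : ℚ_[p]ˣ →* ℂˣ) (x : ℚ_[p]) : ℂ :=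
  if h : x = 0 then 0 else χ (Units.mk0 x h)

theorem extendZero_units (χ : ℚ_[p]ˣ →* ℂˣ) (x : ℚ_[p]ˣ) : extendZero χ x = χ x := by
  simp [extendZero]

theorem extendZero_mul (χ : ℚ_[p]ˣ →* ℂˣ) (x y : ℚ_[p]) :
    extendZero χ (x * y) = extendZero χ x * extendZero χ y := by
  by_cases hx : x = 0
  · simp [extendZero, hx]
  by_cases hy : y = 0
  · simp [extendZero, hy]
  have h : x * y ≠ 0 := mul_ne_zero hx hy
  simp only [extendZero, hx, hy, h, dite_false, Units.mk0_mul, map_mul, Units.val_mul]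

theorem extendZero_one (χ : ℚ_[p]ˣ →* ℂˣ) : extendZero χ 1 = 1 := by
  simpa using extendZero_units χ 1

theorem extendZero_prod (χ : ℚ_[p]ˣ →* ℂˣ) {α : Type*} (s : Finset α) (f : α → ℚ_[p]) :
    extendZero χ (∏ i ∈ s, f i) = ∏ i ∈ s, extendZero χ (f i) := by
  classical
  induction s using Finset.induction_on with
  | empty => simp [extendZero_one]
  | insert i s hi ih => rw [Finset.prod_insert hi, Finset.prod_insert hi, extendZero_mul, ih]

theorem extendZero_congr {χ : ℚ_[p]ˣ →* ℂˣ} {β : ℕ} (hχ : HasConductor χ β) {x y : ℚ_[p]}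
    (hx : ‖x‖ = 1) (hy : ‖y‖ = 1) (hxy : ‖x - y‖ ≤ (p : ℝ) ^ (-(β : ℤ))) :
    extendZero χ x = extendZero χ y := by
  have hy0 : y ≠ 0 := by rintro rfl; simp at hy
  have hx0 : x ≠ 0 := by rintro rfl; simp at hx
  have h1 : x = (x / y) * y := by field_simp
  have h2 : extendZero χ (x / y) = 1 := by
    have h3 := hχ.1 (Units.mk0 (x / y) (div_ne_zero hx0 hy0)) (by simp [hx, hy]) (by
      rw [Units.val_mk0, show x / y - 1 = (x - y) / y by field_simp, norm_div, hy, div_one]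
      exact hxy)
    simp [extendZero, hx0, hy0] at h3 ⊢
    simp [h3]
  rw [h1, extendZero_mul, h2, one_mul]

/-- This is the minimality of the conductor exponent, tested at `β - 1`. -/
theorem exists_extendZero_ne_one {χ : ℚ_[p]ˣ →* ℂˣ} {β : ℕ} (hχ : HasConductor χ β)
    (hβ : 1 ≤ β) : ∃ u : ℚ_[p], ‖u‖ = 1 ∧ ‖u - 1‖ ≤ (p : ℝ) ^ (-((β - 1 : ℕ) : ℤ)) ∧
      extendZero χ u ≠ 1 := by
  by_contra! h
  have hχ' : IsLeast _ β := hχ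
  have := mem_lowerBounds.1 hχ'.2 (β - 1) fun c hc1 hc2 => by
    have h1 := h c hc1 hc2
    rw [extendZero_units] at h1
    exact Units.ext h1
  omega

theorem exists_psi_ne_one {ψ : AddChar ℚ_[p] ℂ} (hψ : HasConductorOne ψ) {x : ℚ_[p]}
    (hx : 1 < ‖x‖) : ∃ y : ℚ_[p], ‖y‖ ≤ 1 ∧ ψ (x * y) ≠ 1 := by
  by_contra! h
  exact absurd ((hψ x).1 h) (not_le.2 hx)

theorem psi_congr {ψ : AddChar ℚ_[p] ℂ} (hψ : HasConductorOne ψ) {x y : ℚ_[p]}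
    (h : ‖x - y‖ ≤ 1) : ψ x = ψ y := by
  rw [← sub_add_cancel x y, AddChar.map_add_eq_mul, psi_eq_one hψ h, one_mul]

/-- The condition on the `(i, j)` entry in the subgroup of integral matrices which are upper
triangular modulo `p^β`. -/
def entryCondition (p : ℕ) [Fact p.Prime] (β : ℕ) (i j : Fin n) (x : ℚ_[p]) : Prop :=
  if i = j then ‖x‖ = 1 else if j < i then ‖x‖ ≤ (p : ℝ) ^ (-(β : ℤ)) else ‖x‖ ≤ 1

theorem entryCondition.norm_le {β : ℕ} {i j : Fin n} {x : ℚ_[p]}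
    (h : entryCondition p β i j x) : ‖x‖ ≤ 1 := by
  rw [entryCondition] at h
  split_ifs at h
  · exact h.le
  · exact h.trans (zpow_neg_le_one β)
  · exact h

theorem entryCondition.add {β : ℕ} (hβ : 1 ≤ β) {i j : Fin n} {x y : ℚ_[p]}
    (h : entryCondition p β i j x) (hy : ‖y‖ ≤ (p : ℝ) ^ (-(β : ℤ))) :
    entryCondition p β i j (x + y) := by
  rw [entryCondition] at h ⊢
  split_ifs at h ⊢
  · exact norm_eq_one_of_norm_sub_lt h (by simpa using hy.trans_lt (zpow_neg_lt_one hβ))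
  · exact padic_norm_add_le h hy
  · exact padic_norm_add_le h (hy.trans (zpow_neg_le_one β))

theorem entryCondition_add_iff {β : ℕ} (hβ : 1 ≤ β) {i j : Fin n} {x y : ℚ_[p]}
    (hy : ‖y‖ ≤ (p : ℝ) ^ (-(β : ℤ))) :
    entryCondition p β i j (x + y) ↔ entryCondition p β i j x :=
  ⟨fun h => by simpa using h.add hβ (y := -y) (by simpa using hy), fun h => h.add hβ hy⟩

open Classical in
/-- The contribution of the `(i, j)` entry to `χ(det k) ψ(tr(b k))`. -/
noncomputable def entryFactor (χ : ℚ_[p]ˣ →* ℂˣ) (ψ : AddChar ℚ_[p] ℂ) (β : ℕ) (i j : Fin n)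
    (b x : ℚ_[p]) : ℂ :=
  if entryCondition p β i j x then (if i = j then extendZero χ x else 1) * ψ (b * x) else 0

/-- Translation by `p^β ℤ_p` changes neither the entry condition nor the value of `χ`, so only `ψ`
sees it. -/
theorem entryFactor_add {χ : ℚ_[p]ˣ →* ℂˣ} (ψ : AddChar ℚ_[p] ℂ) {β : ℕ} (hχ : HasConductor χ β)
    (hβ : 1 ≤ β) (i j : Fin n) (b : ℚ_[p]) (x : ℚ_[p]) {y : ℚ_[p]}
    (hy : ‖y‖ ≤ (p : ℝ) ^ (-(β : ℤ))) :
    entryFactor χ ψ β i j b (x + y) = ψ (b * y) * entryFactor χ ψ β i j b x := by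
  by_cases hx : entryCondition p β i j x
  · rw [entryFactor, entryFactor, if_pos hx, if_pos (hx.add hβ hy), mul_add,
      AddChar.map_add_eq_mul]
    by_cases hij : i = j
    · have h1 := hx.add hβ hy
      rw [entryCondition, if_pos hij] at hx h1
      rw [if_pos hij, if_pos hij, extendZero_congr hχ h1 hx (by simpa using hy)]
      ring
    · rw [if_neg hij, if_neg hij]; ring
  · rw [entryFactor, entryFactor, if_neg hx, if_neg (fun h => hx ((entryCondition_add_iff hβ hy).1 h)),
      mul_zero]

theorem isResidual_entryFactor {χ : ℚ_[p]ˣ →* ℂˣ} {ψ : AddChar ℚ_[p] ℂ} (hψ : HasConductorOne ψ)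
    {β : ℕ} (hχ : HasConductor χ β) (hβ : 1 ≤ β) (i j : Fin n) {b : ℚ_[p]} {m : ℕ} (hm : β ≤ m)
    (hb : ‖b‖ ≤ (p : ℝ) ^ (m : ℤ)) : IsResidual p m (entryFactor χ ψ β i j b) := by
  have hp0 : (p : ℝ) ≠ 0 := by exact_mod_cast (Fact.out : p.Prime).ne_zero
  have hp1 : (1 : ℝ) ≤ p := by exact_mod_cast (Fact.out : p.Prime).one_lt.le
  refine ⟨fun x hx => ?_, fun x y hxy => ?_⟩
  · rw [entryFactor, if_neg fun h => hx h.norm_le]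
  · have h1 : ‖x - y‖ ≤ (p : ℝ) ^ (-(β : ℤ)) :=
      hxy.trans (zpow_le_zpow_right₀ hp1 (by omega))
    rw [show x = y + (x - y) by ring, entryFactor_add ψ hχ hβ i j b y h1, psi_eq_one hψ, one_mul]
    rw [norm_mul]
    calc _ ≤ (p : ℝ) ^ (m : ℤ) * (p : ℝ) ^ (-(m : ℤ)) :=
          mul_le_mul hb hxy (norm_nonneg _) (by positivity)
      _ = 1 := by rw [← zpow_add₀ hp0]; simp

/-- The sum over residues of `entryFactor` vanishes unless `b` satisfies the dual condition. -/
theorem entryCondition_of_residueSum_ne_zero {χ : ℚ_[p]ˣ →* ℂˣ} {ψ : AddChar ℚ_[p] ℂ}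
    (hψ : HasConductorOne ψ) {β : ℕ} (hχ : HasConductor χ β) (hβ : 1 ≤ β) (i j : Fin n)
    {b : ℚ_[p]} {m : ℕ} (hm : β ≤ m) (hb : ‖b‖ ≤ (p : ℝ) ^ (m : ℤ))
    (h : residueSum p m (entryFactor χ ψ β i j b) ≠ 0) :
    entryCondition p β j i ((p : ℚ_[p]) ^ β * b) := by
  have hres := isResidual_entryFactor hψ hχ hβ i j hm hb
  have hp1 : (1 : ℝ) < p := by exact_mod_cast (Fact.out : p.Prime).one_lt
  have hp0 : (p : ℝ) ≠ 0 := by linarith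
  have hnp : ‖(p : ℚ_[p]) ^ β‖ = (p : ℝ) ^ (-(β : ℤ)) := by simp
  have hnpb : ‖(p : ℚ_[p]) ^ β * b‖ = (p : ℝ) ^ (-(β : ℤ)) * ‖b‖ := by rw [norm_mul, hnp]
  -- Otherwise some translation by an element of `p^β ℤ_p` multiplies the summand by a value of `ψ`
  -- other than `1`.
  have hbβ : ‖(p : ℚ_[p]) ^ β * b‖ ≤ 1 := by
    by_contra! hlt
    obtain ⟨y, hy, hy1⟩ := exists_psi_ne_one hψ hlt
    have hpy : ‖(p : ℚ_[p]) ^ β * y‖ ≤ (p : ℝ) ^ (-(β : ℤ)) := by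
      rw [norm_mul, hnp]; exact mul_le_of_le_one_right (prime_zpow_pos _).le hy
    refine h (residueSum_eq_zero_of_add hres (d := (p : ℚ_[p]) ^ β * y)
      (hpy.trans (zpow_neg_le_one β)) (ω := ψ (b * ((p : ℚ_[p]) ^ β * y))) ?_ fun x =>
        entryFactor_add ψ hχ hβ i j b x hpy)
    rwa [show b * ((p : ℚ_[p]) ^ β * y) = (p : ℚ_[p]) ^ β * b * y by ring]
  rw [entryCondition]
  split_ifs with hji hij
  -- If `p^β b` is not a unit, then `‖b‖ ≤ p^(β-1)`. Multiplying by a unit `u ≡ 1` modulo `p^(β-1)`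
  -- with `χ(u) ≠ 1` then leaves `ψ` unchanged and kills the sum.
  · refine le_antisymm hbβ (not_lt.1 fun hlt => ?_)
    obtain ⟨u, hu, hu1, hχu⟩ := exists_extendZero_ne_one hχ hβ
    refine h (residueSum_eq_zero_of_mul hres hu hχu fun x => ?_)
    have hcond : entryCondition p β i j (x * u) ↔ entryCondition p β i j x := by
      rw [entryCondition, entryCondition, if_pos hji.symm, if_pos hji.symm, norm_mul, hu, mul_one]
    by_cases hx : entryCondition p β i j x
    · rw [entryFactor, entryFactor, if_pos hx, if_pos (hcond.2 hx), if_pos hji.symm,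
        if_pos hji.symm, extendZero_mul]
      have hψe : ψ (b * (x * u)) = ψ (b * x) := by
        refine psi_congr hψ ?_
        rw [show b * (x * u) - b * x = b * (u - 1) * x by ring, norm_mul, norm_mul]
        refine mul_le_one₀ ?_ (norm_nonneg _) hx.norm_le
        have h3 : ‖b‖ ≤ (p : ℝ) ^ ((β : ℤ) - 1) := by
          rw [Padic.norm_le_pow_iff_norm_lt_pow_add_one]
          rw [hnpb, zpow_neg, inv_mul_lt_one₀ (prime_zpow_pos _)] at hlt
          simpa using hlt
        calc _ ≤ (p : ℝ) ^ ((β : ℤ) - 1) * (p : ℝ) ^ (-((β - 1 : ℕ) : ℤ)) :=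
              mul_le_mul h3 hu1 (norm_nonneg _) (by positivity)
          _ = 1 := by
            rw [← zpow_add₀ hp0, show (β : ℤ) - 1 + -((β - 1 : ℕ) : ℤ) = 0 by omega, zpow_zero]
      rw [hψe]; ring
    · rw [entryFactor, entryFactor, if_neg hx, if_neg (fun h => hx (hcond.1 h)), mul_zero]
  -- Above the diagonal the entry ranges over all of `ℤ_p`, so `b` itself must be integral.
  · by_contra! hlt
    rw [hnpb] at hlt
    have hb1 : 1 < ‖b‖ := by
      have := prime_zpow_pos (p := p) (-(β : ℤ))
      nlinarith
    obtain ⟨y, hy, hy1⟩ := exists_psi_ne_one hψ hb1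
    refine h (residueSum_eq_zero_of_add hres hy hy1 fun x => ?_)
    have hij' : ¬ i = j := fun h => hji h.symm
    have hc : ∀ x, entryCondition p β i j x ↔ ‖x‖ ≤ 1 := fun x => by
      rw [entryCondition, if_neg hij', if_neg hij.asymm]
    have hcond : entryCondition p β i j (x + y) ↔ entryCondition p β i j x := by
      rw [hc, hc]
      exact ⟨fun h => by simpa using padic_norm_sub_le h hy, fun h => padic_norm_add_le h hy⟩
    by_cases hx : entryCondition p β i j x
    · rw [entryFactor, entryFactor, if_pos hx, if_pos (hcond.2 hx), mul_add,
        AddChar.map_add_eq_mul, if_neg hij', if_neg hij']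
      ring
    · rw [entryFactor, entryFactor, if_neg hx, if_neg (fun h => hx (hcond.1 h)), mul_zero]
  · exact hbβ

end Characters

/-! ### The groups `Γ₀(p^β)` and factorisation over entries -/

section UpperTriangularModulo

variable {p : ℕ} [Fact p.Prime] {n : ℕ}

/-- The relevant cofactor is the determinant of `g` with row `j` replaced by a basis vector. That
matrix is still small below the diagonal and has a zero at `(j, j)`, so its determinant is close to
`0`. -/
theorem norm_inv_apply_le_of_lower {g : GL (Fin n) ℚ_[p]} {e : ℝ} (he : 0 ≤ e)
    (h1 : EntriesLE 1 g.val) (hdet : ‖g.val.det‖ = 1) (hl : ∀ i j, j < i → ‖g.val i j‖ ≤ e)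
    {i j : Fin n} (hij : j < i) : ‖g⁻¹.val i j‖ ≤ e := by
  rw [Matrix.coe_units_inv, Matrix.inv_def, Matrix.smul_apply, smul_eq_mul, norm_mul,
    Ring.inverse_eq_inv', norm_inv, hdet, inv_one, one_mul, Matrix.adjugate_apply]
  have hA1 : EntriesLE 1 (g.val.updateRow j (Pi.single i 1)) := fun a b => by
    rw [Matrix.updateRow_apply]
    split_ifs
    · exact norm_single_le i b
    · exact h1 a b
  have h := norm_det_sub_prod_le he hA1 fun a b hab => by
    rw [Matrix.updateRow_apply]
    split_ifs with haj
    · rw [Pi.single_eq_of_ne (by rintro rfl; exact absurd hab (by rw [haj]; exact hij.asymm)),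
        norm_zero]
      exact he
    · exact hl a b hab
  rwa [Finset.prod_eq_zero (Finset.mem_univ j), sub_zero] at h
  rw [Matrix.updateRow_self, Pi.single_eq_of_ne hij.ne]

variable (p n) in
/-- The integral matrices which are upper triangular modulo `p^β`. -/
def gammaZero (β : ℕ) : Subgroup (GL (Fin n) ℚ_[p]) where
  carrier := {g | EntriesLE 1 g.val ∧ ‖g.val.det‖ = 1 ∧
    ∀ i j, j < i → ‖g.val i j‖ ≤ (p : ℝ) ^ (-(β : ℤ))}
  one_mem' := ⟨EntriesLE.one, by simp, fun i j hij => by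
    simp [Matrix.one_apply_ne hij.ne']⟩
  mul_mem' := by
    rintro g h ⟨g1, g2, g3⟩ ⟨h1, h2, h3⟩
    refine ⟨by simpa using g1.mul zero_le_one zero_le_one h1, by simp [g2, h2],
      fun i j hij => ?_⟩
    rw [Units.val_mul, Matrix.mul_apply]
    refine padic_norm_sum_le _ _ (prime_zpow_pos _).le fun m _ => ?_
    rw [norm_mul]
    by_cases hm : m < i
    · exact (mul_le_of_le_one_right (norm_nonneg _) (h1 m j)).trans (g3 i m hm)
    · exact (mul_le_of_le_one_left (norm_nonneg _) (g1 i m)).trans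
        (h3 m j (hij.trans_le (not_lt.1 hm)))
  inv_mem' := by
    rintro g ⟨g1, g2, g3⟩
    have h1 : EntriesLE 1 g⁻¹.val := by simpa [g2] using norm_inv_apply_le g1
    exact ⟨h1, norm_det_eq_one h1 (by simpa using g1),
      fun i j hij => norm_inv_apply_le_of_lower (prime_zpow_pos _).le g1 g2 g3 hij⟩

theorem congruenceSubgroup_le_gammaZero (β : ℕ) :
    congruenceSubgroup p (Fin n) β ≤ gammaZero p n β := fun g hg => by
  rw [mem_congruenceSubgroup] at hg
  refine ⟨hg.1, hg.2.1, fun i j hij => ?_⟩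
  simpa [Matrix.one_apply_ne hij.ne'] using hg.2.2 i j

theorem isOpen_gammaZero (β : ℕ) : IsOpen (gammaZero p n β : Set (GL (Fin n) ℚ_[p])) :=
  Subgroup.isOpen_mono (congruenceSubgroup_le_gammaZero β) (isOpen_congruenceSubgroup p _ β)

theorem norm_lt_one_iff_le {x : ℚ_[p]} : ‖x‖ < 1 ↔ ‖x‖ ≤ (p : ℝ) ^ (-((1 : ℕ) : ℤ)) := by
  rw [Padic.norm_le_pow_iff_norm_lt_pow_add_one]
  simp

theorem coe_gammaZero_one : (gammaZero p n 1 : Set (GL (Fin n) ℚ_[p])) = Iw p n := by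
  ext g
  refine ⟨fun h => ⟨h.1, h.2.1, fun i j hij => norm_lt_one_iff_le.2 (h.2.2 i j hij)⟩,
    fun h => ⟨h.1, h.2.1, fun i j hij => norm_lt_one_iff_le.1 (h.2.2 i j hij)⟩⟩

theorem gammaZero_anti {β β' : ℕ} (h : β ≤ β') : gammaZero p n β' ≤ gammaZero p n β :=
  fun g hg => ⟨hg.1, hg.2.1, fun i j hij => (hg.2.2 i j hij).trans
    (zpow_le_zpow_right₀ (by exact_mod_cast (Fact.out : p.Prime).one_lt.le) (by omega))⟩

/-- For matrices which are upper triangular modulo `p`, the determinant is a unit if and only if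
the diagonal entries are. -/
theorem forall_entryCondition_iff {β : ℕ} (hβ : 1 ≤ β) {A : Matrix (Fin n) (Fin n) ℚ_[p]} :
    (∀ i j, entryCondition p β i j (A i j)) ↔ EntriesLE 1 A ∧ ‖A.det‖ = 1 ∧
      ∀ i j, j < i → ‖A i j‖ ≤ (p : ℝ) ^ (-(β : ℤ)) := by
  have hpos := (prime_zpow_pos (p := p) (-(β : ℤ))).le
  constructor
  · intro h
    have h1 : EntriesLE 1 A := fun i j => (h i j).norm_le
    have h2 : ∀ i j, j < i → ‖A i j‖ ≤ (p : ℝ) ^ (-(β : ℤ)) := fun i j hij => by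
      simpa [entryCondition, hij.ne', hij] using h i j
    refine ⟨h1, norm_eq_one_of_norm_sub_lt (b := ∏ i, A i i) ?_
      ((norm_det_sub_prod_le hpos h1 h2).trans_lt (zpow_neg_lt_one hβ)), h2⟩
    rw [norm_prod]
    exact Finset.prod_eq_one fun i _ => by simpa [entryCondition] using h i i
  · rintro ⟨h1, hdet, h2⟩ i j
    rw [entryCondition]
    split_ifs with hij hij
    · have h3 : ‖∏ i, A i i‖ = 1 := norm_eq_one_of_norm_sub_lt hdet (by
        rw [norm_sub_rev]
        exact (norm_det_sub_prod_le hpos h1 h2).trans_lt (zpow_neg_lt_one hβ))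
      rw [norm_prod, ← Finset.mul_prod_erase _ _ (Finset.mem_univ i)] at h3
      have h4 : ∏ x ∈ Finset.univ.erase i, ‖A x x‖ ≤ 1 :=
        Finset.prod_le_one (fun _ _ => norm_nonneg _) fun x _ => h1 x x
      rw [← hij]
      refine le_antisymm (h1 i i) ?_
      rw [← h3]
      exact mul_le_of_le_one_right (norm_nonneg _) h4
    · exact h2 i j hij
    · exact h1 i j

theorem mem_gammaZero_iff {β : ℕ} (hβ : 1 ≤ β) {g : GL (Fin n) ℚ_[p]} :
    g ∈ gammaZero p n β ↔ ∀ i j, entryCondition p β i j (g.val i j) :=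
  (forall_entryCondition_iff hβ).symm

-- `χ(det A)` depends only on the diagonal, since the determinant is congruent to the diagonal
-- product modulo `p^β`; the trace is a sum over entries.
open Classical in
theorem prod_entryFactor {χ : ℚ_[p]ˣ →* ℂˣ} (ψ : AddChar ℚ_[p] ℂ) {β : ℕ} (hχ : HasConductor χ β)
    (hβ : 1 ≤ β) (A B : Matrix (Fin n) (Fin n) ℚ_[p]) :
    ∏ i, ∏ j, entryFactor χ ψ β i j (B j i) (A i j) =
      if ∀ i j, entryCondition p β i j (A i j) then extendZero χ A.det * ψ (A * B).trace else 0 := by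
  split_ifs with h
  · have h1 : ∀ i j, entryFactor χ ψ β i j (B j i) (A i j) =
        (if i = j then extendZero χ (A i j) else 1) * ψ (B j i * A i j) := fun i j => by
      rw [entryFactor, if_pos (h i j)]
    simp_rw [h1, Finset.prod_mul_distrib]
    obtain ⟨h2, h3, h4⟩ := (forall_entryCondition_iff hβ).1 h
    congr 1
    · simp only [Finset.prod_ite_eq, Finset.mem_univ, if_true]
      rw [← extendZero_prod]
      refine (extendZero_congr hχ h3 ?_
        (norm_det_sub_prod_le (prime_zpow_pos _).le h2 h4)).symm
      rw [norm_prod]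
      exact Finset.prod_eq_one fun i _ => by simpa [entryCondition] using h i i
    · have h5 : ∀ (s : Finset (Fin n)) (f : Fin n → ℚ_[p]), ∏ i ∈ s, ψ (f i) = ψ (∑ i ∈ s, f i) :=
        fun s f => by
          induction s using Finset.induction_on with
          | empty => simp
          | insert i s hi ih =>
            rw [Finset.prod_insert hi, Finset.sum_insert hi, AddChar.map_add_eq_mul, ih]
      simp only [h5]
      congr 1
      simp only [Matrix.trace, Matrix.diag, Matrix.mul_apply, mul_comm]
  · push Not at h
    obtain ⟨i, j, hij⟩ := h
    exact Finset.prod_eq_zero (Finset.mem_univ i) (Finset.prod_eq_zero (Finset.mem_univ j)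
      (by rw [entryFactor, if_neg hij]))

end UpperTriangularModulo

/-! ### The twisted integral on `Γ₀(p^β)` and on its complement -/

section MainIntegral

variable {p : ℕ} [Fact p.Prime] {n : ℕ} [MeasurableSpace (GL (Fin n) ℚ_[p])]
  [BorelSpace (GL (Fin n) ℚ_[p])] (μ : Measure (GL (Fin n) ℚ_[p])) [μ.IsHaarMeasure]

theorem setIntegral_mul_left {E : Set (GL (Fin n) ℚ_[p])} (hE : MeasurableSet E)
    (f : GL (Fin n) ℚ_[p] → ℂ) (k : GL (Fin n) ℚ_[p]) (hk : ∀ x, k * x ∈ E ↔ x ∈ E) :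
    ∫ x in E, f (k * x) ∂μ = ∫ x in E, f x ∂μ := by
  rw [← integral_indicator hE, ← integral_indicator hE, ← integral_mul_left_eq_self (E.indicator f) k]
  congr 1
  ext x
  by_cases hx : x ∈ E
  · rw [Set.indicator_of_mem hx, Set.indicator_of_mem ((hk x).2 hx)]
  · rw [Set.indicator_of_notMem hx, Set.indicator_of_notMem fun h => hx ((hk x).1 h)]

/-- The integrand of the twisted zeta integral after a linear change of variables. -/
noncomputable def twistedIntegrand (F : GL (Fin n) ℚ_[p] → ℂ) (χ : ℚ_[p]ˣ →* ℂˣ)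
    (ψ : AddChar ℚ_[p] ℂ) (β : ℕ) (t : ℂ) (x : GL (Fin n) ℚ_[p]) : ℂ :=
  ψ ((p : ℚ_[p])⁻¹ ^ β * x.val.trace) * extendZero χ x.val.det * (‖x.val.det‖ : ℂ) ^ t * F x

variable {F : GL (Fin n) ℚ_[p] → ℂ} {χ : ℚ_[p]ˣ →* ℂˣ} {ψ : AddChar ℚ_[p] ℂ} {β : ℕ} {t : ℂ}

/-- `R` represents `Γ₀(p^β)` modulo `p^(β+m)`. Summing over it gives a product of residue sums with
parameters the entries of `p^{-β} x`, whose norms are at most `p^(β+m)`. If no factor vanishes, the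
dual conditions say precisely that `x` is in `Γ₀(p^β)`. -/
theorem sum_twistedIntegrand_eq_zero (hF : ∀ k ∈ Iw p n, ∀ x, F (k * x) = F x)
    (hψ : HasConductorOne ψ) (hχ : HasConductor χ β) (hβ : 1 ≤ β) (m : ℕ) :
    ∃ (R : Finset (Fin n → Fin n → ZMod (p ^ (β + m))))
      (κ : (Fin n → Fin n → ZMod (p ^ (β + m))) → GL (Fin n) ℚ_[p]), R.Nonempty ∧
      (∀ a ∈ R, κ a ∈ gammaZero p n β) ∧ ∀ x : GL (Fin n) ℚ_[p], x ∉ gammaZero p n β →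
        EntriesLE ((p : ℝ) ^ (m : ℤ)) x.val → ∑ a ∈ R, twistedIntegrand F χ ψ β t (κ a * x) = 0 := by
  classical
  have hp0 : (p : ℝ) ≠ 0 := by exact_mod_cast (Fact.out : p.Prime).ne_zero
  have hpp : (p : ℚ_[p]) ≠ 0 := by exact_mod_cast (Fact.out : p.Prime).ne_zero
  let A : (Fin n → Fin n → ZMod (p ^ (β + m))) → Matrix (Fin n) (Fin n) ℚ_[p] := fun a =>
    Matrix.of fun i j => ((a i j).val : ℚ_[p])
  -- The default `1` is never taken on `R`, where the determinant is a unit.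
  let κ : (Fin n → Fin n → ZMod (p ^ (β + m))) → GL (Fin n) ℚ_[p] := fun a =>
    if h : (A a).det ≠ 0 then Matrix.GeneralLinearGroup.mkOfDetNeZero (A a) h else 1
  let R := Finset.univ.filter fun a => ∀ i j, entryCondition p β i j (A a i j)
  have hκ : ∀ a ∈ R, (κ a).val = A a := fun a ha => by
    have h1 := ((forall_entryCondition_iff hβ).1 (Finset.mem_filter.1 ha).2).2.1
    have h2 : (A a).det ≠ 0 := fun h0 => by simp [h0] at h1
    simp only [κ, dif_pos h2]; rfl
  have hκ' : ∀ a ∈ R, κ a ∈ gammaZero p n β := fun a ha => by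
    rw [mem_gammaZero_iff hβ, hκ a ha]; exact (Finset.mem_filter.1 ha).2
  refine ⟨R, κ, ⟨fun i j => if i = j then 1 else 0,
    Finset.mem_filter.2 ⟨Finset.mem_univ _, fun i j => ?_⟩⟩, hκ', fun x hx hxm => ?_⟩
  · simp only [A, Matrix.of_apply]
    have hone : (1 : ZMod (p ^ (β + m))).val = 1 := by
      have : Fact (1 < p ^ (β + m)) :=
        ⟨Nat.one_lt_pow (by omega) (Fact.out : p.Prime).one_lt⟩
      exact ZMod.val_one _
    rw [entryCondition]
    split_ifs with h1 h2
    · simp [hone]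
    · simp
    · simp
  set B : Matrix (Fin n) (Fin n) ℚ_[p] := (p : ℚ_[p])⁻¹ ^ β • x.val
  have h1 : ∀ a ∈ R, twistedIntegrand F χ ψ β t (κ a * x) =
      (extendZero χ x.val.det * (‖x.val.det‖ : ℂ) ^ t * F x) *
        ∏ i, ∏ j, entryFactor χ ψ β i j (B j i) (A a i j) := fun a ha => by
    have h2 := (Finset.mem_filter.1 ha).2
    have h3 := ((forall_entryCondition_iff hβ).1 h2).2.1
    rw [prod_entryFactor ψ hχ hβ, if_pos h2, twistedIntegrand, hF _ (by
      rw [← coe_gammaZero_one]; exact gammaZero_anti hβ (hκ' a ha)), Units.val_mul, hκ a ha,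
      Matrix.det_mul, extendZero_mul, norm_mul, h3, one_mul]
    simp only [B, Matrix.mul_smul, Matrix.trace_smul, smul_eq_mul]
    ring
  rw [Finset.sum_congr rfl h1, ← Finset.mul_sum]
  refine mul_eq_zero_of_right _ ?_
  rw [Finset.sum_subset (Finset.subset_univ R) fun a _ ha => by
    rw [prod_entryFactor ψ hχ hβ, if_neg]; simpa [R] using ha]
  have h4 : ∑ a, ∏ i, ∏ j, entryFactor χ ψ β i j (B j i) (A a i j) =
      ∏ i, ∏ j, residueSum p (β + m) (entryFactor χ ψ β i j (B j i)) := by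
    simp_rw [residueSum, Finset.prod_univ_sum, Fintype.piFinset_univ]
    rfl
  rw [h4]
  by_contra hne
  refine hx ((mem_gammaZero_iff hβ).2 fun i j => ?_)
  have h5 := Finset.prod_ne_zero_iff.1 (Finset.prod_ne_zero_iff.1 hne j (Finset.mem_univ _)) i
    (Finset.mem_univ _)
  have h6 := entryCondition_of_residueSum_ne_zero hψ hχ hβ j i (by omega) (by
    simp only [B, Matrix.smul_apply, smul_eq_mul, norm_mul, norm_pow, norm_inv, Padic.norm_p,
      inv_inv]
    rw [Nat.cast_add, zpow_add₀ hp0, zpow_natCast]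
    exact mul_le_mul_of_nonneg_left (hxm i j) (by positivity)) h5
  simpa [B, ← mul_assoc, ← mul_pow, hpp] using h6

/-- A uniform set of representatives exists only for entries bounded by `p^m`. The complement is
exhausted by such pieces, each stable under left translation by `Γ₀(p^β)`. On each, the integral
times the number of representatives vanishes, and integrability permits passing to the limit. -/
theorem integral_compl_gammaZero (hF : ∀ k ∈ Iw p n, ∀ x, F (k * x) = F x)
    (hψ : HasConductorOne ψ) (hχ : HasConductor χ β) (hβ : 1 ≤ β)
    (hint : Integrable (twistedIntegrand F χ ψ β t) μ) :
    ∫ x in (gammaZero p n β : Set (GL (Fin n) ℚ_[p]))ᶜ, twistedIntegrand F χ ψ β t x ∂μ = 0 := by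
  have hp1 : (1 : ℝ) < p := by exact_mod_cast (Fact.out : p.Prime).one_lt
  let E : ℕ → Set (GL (Fin n) ℚ_[p]) := fun m =>
    (gammaZero p n β : Set (GL (Fin n) ℚ_[p]))ᶜ ∩ {g | EntriesLE ((p : ℝ) ^ (m : ℤ)) g.val}
  have hEm : ∀ m, MeasurableSet (E m) := fun m => by
    refine (isOpen_gammaZero β).measurableSet.compl.inter ?_
    simpa using (isOpen_entriesLE_sub (prime_zpow_pos (p := p) (m : ℤ)) 0).measurableSet
  have hE : (gammaZero p n β : Set (GL (Fin n) ℚ_[p]))ᶜ = ⋃ m, E m := by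
    refine Set.Subset.antisymm (fun g hg => ?_) (Set.iUnion_subset fun m => Set.inter_subset_left)
    obtain ⟨m, hm⟩ := pow_unbounded_of_one_lt (∑ i, ∑ j, ‖g.val i j‖) hp1
    refine Set.mem_iUnion.2 ⟨m, hg, fun i j => ?_⟩
    rw [zpow_natCast]
    exact ((Finset.single_le_sum (f := fun j => ‖g.val i j‖) (fun _ _ => norm_nonneg _)
      (Finset.mem_univ j)).trans (Finset.single_le_sum (f := fun i => ∑ j, ‖g.val i j‖)
      (fun _ _ => Finset.sum_nonneg fun _ _ => norm_nonneg _) (Finset.mem_univ i))).trans hm.le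
  have hzero : ∀ m, ∫ x in E m, twistedIntegrand F χ ψ β t x ∂μ = 0 := fun m => by
    obtain ⟨R, κ, hRne, hκ, hR⟩ := sum_twistedIntegrand_eq_zero (t := t) hF hψ hχ hβ m
    have hinv : ∀ a ∈ R, ∀ x, κ a * x ∈ E m ↔ x ∈ E m := fun a ha x => by
      have hle : ∀ k ∈ gammaZero p n β, ∀ x : GL (Fin n) ℚ_[p],
          EntriesLE ((p : ℝ) ^ (m : ℤ)) x.val → EntriesLE ((p : ℝ) ^ (m : ℤ)) (k * x).val :=
        fun k hk x hx => by simpa using hk.1.mul zero_le_one (prime_zpow_pos _).le hx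
      refine and_congr (not_congr (Subgroup.mul_mem_cancel_left _ (hκ a ha)))
        ⟨fun h => ?_, hle _ (hκ a ha) x⟩
      simpa using hle _ (inv_mem (hκ a ha)) _ h
    have h1 : ∑ a ∈ R, ∫ x in E m, twistedIntegrand F χ ψ β t (κ a * x) ∂μ = 0 := by
      rw [← integral_finsetSum _ fun a _ => (hint.comp_mul_left (κ a)).integrableOn]
      exact setIntegral_eq_zero_of_forall_eq_zero fun x hx => hR x hx.1 hx.2
    rw [Finset.sum_congr rfl fun a ha => setIntegral_mul_left μ (hEm m) _ (κ a) (hinv a ha),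
      Finset.sum_const, nsmul_eq_mul] at h1
    exact (mul_eq_zero.1 h1).resolve_left (by
      exact_mod_cast (Finset.card_pos.2 hRne).ne')
  have hmono : Monotone E := fun a b hab g hg => ⟨hg.1, hg.2.mono
    (zpow_le_zpow_right₀ hp1.le (by exact_mod_cast hab))⟩
  have hlim := tendsto_setIntegral_of_monotone hEm hmono hint.integrableOn
  rw [← hE] at hlim
  simp only [hzero] at hlim
  exact (tendsto_nhds_unique hlim tendsto_const_nhds)

/-- Here `F` is constant and `|det x| = 1`. What remains is a product over entries with parameter
matrix `p^{-β}` times the identity. -/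
theorem integral_gammaZero (hF : ∀ k ∈ Iw p n, ∀ x, F (k * x) = F x)
    (hψ : HasConductorOne ψ) (hχ : HasConductor χ β) (hβ : 1 ≤ β) :
    ∫ x in (gammaZero p n β : Set (GL (Fin n) ℚ_[p])), twistedIntegrand F χ ψ β t x ∂μ =
      F 1 * (μ.real (congruenceSubgroup p (Fin n) β : Set (GL (Fin n) ℚ_[p])) *
        ∏ i : Fin n, ∏ j, residueSum p β (entryFactor χ ψ β i j
          (if j = i then (p : ℚ_[p])⁻¹ ^ β else 0))) := by
  classical
  set B : Matrix (Fin n) (Fin n) ℚ_[p] := (p : ℚ_[p])⁻¹ ^ β • 1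
  have hB : ∀ i j, B j i = if j = i then (p : ℚ_[p])⁻¹ ^ β else 0 := fun i j => by
    simp [B, Matrix.one_apply]
  rw [← integral_indicator (isOpen_gammaZero β).measurableSet,
    ← integral_prod_entries μ hβ _ (fun i j => isResidual_entryFactor hψ hχ hβ i j le_rfl ?_)
      fun A hA => ((forall_entryCondition_iff hβ).1 fun i j => ?_).2.1, ← integral_const_mul]
  · congr 1
    ext x
    simp only [← hB]
    rw [prod_entryFactor ψ hχ hβ]
    by_cases hx : x ∈ gammaZero p n β
    · rw [Set.indicator_of_mem hx, if_pos ((mem_gammaZero_iff hβ).1 hx), twistedIntegrand]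
      have h1 : F x = F 1 := by
        rw [← hF x (by rw [← coe_gammaZero_one]; exact gammaZero_anti hβ hx) 1, mul_one]
      rw [h1, hx.2.1]
      simp only [B, Matrix.mul_smul, Matrix.trace_smul, smul_eq_mul, mul_one, Complex.ofReal_one,
        Complex.one_cpow]
      ring
    · rw [Set.indicator_of_notMem hx, if_neg fun h => hx ((mem_gammaZero_iff hβ).2 h), mul_zero]
  · split_ifs
    · simp
    · simp
  · by_contra h
    exact hA i j (by rw [entryFactor, if_neg h])

end MainIntegral

/-! ### Counting residues -/

section Counting

variable {p : ℕ} [Fact p.Prime] {n : ℕ}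

theorem residueSum_eq_sum_range (m : ℕ) (h : ℚ_[p] → ℂ) :
    residueSum p m h = ∑ k ∈ Finset.range (p ^ m), h k := by
  refine Finset.sum_bij' (fun a _ => a.val) (fun k _ => (k : ZMod (p ^ m))) (fun a _ => ?_)
    (fun _ _ => Finset.mem_univ _) (fun a _ => ?_) (fun k hk => ?_) (fun _ _ => rfl)
  · exact Finset.mem_range.2 (ZMod.val_lt a)
  · simp
  · exact ZMod.val_cast_of_lt (Finset.mem_range.1 hk)

open Classical in
theorem residueSum_integers (m : ℕ) :
    residueSum p m (fun x => if ‖x‖ ≤ 1 then 1 else 0) = (p : ℂ) ^ m := by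
  rw [residueSum, Finset.sum_congr rfl fun a _ => if_pos (norm_natCast_le_one _)]
  simp [ZMod.card]

open Classical in
theorem residueSum_units {m : ℕ} (hm : 1 ≤ m) :
    residueSum p m (fun x => if ‖x‖ = 1 then 1 else 0) = (p : ℂ) ^ m * (1 - (p : ℂ)⁻¹) := by
  have hp0 : (p : ℂ) ≠ 0 := by exact_mod_cast (Fact.out : p.Prime).ne_zero
  rw [residueSum_eq_sum_range, ← Finset.sum_filter, Finset.sum_const, nsmul_one]
  have h1 : (Finset.range (p ^ m)).filter (fun k : ℕ => ‖(k : ℚ_[p])‖ = 1) =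
      (Finset.range (p ^ m)).filter (p ^ m).Coprime := by
    refine Finset.filter_congr fun k _ => ?_
    rw [Padic.norm_natCast_eq_one_iff, Nat.coprime_pow_left_iff (by omega)]
  rw [h1, ← Nat.totient_eq_card_coprime, Nat.totient_prime_pow Fact.out (by omega)]
  obtain ⟨m, rfl⟩ := Nat.exists_eq_add_of_le' hm
  rw [Nat.add_sub_cancel, Nat.cast_mul, Nat.cast_sub (Fact.out : p.Prime).one_lt.le, pow_succ]
  push_cast
  field_simp

open Classical in
theorem residueSum_nonunits {m : ℕ} (hm : 1 ≤ m) :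
    residueSum p m (fun x => if ‖x‖ ≤ (p : ℝ) ^ (-((1 : ℕ) : ℤ)) then 1 else 0) =
      (p : ℂ) ^ (m - 1) := by
  have hp0 : (p : ℂ) ≠ 0 := by exact_mod_cast (Fact.out : p.Prime).ne_zero
  have h1 := residueSum_integers (p := p) m
  have h2 := residueSum_units (p := p) hm
  have h3 : residueSum p m (fun x => if ‖x‖ ≤ (p : ℝ) ^ (-((1 : ℕ) : ℤ)) then 1 else 0) =
      residueSum p m (fun x => if ‖x‖ ≤ 1 then 1 else 0) -
        residueSum p m (fun x => if ‖x‖ = 1 then 1 else 0) := by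
    rw [residueSum, residueSum, residueSum, ← Finset.sum_sub_distrib]
    refine Finset.sum_congr rfl fun a _ => ?_
    rw [if_pos (norm_natCast_le_one _)]
    simp only [← norm_lt_one_iff_le]
    by_cases h : ‖((a.val : ℕ) : ℚ_[p])‖ = 1
    · rw [if_neg (by rw [h]; exact lt_irrefl _), if_pos h, sub_self]
    · rw [if_pos (lt_of_le_of_ne (norm_natCast_le_one _) h), if_neg h, sub_zero]
  rw [h3, h1, h2]
  obtain ⟨m, rfl⟩ := Nat.exists_eq_add_of_le' hm
  rw [Nat.add_sub_cancel, pow_succ]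
  field_simp
  ring

open Classical in
theorem residueSum_zero (m : ℕ) :
    residueSum p m (fun x => if ‖x‖ ≤ (p : ℝ) ^ (-(m : ℤ)) then 1 else 0) = 1 := by
  rw [residueSum, Finset.sum_eq_single 0]
  · simp
  · refine fun a _ ha => if_neg fun h => ha ?_
    have := (norm_natCast_sub_le_iff m a.val 0).1 (by simpa using h)
    simpa using this
  · simp

theorem exists_prod_prod_ite (n : ℕ) : ∃ q : ℕ, 2 * q + n = n ^ 2 ∧ ∀ a b c : ℂ,
    ∏ i : Fin n, ∏ j : Fin n, (if i = j then a else if j < i then b else c) =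
      a ^ n * b ^ q * c ^ q := by
  let s₁ := Finset.univ.filter fun x : Fin n × Fin n => x.1 = x.2
  let s₂ := Finset.univ.filter fun x : Fin n × Fin n => x.2 < x.1
  let s₃ := Finset.univ.filter fun x : Fin n × Fin n => x.1 < x.2
  have h1 : s₁.card = n := by
    have : s₁ = Finset.univ.image fun i : Fin n => (i, i) := by
      ext ⟨i, j⟩; simp [s₁]
    rw [this, Finset.card_image_of_injective _ fun i j h => (Prod.ext_iff.1 h).1]
    simp
  have h3 : s₃.card = s₂.card := by
    refine Finset.card_bij (fun x _ => x.swap) (fun x hx => ?_) (fun x _ y _ h => ?_)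
      (fun x hx => ⟨x.swap, ?_, ?_⟩)
    · simpa [s₂, s₃] using hx
    · exact Prod.swap_injective h
    · simpa [s₂, s₃] using hx
    · simp
  have hprod : ∀ a b c : ℂ, ∏ i : Fin n, ∏ j : Fin n, (if i = j then a else if j < i then b else c) =
      a ^ s₁.card * b ^ s₂.card * c ^ s₃.card := fun a b c => by
    rw [← Finset.prod_const, ← Finset.prod_const, ← Finset.prod_const, Finset.prod_filter,
      Finset.prod_filter, Finset.prod_filter, ← Finset.prod_mul_distrib,
      ← Finset.prod_mul_distrib, ← Finset.univ_product_univ, Finset.prod_product]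
    refine Finset.prod_congr rfl fun i _ => Finset.prod_congr rfl fun j _ => ?_
    rcases lt_trichotomy i j with h | h | h
    · simp [h, h.ne, h.asymm]
    · simp [h]
    · simp [h, h.ne', h.asymm]
  refine ⟨s₂.card, ?_, fun a b c => by rw [hprod, h1, h3]⟩
  have h4 : s₁.card + s₂.card + s₃.card = n ^ 2 := by
    -- Setting all three values to `2` and comparing exponents counts all index pairs.
    have h5 := hprod 2 2 2
    simp only [ite_self, Finset.prod_const, Finset.card_univ, Fintype.card_fin, ← pow_add,
      ← pow_mul] at h5
    have h6 : 2 ^ (n * n) = 2 ^ (s₁.card + s₂.card + s₃.card) := by exact_mod_cast h5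
    rw [pow_two]
    exact (Nat.pow_right_injective le_rfl h6).symm
  rw [h1, h3] at h4
  omega

end Counting

/-! ### The Gauss sum as a residue sum -/

section GaussSum

variable {p : ℕ} [Fact p.Prime] {n : ℕ}

/-- By translation invariance all residue classes of units have the same mass; applying the formula
to the indicator function of the units determines it. -/
theorem integral_padicInt_units [MeasurableSpace ℤ_[p]ˣ] [BorelSpace ℤ_[p]ˣ] {m : ℕ}
    (hm : 1 ≤ m) {h : ℚ_[p] → ℂ} (hh : IsResidual p m h) (hs : ∀ x, ‖x‖ ≠ 1 → h x = 0) :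
    (p : ℂ) ^ m * (1 - (p : ℂ)⁻¹) *
      ∫ c : ℤ_[p]ˣ, h ((c : ℤ_[p]) : ℚ_[p]) ∂(Measure.haarMeasure ⊤) = residueSum p m h := by
  classical
  set ν : Measure ℤ_[p]ˣ := Measure.haarMeasure ⊤
  have hν : ν Set.univ = 1 := Measure.haarMeasure_self (K₀ := ⊤)
  have : IsProbabilityMeasure ν := ⟨hν⟩
  let C : ℚ_[p] → Set ℤ_[p]ˣ := fun a =>
    {c | ‖((c : ℤ_[p]) : ℚ_[p]) - a‖ ≤ (p : ℝ) ^ (-(m : ℤ))}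
  have hcont : Continuous fun c : ℤ_[p]ˣ => ((c : ℤ_[p]) : ℚ_[p]) :=
    (continuous_induced_dom : Continuous fun z : ℤ_[p] => (z : ℚ_[p])).comp Units.continuous_val
  have hC : ∀ a, MeasurableSet (C a) := fun a =>
    (isClosed_le (hcont.sub continuous_const).norm continuous_const).measurableSet
  have hCa : ∀ a : ℚ_[p], ‖a‖ = 1 → ν.real (C a) = ν.real (C 1) := fun a ha => by
    let u : ℤ_[p]ˣ := PadicInt.mkUnits ha
    have hu : ((u : ℤ_[p]) : ℚ_[p]) = a := rfl
    have : C a = (fun c => u⁻¹ * c) ⁻¹' C 1 := by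
      ext c
      have h1 : (((u⁻¹ * c : ℤ_[p]ˣ) : ℤ_[p]) : ℚ_[p]) * a = ((c : ℤ_[p]) : ℚ_[p]) := by
        rw [← hu, ← PadicInt.coe_mul, ← Units.val_mul]
        simp [mul_comm]
      change ‖_‖ ≤ _ ↔ ‖_‖ ≤ _
      rw [← h1, show ∀ b : ℚ_[p], b * a - a = (b - 1) * a by intro b; ring, norm_mul, ha, mul_one]
    rw [Measure.real, this, measure_preimage_mul, Measure.real]
  have key : ∀ h : ℚ_[p] → ℂ, IsResidual p m h → (∀ x, ‖x‖ ≠ 1 → h x = 0) →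
      ∫ c : ℤ_[p]ˣ, h ((c : ℤ_[p]) : ℚ_[p]) ∂ν = ν.real (C 1) * residueSum p m h := by
    intro h hh hs
    have h1 : ∀ c : ℤ_[p]ˣ, h ((c : ℤ_[p]) : ℚ_[p]) =
        ∑ a : ZMod (p ^ m), (C a.val).indicator (fun _ => h a.val) c := fun c => by
      rw [hh.eq_sum]
      rfl
    simp_rw [h1]
    rw [integral_finsetSum _ fun a _ => (integrable_const _).indicator (hC _), residueSum,
      Finset.mul_sum]
    refine Finset.sum_congr rfl fun a _ => ?_
    rw [integral_indicator_const _ (hC _), Complex.real_smul]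
    by_cases ha : ‖(a.val : ℚ_[p])‖ = 1
    · rw [hCa _ ha]
    · rw [hs _ ha, mul_zero, mul_zero]
  have hunit := key (fun x => if ‖x‖ = 1 then 1 else 0) ⟨fun x hx => if_neg fun h => hx h.le,
    fun x y hxy => by
      have h1 := hxy.trans_lt (zpow_neg_lt_one hm)
      have h2 : ‖x‖ = 1 ↔ ‖y‖ = 1 := ⟨fun h => norm_eq_one_of_norm_sub_lt h
        (by rwa [norm_sub_rev]), fun h => norm_eq_one_of_norm_sub_lt h h1⟩
      simp only [h2]⟩ fun x hx => if_neg hx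
  rw [residueSum_units hm] at hunit
  have h1 : ∀ c : ℤ_[p]ˣ, ‖((c : ℤ_[p]) : ℚ_[p])‖ = 1 := fun c => by
    rw [← PadicInt.norm_def, PadicInt.norm_units]
  simp only [h1, if_true] at hunit
  rw [integral_const, Measure.real, hν] at hunit
  rw [key h hh hs, ← mul_assoc, mul_comm _ (ν.real (C 1) : ℂ), ← hunit]
  simp

theorem gaussSum_eq_residueSum {χ : ℚ_[p]ˣ →* ℂˣ} {ψ : AddChar ℚ_[p] ℂ} (hψ : HasConductorOne ψ)
    {β : ℕ} (hχ : HasConductor χ β) (hβ : 1 ≤ β) (i : Fin n) :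
    gaussSum χ ψ β = residueSum p β (entryFactor χ ψ β i i ((p : ℚ_[p])⁻¹ ^ β)) := by
  let _ : MeasurableSpace ℤ_[p]ˣ := borel _
  have _ : BorelSpace ℤ_[p]ˣ := ⟨rfl⟩
  rw [← integral_padicInt_units hβ (isResidual_entryFactor hψ hχ hβ i i le_rfl (by simp))
    fun x hx => by rw [entryFactor, if_neg]; simp [entryCondition, hx]]
  rw [gaussSum]
  congr 2
  ext c
  have h1 : ‖((c : ℤ_[p]) : ℚ_[p])‖ = 1 := by rw [← PadicInt.norm_def, PadicInt.norm_units]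
  rw [entryFactor, if_pos (by simp [entryCondition]), if_pos rfl, ← extendZero_units]
  rfl

end GaussSum

/-! ### The constant `Υ'` -/

section Volume

variable {p : ℕ} [Fact p.Prime] {n : ℕ} [MeasurableSpace (GL (Fin n) ℚ_[p])]
  [BorelSpace (GL (Fin n) ℚ_[p])] (μ : Measure (GL (Fin n) ℚ_[p])) [μ.IsHaarMeasure]

theorem measureReal_iwahori {m : ℕ} (hm : 1 ≤ m) : (μ.real (Iw p n) : ℂ) =
    μ.real (congruenceSubgroup p (Fin n) m : Set (GL (Fin n) ℚ_[p])) *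
      ∏ i : Fin n, ∏ j : Fin n, (if i = j then (p : ℂ) ^ m * (1 - (p : ℂ)⁻¹) else
        if j < i then (p : ℂ) ^ (m - 1) else (p : ℂ) ^ m) := by
  classical
  have hp1 : (1 : ℝ) ≤ p := by exact_mod_cast (Fact.out : p.Prime).one_lt.le
  have h1 := integral_prod_entries μ hm
    (fun i j x => if entryCondition p 1 i j x then 1 else 0)
    (fun i j => ⟨fun x hx => if_neg fun h => hx h.norm_le, fun x y hxy => by
      have h2 := entryCondition_add_iff (p := p) (i := i) (j := j) le_rfl (x := y) (y := x - y)
        (hxy.trans (zpow_le_zpow_right₀ hp1 (by omega)))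
      rw [add_sub_cancel] at h2
      simp only [h2]⟩)
    fun A hA => ((forall_entryCondition_iff le_rfl).1 fun i j => by
      by_contra h; exact hA i j (if_neg h)).2.1
  have h2 : ∀ g : GL (Fin n) ℚ_[p],
      (∏ i, ∏ j, if entryCondition p 1 i j (g.val i j) then (1 : ℂ) else 0) =
        (Iw p n).indicator (fun _ => 1) g := fun g => by
    by_cases hg : g ∈ Iw p n
    · rw [Set.indicator_of_mem hg]
      rw [← coe_gammaZero_one] at hg
      have := (mem_gammaZero_iff le_rfl).1 hg
      simp [this]
    · rw [Set.indicator_of_notMem hg]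
      rw [← coe_gammaZero_one, SetLike.mem_coe, mem_gammaZero_iff le_rfl] at hg
      push Not at hg
      obtain ⟨i, j, hij⟩ := hg
      exact Finset.prod_eq_zero (Finset.mem_univ i) (Finset.prod_eq_zero (Finset.mem_univ j)
        (if_neg hij))
  have hmeas : MeasurableSet (Iw p n) := by
    rw [← coe_gammaZero_one]; exact (isOpen_gammaZero 1).measurableSet
  simp only [h2] at h1
  rw [integral_indicator_const _ hmeas, Complex.real_smul, mul_one] at h1
  rw [h1]
  congr 1
  refine Finset.prod_congr rfl fun i _ => Finset.prod_congr rfl fun j _ => ?_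
  simp only [entryCondition]
  split_ifs
  · exact residueSum_units hm
  · exact residueSum_nonunits hm
  · exact residueSum_integers m

/-- Compared with the count for `Iw_n` modulo `p^β`, a diagonal entry gives `τ(χ)` instead of `p^β
(1 - p⁻¹)`, an entry below the diagonal `1` instead of `p^(β-1)`, and one above `p^β` in both. With
`q = (n² - n)/2` the quotient carries `p` to the power `-βn - (β-1)q = q - β(q + n)`. -/
theorem volume_identity {χ : ℚ_[p]ˣ →* ℂˣ} {ψ : AddChar ℚ_[p] ℂ} (hψ : HasConductorOne ψ)
    {β : ℕ} (hχ : HasConductor χ β) (hβ : 1 ≤ β) :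
    (μ.real (congruenceSubgroup p (Fin n) β : Set (GL (Fin n) ℚ_[p])) : ℂ) *
        ∏ i : Fin n, ∏ j, residueSum p β (entryFactor χ ψ β i j
          (if j = i then (p : ℚ_[p])⁻¹ ^ β else 0)) =
      upsilon' μ * (p : ℂ) ^ (-(β : ℂ) * (((n : ℂ) ^ 2 + n) / 2)) * gaussSum χ ψ β ^ n := by
  classical
  have hp0 : (p : ℂ) ≠ 0 := by exact_mod_cast (Fact.out : p.Prime).ne_zero
  have hp1 : 1 - (p : ℂ)⁻¹ ≠ 0 := by
    have h1 : (p : ℂ) ≠ 1 := by exact_mod_cast (Fact.out : p.Prime).ne_one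
    intro h
    exact h1 (inv_eq_one.1 (sub_eq_zero.1 h).symm)
  obtain ⟨q, hq, hprod⟩ := exists_prod_prod_ite n
  have h1 : ∀ i j : Fin n, residueSum p β (entryFactor χ ψ β i j
      (if j = i then (p : ℚ_[p])⁻¹ ^ β else 0)) =
      if i = j then gaussSum χ ψ β else if j < i then 1 else (p : ℂ) ^ β := fun i j => by
    by_cases hij : i = j
    · subst hij
      rw [if_pos rfl, if_pos rfl, gaussSum_eq_residueSum hψ hχ hβ]
    · rw [if_neg (Ne.symm hij), if_neg hij]
      have h2 : entryFactor χ ψ β i j 0 = fun x => if entryCondition p β i j x then 1 else 0 := by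
        ext x
        simp [entryFactor, hij]
      rw [h2]
      simp only [entryCondition, if_neg hij]
      split_ifs
      · exact residueSum_zero β
      · exact residueSum_integers β
  have hqC : (2 : ℂ) * q + n = (n : ℂ) ^ 2 := by exact_mod_cast hq
  have e1 : (p : ℂ) ^ (((n : ℂ) ^ 2 - n) / 2) = (p : ℂ) ^ q := by
    rw [show ((n : ℂ) ^ 2 - n) / 2 = (q : ℂ) by rw [← hqC]; ring, Complex.cpow_natCast]
  have e2 : (p : ℂ) ^ (-(β : ℂ) * (((n : ℂ) ^ 2 + n) / 2)) = ((p : ℂ) ^ (β * (q + n)))⁻¹ := by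
    rw [show -(β : ℂ) * (((n : ℂ) ^ 2 + n) / 2) = -((β * (q + n) : ℕ) : ℂ) by
      rw [← hqC]; push_cast; ring, Complex.cpow_neg, Complex.cpow_natCast]
  simp_rw [h1]
  rw [hprod, upsilon', measureReal_iwahori μ hβ, hprod, e1, e2]
  obtain ⟨b, rfl⟩ := Nat.exists_eq_add_of_le' hβ
  rw [Nat.add_sub_cancel]
  rw [mul_pow, one_pow, mul_one]
  generalize 1 - (p : ℂ)⁻¹ = d at hp1
  field_simp
  ring

end Volume

/-! ### Block matrices in the Iwahori subgroup -/

section Iwahori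

variable {p : ℕ} [Fact p.Prime] {n : ℕ}

theorem one_mem_iwahori : (1 : GL (Fin n) ℚ_[p]) ∈ Iw p n := by
  rw [← coe_gammaZero_one]; exact one_mem _

theorem inv_mem_iwahori {k : GL (Fin n) ℚ_[p]} (hk : k ∈ Iw p n) : k⁻¹ ∈ Iw p n := by
  rw [← coe_gammaZero_one] at hk ⊢; exact inv_mem hk

theorem fromBlocks_mem_iwahori {a b : GL (Fin n) ℚ_[p]} (ha : a ∈ Iw p n) (hb : b ∈ Iw p n)
    {X : Matrix (Fin n) (Fin n) ℚ_[p]} (hX : EntriesLE 1 X) {g : G2 p n}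
    (hg : g.val = Matrix.fromBlocks a.val X 0 b.val) : g ∈ Iw2 p n := by
  refine ⟨?_, ?_, ?_⟩
  · rw [hg]
    rintro (i | i) (j | j)
    · exact ha.1 i j
    · exact hX i j
    · simp
    · exact hb.1 i j
  · rw [hg, Matrix.det_fromBlocks_zero₂₁, norm_mul, ha.2.1, hb.2.1, one_mul]
  · rw [hg]
    rintro (i | i) (j | j) hij
    · exact ha.2.2 i j (by simpa [pos] using hij)
    · have := i.2
      simp only [pos, Sum.elim_inl, Sum.elim_inr] at hij
      omega
    · simp
    · exact hb.2.2 i j (by simpa [pos] using hij)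

theorem blockDiag_mem_iwahori {a b : GL (Fin n) ℚ_[p]} (ha : a ∈ Iw p n) (hb : b ∈ Iw p n) :
    blockDiag a b ∈ Iw2 p n :=
  fromBlocks_mem_iwahori ha hb (X := 0) (fun _ _ => by simp) rfl

theorem blockUnip_mem_iwahori {X : Matrix (Fin n) (Fin n) ℚ_[p]} (hX : EntriesLE 1 X) :
    blockUnip X ∈ Iw2 p n :=
  fromBlocks_mem_iwahori one_mem_iwahori one_mem_iwahori hX rfl

theorem congruenceSubgroup_subset_iwahori {ι : Type*} [Fintype ι] [DecidableEq ι] (r : ι → ℕ) :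
    (congruenceSubgroup p ι 1 : Set (GL ι ℚ_[p])) ⊆ iwahori r := fun g hg => by
  refine ⟨hg.1, norm_det_eq_one hg.1 hg.2.1, fun i j hij => norm_lt_one_iff_le.2 ?_⟩
  have h := hg.2.2 i j
  rwa [Matrix.sub_apply, Matrix.one_apply_ne (by rintro rfl; exact hij.false), sub_zero] at h

end Iwahori

/-! ### Invariance, support and ramification of `W` on `diag(y, 1)` -/

namespace IsShalika

variable {p : ℕ} [Fact p.Prime] {n : ℕ} {η : ℚ_[p]ˣ →* ℂˣ} {ψ : AddChar ℚ_[p] ℂ} {W : G2 p n → ℂ}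

theorem apply_mul_iwahori (hI : ∀ k ∈ Iw2 p n, ∀ g, W (g * k) = W g) (y : GL (Fin n) ℚ_[p])
    {k : GL (Fin n) ℚ_[p]} (hk : k ∈ Iw p n) : W (blockDiag (y * k) 1) = W (blockDiag y 1) := by
  rw [← hI _ (blockDiag_mem_iwahori hk one_mem_iwahori) (blockDiag y 1),
    ShalikaZeta.blockDiag_mul, one_mul]

/-- Right invariance under `diag(1, k⁻¹)` exchanges `diag(k y, 1)` for `diag(k, k) diag(y, 1)`, up
to that factor. -/
theorem apply_iwahori_mul (hW : IsShalika η ψ W) (hI : ∀ k ∈ Iw2 p n, ∀ g, W (g * k) = W g)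
    {k : GL (Fin n) ℚ_[p]} (hk : k ∈ Iw p n) (y : GL (Fin n) ℚ_[p]) :
    W (blockDiag (k * y) 1) =
      (η (Matrix.GeneralLinearGroup.det k) : ℂ) * W (blockDiag y 1) := by
  rw [← hI _ (blockDiag_mem_iwahori one_mem_iwahori (inv_mem_iwahori hk)) (blockDiag y 1),
    ← hW.blockDiag_mul, ShalikaZeta.blockDiag_mul, ShalikaZeta.blockDiag_mul]
  simp

/-- Right invariance under an integral block unipotent matrix forces `ψ(tr(y X)) = 1` where `W` does
not vanish; `X` with a single entry isolates a non-integral entry of `y`. -/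
theorem apply_eq_zero (hψ : HasConductorOne ψ) (hW : IsShalika η ψ W)
    (hI : ∀ k ∈ Iw2 p n, ∀ g, W (g * k) = W g) {y : GL (Fin n) ℚ_[p]}
    (hy : ¬EntriesLE 1 y.val) : W (blockDiag y 1) = 0 := by
  classical
  simp only [EntriesLE, not_forall, not_le] at hy
  obtain ⟨i, j, hij⟩ := hy
  obtain ⟨c, hc, hc1⟩ := exists_psi_ne_one hψ hij
  have hX : EntriesLE 1 (Matrix.single j i c : Matrix (Fin n) (Fin n) ℚ_[p]) := fun a b => by
    rw [Matrix.single_apply]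
    split_ifs
    · exact hc
    · simp
  have h := hI _ (blockUnip_mem_iwahori hX) (blockDiag y 1)
  rw [blockDiag_mul_blockUnip, hW.blockUnip_mul, inv_one, Units.val_one, mul_one,
    Matrix.trace_mul_single, op_smul_eq_mul] at h
  by_contra h0
  exact hc1 (mul_right_cancel₀ h0 (h.trans (one_mul _).symm))

/-- If `k y = y k'` with `k`, `k'` in `Iw_n`, then `W(diag(y, 1))` is multiplied by `η(det k)` on
the left and by `1` on the right. -/
theorem isUnramified_or_apply_eq_zero (hn : 0 < n) (hW : IsShalika η ψ W)
    (hI : ∀ k ∈ Iw2 p n, ∀ g, W (g * k) = W g) :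
    IsUnramified η ∨ ∀ y, W (blockDiag y 1) = 0 := by
  by_contra! h
  obtain ⟨h1, y, hy⟩ := h
  simp only [IsUnramified, not_forall] at h1
  obtain ⟨c, hc, hηc⟩ := h1
  obtain ⟨k, hk, k', hk', hkk, hdet⟩ := exists_iwahori_conj hn y c hc
  have h2 := hW.apply_iwahori_mul hI hk y
  rw [hkk, apply_mul_iwahori hI y hk', hdet] at h2
  exact hηc (Units.ext (mul_right_cancel₀ hy (by rw [← h2, Units.val_one, one_mul])))

end IsShalika

/-! ### The change of variables -/

section ChangeOfVariables

variable {p : ℕ} [Fact p.Prime] {n : ℕ}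

theorem blockDiag_pow (a b : GL (Fin n) ℚ_[p]) (k : ℕ) :
    blockDiag a b ^ k = blockDiag (a ^ k) (b ^ k) := by
  induction k with
  | zero => simp [blockDiag_one]
  | succ k ih => rw [pow_succ, ih, blockDiag_mul, pow_succ, pow_succ]

theorem tMat_eq_blockDiag :
    tMat p n = blockDiag (scalarGL p n (pUnit p ^ n) * zMat p n) (zMat p n) := by
  ext (i | i) (j | j)
  · change _ = (scalarGL p n (pUnit p ^ n) * zMat p n).val i j
    rw [scalarGL_mul_apply]
    by_cases hij : i = j
    · subst hij
      have := i.2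
      simp only [tMat, zMat, diagGL, Matrix.diagonal_apply_eq, pos, Sum.elim_inl]
      rw [← Units.val_mul, ← pow_add]
      congr 2; omega
    · simp [tMat, zMat, diagGL, hij]
  · simp [tMat, diagGL, blockDiag]
  · simp [tMat, diagGL, blockDiag]
  · change _ = (zMat p n).val i j
    by_cases hij : i = j
    · subst hij
      have := i.2
      simp only [tMat, zMat, diagGL, Matrix.diagonal_apply_eq, pos, Sum.elim_inr]
      congr 2; omega
    · simp [tMat, zMat, diagGL, hij]

theorem inv_uMat : (uMat p n)⁻¹ = blockUnip (-(longestWeyl p n).val) := by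
  ext1
  simp [uMat, blockUnip]

theorem scalarGL_mul (c d : ℚ_[p]ˣ) : scalarGL p n c * scalarGL p n d = scalarGL p n (c * d) := by
  ext1; simp [scalarGL, diagGL]

theorem scalarGL_pow (c : ℚ_[p]ˣ) (k : ℕ) : scalarGL p n c ^ k = scalarGL p n (c ^ k) := by
  induction k with
  | zero => ext1; simp [scalarGL, diagGL]
  | succ k ih => rw [pow_succ, ih, scalarGL_mul, pow_succ]

theorem det_scalarGL (c : ℚ_[p]ˣ) :
    Matrix.GeneralLinearGroup.det (scalarGL p n c) = c ^ n := by
  ext1; simp [scalarGL, diagGL]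

theorem scalarGL_neg_one : scalarGL p n (-1) = -1 := by
  ext i j; simp [scalarGL, diagGL, Matrix.diagonal_apply, Matrix.one_apply, apply_ite]

theorem neg_one_mem_iwahori : (-1 : GL (Fin n) ℚ_[p]) ∈ Iw p n := by
  refine ⟨fun i j => ?_, ?_, fun i j hij => ?_⟩
  · simpa using EntriesLE.one (p := p) (ι := Fin n) i j
  · simp [Matrix.det_neg]
  · have : i ≠ j := by rintro rfl; exact hij.false
    simp [Matrix.one_apply_ne this]

/-- Conjugating by the longest Weyl element inverts `z`, up to scalars. -/
theorem inv_zMat_pow_mul_longestWeyl (hn : 1 ≤ n) (β : ℕ) :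
    (zMat p n ^ β)⁻¹ * longestWeyl p n * (scalarGL p n (pUnit p ^ n) * zMat p n) ^ β =
      scalarGL p n (pUnit p ^ β) * (longestWeyl p n * zMat p n ^ (2 * β)) := by
  set w := longestWeyl p n
  set z := zMat p n
  set s := scalarGL p n (pUnit p ^ (n - 1))
  have hww : w * w = 1 := longestWeyl_mul_self n
  have hs : ∀ c : ℚ_[p]ˣ, ∀ g : GL (Fin n) ℚ_[p], Commute (scalarGL p n c) g := scalarGL_comm
  have h1 : w * z * w = s * z⁻¹ := eq_mul_inv_of_mul_eq (longestWeyl_zMat n)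
  have hwinv : w⁻¹ = w := inv_eq_of_mul_eq_one_left hww
  have h2 : ∀ k : ℕ, w * z ^ k * w = s ^ k * (z ^ k)⁻¹ := fun k => by
    have := conj_pow (a := w) (b := z) (i := k)
    rw [hwinv] at this
    rw [← this, h1, (hs _ _).mul_pow, inv_pow]
  have h3 : s ^ β * (z ^ β)⁻¹ * w = w * z ^ β := by rw [← h2, mul_assoc, hww, mul_one]
  have h4 : scalarGL p n (pUnit p ^ n) = scalarGL p n (pUnit p) * s := by
    rw [scalarGL_mul, ← pow_succ', Nat.sub_add_cancel hn]
  rw [(hs _ _).mul_pow, h4, (hs _ _).mul_pow, two_mul, pow_add]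
  calc (z ^ β)⁻¹ * w * (scalarGL p n (pUnit p) ^ β * s ^ β * z ^ β)
      = scalarGL p n (pUnit p) ^ β * (s ^ β * (z ^ β)⁻¹ * w) * z ^ β := by
        have e1 := ((hs (pUnit p) ((z ^ β)⁻¹ * w)).pow_left β).eq
        have e2 := ((hs (pUnit p ^ (n - 1)) ((z ^ β)⁻¹ * w)).pow_left β).eq
        rw [mul_assoc (s ^ β), e2, ← mul_assoc, ← mul_assoc, ← mul_assoc, ← e1]
    _ = _ := by rw [h3, scalarGL_pow, mul_assoc, mul_assoc]

variable {η : ℚ_[p]ˣ →* ℂˣ} {ψ : AddChar ℚ_[p] ℂ} {W : G2 p n → ℂ}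

/-- Moving `u⁻¹` to the left of `diag(x, 1)` produces `ψ`; removing the lower block `z^β` of `t_p^β`
produces `η`. -/
theorem rightTranslation_apply_blockDiag (hW : IsShalika η ψ W) (β : ℕ) (x : GL (Fin n) ℚ_[p]) :
    rightTranslation (G2 p n) ((uMat p n)⁻¹ * tMat p n ^ β) W (blockDiag x 1) =
      ψ (-(x.val * (longestWeyl p n).val).trace) *
        ((η (Matrix.GeneralLinearGroup.det (zMat p n ^ β)) : ℂ) *
          W (blockDiag ((zMat p n ^ β)⁻¹ * x * (scalarGL p n (pUnit p ^ n) * zMat p n) ^ β) 1)) := by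
  change W (blockDiag x 1 * _) = _
  have h := hW.apply_blockDiag (x * (scalarGL p n (pUnit p ^ n) * zMat p n) ^ β) (zMat p n ^ β) 1
  rw [mul_one, mul_one, ← mul_assoc] at h
  rw [inv_uMat, tMat_eq_blockDiag, blockDiag_pow, ← mul_assoc, blockDiag_mul_blockUnip, mul_assoc,
    blockDiag_mul, one_mul, hW.blockUnip_mul, h]
  simp

/-- The change of variables diagonalising the twisted zeta integral. -/
noncomputable def shiftEquiv (p : ℕ) [Fact p.Prime] (n β : ℕ) :
    GL (Fin n) ℚ_[p] ≃ₜ GL (Fin n) ℚ_[p] :=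
  (Homeomorph.mulLeft (zMat p n ^ β * scalarGL p n (-(pUnit p ^ β)⁻¹))).trans
    (Homeomorph.mulRight ((zMat p n ^ β)⁻¹ * longestWeyl p n))

theorem shiftEquiv_apply (β : ℕ) (x : GL (Fin n) ℚ_[p]) : shiftEquiv p n β x =
    zMat p n ^ β * scalarGL p n (-(pUnit p ^ β)⁻¹) * x * ((zMat p n ^ β)⁻¹ * longestWeyl p n) :=
  rfl

theorem measurePreserving_shiftEquiv [MeasurableSpace (GL (Fin n) ℚ_[p])]
    [BorelSpace (GL (Fin n) ℚ_[p])] (μ : Measure (GL (Fin n) ℚ_[p])) [μ.IsHaarMeasure] (β : ℕ) :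
    MeasurePreserving (shiftEquiv p n β) μ μ :=
  (measurePreserving_mul_right μ (g := (zMat p n ^ β)⁻¹ * longestWeyl p n) (by
    have h : Measure.modularCharacter (zMat p n ^ β)⁻¹ = 1 :=
      by
        have h1 := map_mul Measure.modularCharacter (zMat p n ^ β) (zMat p n ^ β)⁻¹
        rwa [mul_inv_cancel, map_one, map_pow, modularCharacter_zMat, one_pow, one_mul,
          eq_comm] at h1
    rw [map_mul, h, modularCharacter_longestWeyl, one_mul])).comp (measurePreserving_mul_left μ _)

/-- The shift makes `-tr(x w_n)` into `p^{-β} tr x` and the argument of `W` into `-x w_n z^{2β}`,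
whose sign lies in `Iw_n`. The determinant acquires `p^{-βn} det(-w_n)`; its power of `p` is
invisible to `χ` and gives `p^{βn(s-1/2)}` in the norm. -/
theorem zetaIntegrand_shiftEquiv (hn : 1 ≤ n) (hη : IsUnramified η) (hW : IsShalika η ψ W)
    (hI : ∀ k ∈ Iw2 p n, ∀ g, W (g * k) = W g) {χ : ℚ_[p]ˣ →* ℂˣ} (hχ : χ (pUnit p) = 1)
    (β : ℕ) (s : ℂ) (x : GL (Fin n) ℚ_[p]) :
    zetaIntegrand (rightTranslation (G2 p n) ((uMat p n)⁻¹ * tMat p n ^ β) W) χ s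
        (shiftEquiv p n β x) =
      (η (Matrix.GeneralLinearGroup.det (zMat p n ^ β)) : ℂ) *
        (χ (Matrix.GeneralLinearGroup.det (-longestWeyl p n)) : ℂ) *
        (p : ℂ) ^ ((β : ℂ) * n * (s - 1 / 2)) *
        twistedIntegrand (fun y => W (blockDiag (y * (longestWeyl p n * zMat p n ^ (2 * β))) 1))
          χ ψ β (s - 1 / 2) x := by
  set w := longestWeyl p n
  set z := zMat p n
  set c : ℚ_[p]ˣ := -(pUnit p ^ β)⁻¹
  have hc : c = -1 * (pUnit p ^ β)⁻¹ := by simp [c]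
  have hww : w * w = 1 := longestWeyl_mul_self n
  have happ : shiftEquiv p n β x = z ^ β * scalarGL p n c * x * ((z ^ β)⁻¹ * w) :=
    shiftEquiv_apply β x
  have h1 : (shiftEquiv p n β x) * w = z ^ β * (scalarGL p n c * x) * (z ^ β)⁻¹ := by
    rw [happ]
    simp only [mul_assoc]
    rw [hww, mul_one]
  have htr : ((shiftEquiv p n β x).val * w.val).trace = c * x.val.trace := by
    rw [← Units.val_mul, h1, Units.val_mul, Matrix.trace_mul_comm, ← Units.val_mul, ← mul_assoc,
      inv_mul_cancel, one_mul]
    simp only [Matrix.trace, Matrix.diag_apply, scalarGL_mul_apply, Finset.mul_sum]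
  have hdet : Matrix.GeneralLinearGroup.det (shiftEquiv p n β x) =
      ((pUnit p ^ β)⁻¹) ^ n * Matrix.GeneralLinearGroup.det (-w) *
        Matrix.GeneralLinearGroup.det x := by
    have hneg : -w = scalarGL p n (-1) * w := by rw [scalarGL_neg_one, neg_one_mul]
    rw [happ, hneg]
    simp only [map_mul, map_inv, det_scalarGL]
    rw [hc, mul_pow]
    generalize Matrix.GeneralLinearGroup.det (z ^ β) = d
    generalize Matrix.GeneralLinearGroup.det w = d'
    rw [show ∀ a b x : ℚ_[p]ˣ, d * (a * b) * x * (d⁻¹ * d') = (d * d⁻¹) * (b * (a * d') * x) by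
      intros; ac_rfl, mul_inv_cancel, one_mul]
  have harg : (z ^ β)⁻¹ * (shiftEquiv p n β x) * (scalarGL p n (pUnit p ^ n) * z) ^ β =
      -1 * (x * (w * z ^ (2 * β))) := by
    have h2 := inv_zMat_pow_mul_longestWeyl (p := p) hn β
    calc _ = scalarGL p n c * x *
        ((z ^ β)⁻¹ * w * (scalarGL p n (pUnit p ^ n) * z) ^ β) := by
          rw [happ]; simp only [mul_assoc, inv_mul_cancel_left]
      _ = _ := by
        rw [h2, mul_assoc, ← mul_assoc x, ← scalarGL_comm, mul_assoc _ x, ← mul_assoc,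
          scalarGL_mul, ← scalarGL_neg_one, hc, inv_mul_cancel_right]
  have hnw : ‖(Matrix.GeneralLinearGroup.det (-w) : ℚ_[p])‖ = 1 := by
    have h2 : Matrix.GeneralLinearGroup.det (-w) * Matrix.GeneralLinearGroup.det (-w) = 1 := by
      rw [← map_mul, neg_mul_neg, hww, map_one]
    have h3 := congrArg (fun u : ℚ_[p]ˣ => ‖(u : ℚ_[p])‖) h2
    simp only [Units.val_mul, norm_mul, Units.val_one, norm_one] at h3
    exact (mul_self_eq_one_iff.1 h3).resolve_right fun h => by
      have h4 := norm_nonneg (Matrix.GeneralLinearGroup.det (-w) : ℚ_[p])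
      linarith
  have hnorm : ‖(shiftEquiv p n β x).val.det‖ = (p : ℝ) ^ (β * n) * ‖x.val.det‖ := by
    have h3 := congrArg (fun u : ℚ_[p]ˣ => ‖(u : ℚ_[p])‖) hdet
    simp only [Units.val_mul, norm_mul, hnw, mul_one] at h3
    rw [← Matrix.GeneralLinearGroup.val_det_apply, h3, Matrix.GeneralLinearGroup.val_det_apply]
    simp [norm_pUnit, pow_mul]
  have hp : (p : ℂ) ≠ 0 := by exact_mod_cast (Fact.out : p.Prime).ne_zero
  have hcpow : (‖(shiftEquiv p n β x).val.det‖ : ℂ) ^ (s - 1 / 2) =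
      (p : ℂ) ^ ((β : ℂ) * n * (s - 1 / 2)) * (‖x.val.det‖ : ℂ) ^ (s - 1 / 2) := by
    rw [hnorm, Complex.ofReal_mul, Complex.mul_cpow_ofReal_nonneg (by positivity) (norm_nonneg _)]
    congr 1
    push_cast
    rw [← Complex.natCast_cpow_natCast_mul, Nat.cast_mul]
  have hχdet : χ (Matrix.GeneralLinearGroup.det (shiftEquiv p n β x)) =
      χ (Matrix.GeneralLinearGroup.det (-w)) * χ (Matrix.GeneralLinearGroup.det x) := by
    rw [hdet, map_mul, map_mul, map_pow, map_inv, map_pow, hχ]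
    simp
  have hχx : (χ (Matrix.GeneralLinearGroup.det x) : ℂ) = extendZero χ x.val.det := by
    rw [← extendZero_units]; simp
  rw [zetaIntegrand, rightTranslation_apply_blockDiag hW, htr, harg,
    hW.apply_iwahori_mul hI neg_one_mem_iwahori, hη (Matrix.GeneralLinearGroup.det (-1 : GL (Fin n) ℚ_[p]))
      (by simpa using neg_one_mem_iwahori.2.1),
    hcpow, hχdet, Units.val_mul, hχx, twistedIntegrand,
    show -((c : ℚ_[p]) * x.val.trace) = (p : ℚ_[p])⁻¹ ^ β * x.val.trace by simp [c, pUnit]]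
  simp only [Units.val_one]
  ring

end ChangeOfVariables

/-! ### Continuity and unitarity of the characters -/

section Smooth

theorem continuous_of_mul_right_invariant {G X : Type*} [Group G] [TopologicalSpace G]
    [IsTopologicalGroup G] [TopologicalSpace X] {f : G → X} {U : Subgroup G}
    (hU : IsOpen (U : Set G)) (hf : ∀ g, ∀ k ∈ U, f (g * k) = f g) : Continuous f := by
  refine IsLocallyConstant.continuous ((IsLocallyConstant.iff_eventually_eq f).2 fun g => ?_)
  have : (fun y => g⁻¹ * y) ⁻¹' (U : Set G) ∈ nhds g :=
    (hU.preimage (continuous_const_mul g⁻¹)).mem_nhds (by simp)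
  filter_upwards [this] with y hy
  simpa using hf g _ hy

variable {p : ℕ} [Fact p.Prime] {n : ℕ} {χ : ℚ_[p]ˣ →* ℂˣ} {ψ : AddChar ℚ_[p] ℂ} {β : ℕ}

theorem continuous_psi (hψ : HasConductorOne ψ) : Continuous ψ := by
  refine IsLocallyConstant.continuous ((IsLocallyConstant.iff_eventually_eq ψ).2 fun x => ?_)
  filter_upwards [Metric.ball_mem_nhds x one_pos] with y hy
  exact psi_congr hψ (by simpa [dist_eq_norm] using (Metric.mem_ball.1 hy).le)

/-- Some `p^m x` is integral, so `ψ x` is a root of unity. -/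
theorem norm_psi (hψ : HasConductorOne ψ) (x : ℚ_[p]) : ‖ψ x‖ = 1 := by
  have hp1 : (1 : ℝ) < p := by exact_mod_cast (Fact.out : p.Prime).one_lt
  obtain ⟨m, hm⟩ := pow_unbounded_of_one_lt ‖x‖ hp1
  refine Complex.norm_eq_one_of_pow_eq_one (n := p ^ m) ?_ (pow_ne_zero _ (Fact.out : p.Prime).ne_zero)
  rw [← AddChar.map_nsmul_eq_pow]
  refine psi_eq_one hψ ?_
  rw [nsmul_eq_mul, Nat.cast_pow, norm_mul, norm_pow, Padic.norm_p, inv_pow]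
  exact inv_mul_le_one_of_le₀ hm.le (by positivity)

theorem continuous_extendZero_det (hχ : HasConductor χ β) :
    Continuous fun x : GL (Fin n) ℚ_[p] => extendZero χ x.val.det := by
  refine continuous_of_mul_right_invariant (isOpen_congruenceSubgroup p (Fin n) β)
    fun g k hk => ?_
  have h1 := norm_det_eq_one hk.1 hk.2.1
  rw [Units.val_mul, Matrix.det_mul, extendZero_mul, extendZero_congr hχ h1 norm_one
    (norm_det_sub_one_le (prime_zpow_pos _).le (zpow_neg_le_one β) hk.2.2), extendZero_one, mul_one]

/-- On units `χ` factors through the finite group of units modulo `p^β`, so its values are roots of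
unity. -/
theorem norm_character_of_norm_eq_one (hχ : HasConductor χ β) {c : ℚ_[p]ˣ}
    (hc : ‖(c : ℚ_[p])‖ = 1) : ‖(χ c : ℂ)‖ = 1 := by
  let u : ℤ_[p]ˣ := PadicInt.mkUnits hc
  let φ : ℤ_[p]ˣ →* (ZMod (p ^ β))ˣ := Units.map (PadicInt.toZModPow β).toMonoidHom
  have : NeZero (p ^ β) := ⟨pow_ne_zero _ (Fact.out : p.Prime).ne_zero⟩
  set N := Fintype.card (ZMod (p ^ β))ˣ
  have h1 : PadicInt.toZModPow β ((u : ℤ_[p]) ^ N - 1) = 0 := by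
    have h2 : φ u ^ N = 1 := pow_card_eq_one
    have h3 := congrArg Units.val h2
    rw [map_sub, map_pow, map_one, sub_eq_zero]
    simpa [φ] using h3
  rw [← RingHom.mem_ker, PadicInt.ker_toZModPow, ← PadicInt.norm_le_pow_iff_mem_span_pow] at h1
  have h2 : χ (c ^ N) = 1 := hχ.1 _ (by simp [hc]) (by
    have h3 : ((c : ℚ_[p]) ^ N - 1) = (((u : ℤ_[p]) ^ N - 1 : ℤ_[p]) : ℚ_[p]) := by
      rw [PadicInt.coe_sub, PadicInt.coe_pow, PadicInt.coe_one]; rfl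
    rw [Units.val_pow_eq_pow_val, h3, ← PadicInt.norm_def]
    exact h1)
  refine Complex.norm_eq_one_of_pow_eq_one (n := N) ?_ Fintype.card_ne_zero
  rw [← Units.val_pow_eq_pow_val, ← map_pow, h2, Units.val_one]

theorem norm_character (hχ : HasConductor χ β) (hχp : χ (pUnit p) = 1) (c : ℚ_[p]ˣ) :
    ‖(χ c : ℂ)‖ = 1 := by
  set v := (c : ℚ_[p]).valuation
  have hp0 : (p : ℝ) ≠ 0 := by exact_mod_cast (Fact.out : p.Prime).ne_zero
  have h1 : ‖((c * (pUnit p ^ v)⁻¹ : ℚ_[p]ˣ) : ℚ_[p])‖ = 1 := by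
    rw [Units.val_mul, norm_mul, Padic.norm_eq_zpow_neg_valuation c.ne_zero,
      Units.val_inv_eq_inv_val, Units.val_zpow_eq_zpow_val, norm_inv, norm_zpow, norm_pUnit]
    rw [inv_zpow, inv_inv, ← zpow_add₀ hp0, neg_add_cancel, zpow_zero]
  have h2 := norm_character_of_norm_eq_one hχ h1
  rwa [map_mul, map_inv, map_zpow, hχp, one_zpow, inv_one, mul_one] at h2

end Smooth

/-! ### Uniqueness of the meromorphic continuation -/

section Uniqueness

variable {p : ℕ} [Fact p.Prime] {n : ℕ} [MeasurableSpace (GL (Fin n) ℚ_[p])]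
  {μ : Measure (GL (Fin n) ℚ_[p])} {W : G2 p n → ℂ} {χ : ℚ_[p]ˣ →* ℂˣ}

/-- The difference has infinite order at one point, hence at all points by connectedness. Normal
form upgrades equality on punctured neighbourhoods to equality at the points. -/
theorem MeromorphicNFOn.eq_of_eqOn_halfPlane {Z₁ Z₂ : ℂ → ℂ} (h₁ : MeromorphicNFOn Z₁ Set.univ)
    (h₂ : MeromorphicNFOn Z₂ Set.univ) {σ : ℝ} (h : ∀ s : ℂ, σ < s.re → Z₁ s = Z₂ s) :
    Z₁ = Z₂ := by
  have hm : MeromorphicOn (Z₁ - Z₂) Set.univ := h₁.meromorphicOn.sub h₂.meromorphicOn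
  have h0 : meromorphicOrderAt (Z₁ - Z₂) ((σ + 1 : ℝ) : ℂ) = ⊤ := by
    rw [meromorphicOrderAt_eq_top_iff]
    have : {s : ℂ | σ < s.re} ∈ nhds ((σ + 1 : ℝ) : ℂ) :=
      (isOpen_lt continuous_const Complex.continuous_re).mem_nhds (by simp)
    filter_upwards [mem_nhdsWithin_of_mem_nhds this] with s hs
    simp [h s hs]
  have hall : ∀ s : ℂ, meromorphicOrderAt (Z₁ - Z₂) s = ⊤ := fun s => by
    by_contra hs
    exact hm.meromorphicOrderAt_ne_top_of_isPreconnected isPreconnected_univ (Set.mem_univ s)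
      (Set.mem_univ _) hs h0
  ext s
  have h3 : Z₁ =ᶠ[nhdsWithin s {s}ᶜ] Z₂ := by
    filter_upwards [meromorphicOrderAt_eq_top_iff.1 (hall s)] with t ht
    exact sub_eq_zero.1 ht
  exact (((h₁ (Set.mem_univ s)).eventuallyEq_nhdsNE_iff_eventuallyEq_nhds
    (h₂ (Set.mem_univ s))).1 h3).eq_of_nhds

theorem IsZetaFunction.unique {Z₁ Z₂ : ℂ → ℂ} (h₁ : IsZetaFunction μ W χ Z₁)
    (h₂ : IsZetaFunction μ W χ Z₂) : Z₁ = Z₂ := by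
  obtain ⟨m₁, σ₁, e₁⟩ := h₁
  obtain ⟨m₂, σ₂, e₂⟩ := h₂
  refine MeromorphicNFOn.eq_of_eqOn_halfPlane m₁ m₂ (σ := max σ₁ σ₂) fun s hs => ?_
  rw [(e₁ s ((le_max_left _ _).trans_lt hs)).2, (e₂ s ((le_max_right _ _).trans_lt hs)).2]

theorem zeta_eq_of_isZetaFunction {Z : ℂ → ℂ} (h : IsZetaFunction μ W χ Z) (s : ℂ) :
    zeta μ s W χ = Z s := by
  have hex : ∃ Z, IsZetaFunction μ W χ Z := ⟨Z, h⟩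
  rw [zeta, dif_pos hex, hex.choose_spec.unique h]

theorem meromorphicNFOn_zetaValue (η : ℚ_[p]ˣ →* ℂˣ) (ψ : AddChar ℚ_[p] ℂ) (β : ℕ) :
    MeromorphicNFOn (zetaValue μ η ψ χ β W) Set.univ := by
  have hp : (p : ℂ) ≠ 0 := by exact_mod_cast (Fact.out : p.Prime).ne_zero
  have : Differentiable ℂ (zetaValue μ η ψ χ β W) := by
    unfold zetaValue
    have h1 : Differentiable ℂ fun s : ℂ => (p : ℂ) ^ ((β : ℂ) * n * (s - 1 / 2)) :=
      Differentiable.const_cpow (by fun_prop) (Or.inl hp)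
    fun_prop
  exact fun s _ => (this.analyticAt s).meromorphicNFAt

end Uniqueness

/-! ### Evaluation and convergence of the zeta integral -/

section Evaluation

variable {p : ℕ} [Fact p.Prime] {n : ℕ} [MeasurableSpace (GL (Fin n) ℚ_[p])]
  [BorelSpace (GL (Fin n) ℚ_[p])] (μ : Measure (GL (Fin n) ℚ_[p])) [μ.IsHaarMeasure]
  {η χ : ℚ_[p]ˣ →* ℂˣ} {ψ : AddChar ℚ_[p] ℂ} {W : G2 p n → ℂ} {β : ℕ}

theorem zetaValue_eq_zero (hW : ∀ y, W (blockDiag y 1) = 0) (s : ℂ) :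
    zetaValue μ η ψ χ β W s = 0 := by
  rw [zetaValue, hW, mul_zero]

theorem zetaIntegrand_eq_zero (hWS : IsShalika η ψ W) (hW : ∀ y, W (blockDiag y 1) = 0) (s : ℂ) :
    zetaIntegrand (rightTranslation (G2 p n) ((uMat p n)⁻¹ * tMat p n ^ β) W) χ s = 0 := by
  ext x
  rw [zetaIntegrand, rightTranslation_apply_blockDiag hWS, hW]
  simp

theorem integral_zetaIntegrand (hn : 1 ≤ n) (hψ : HasConductorOne ψ) (hη : IsUnramified η)
    (hW : IsShalika η ψ W) (hI : ∀ k ∈ Iw2 p n, ∀ g, W (g * k) = W g)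
    (hχp : χ (pUnit p) = 1) (hχ : HasConductor χ β) (hβ : 1 ≤ β) {s : ℂ}
    (hint : Integrable (zetaIntegrand (rightTranslation (G2 p n)
      ((uMat p n)⁻¹ * tMat p n ^ β) W) χ s) μ) :
    ∫ x, zetaIntegrand (rightTranslation (G2 p n) ((uMat p n)⁻¹ * tMat p n ^ β) W) χ s x ∂μ =
      zetaValue μ η ψ χ β W s := by
  set F : GL (Fin n) ℚ_[p] → ℂ :=
    fun y => W (blockDiag (y * (longestWeyl p n * zMat p n ^ (2 * β))) 1)
  set A : ℂ := (η (Matrix.GeneralLinearGroup.det (zMat p n ^ β)) : ℂ) *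
    (χ (Matrix.GeneralLinearGroup.det (-longestWeyl p n)) : ℂ) *
    (p : ℂ) ^ ((β : ℂ) * n * (s - 1 / 2))
  have hp : (p : ℂ) ≠ 0 := by exact_mod_cast (Fact.out : p.Prime).ne_zero
  have hA : A ≠ 0 := mul_ne_zero (mul_ne_zero (Units.ne_zero _) (Units.ne_zero _))
    ((Complex.cpow_ne_zero_iff).2 (Or.inl hp))
  have hemb := (shiftEquiv p n β).measurableEmbedding
  have hcomp : zetaIntegrand (rightTranslation (G2 p n) ((uMat p n)⁻¹ * tMat p n ^ β) W) χ s ∘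
      shiftEquiv p n β = fun x => A * twistedIntegrand F χ ψ β (s - 1 / 2) x :=
    funext fun x => zetaIntegrand_shiftEquiv hn hη hW hI hχp β s x
  have hF : ∀ k ∈ Iw p n, ∀ x, F (k * x) = F x := fun k hk x => by
    simp only [F, mul_assoc]
    rw [hW.apply_iwahori_mul hI hk, hη _ (by simpa using hk.2.1), Units.val_one, one_mul]
  have hint' : Integrable (twistedIntegrand F χ ψ β (s - 1 / 2)) μ := by
    rw [← (measurePreserving_shiftEquiv μ β).integrable_comp_emb hemb, hcomp] at hint
    exact (integrable_const_mul_iff (isUnit_iff_ne_zero.2 hA) _).1 hint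
  rw [← (measurePreserving_shiftEquiv μ β).integral_comp hemb]
  simp only [← Function.comp_apply (g := shiftEquiv p n β), hcomp]
  rw [integral_const_mul, ← integral_add_compl (isOpen_gammaZero (p := p) (n := n) β).measurableSet
    hint', integral_compl_gammaZero μ hF hψ hχ hβ hint', add_zero,
    integral_gammaZero μ hF hψ hχ hβ, volume_identity μ hψ hχ hβ, zetaValue]
  simp only [F, A, one_mul]
  ring

/-- Both characters have absolute value `1`, so after the shift the integrand has the size of a
right translate by `g` of the function in `integrable_norm_mul_rpow`, up to the constant `|det
g|^{Re s - 1/2}`. -/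
theorem integrable_zetaIntegrand (hn : 1 ≤ n) (hψ : HasConductorOne ψ) (hη : IsUnramified η)
    (hW : IsShalika η ψ W) (hI : ∀ k ∈ Iw2 p n, ∀ g, W (g * k) = W g)
    (hχp : χ (pUnit p) = 1) (hχ : HasConductor χ β) {C : ℝ} {A : ℕ} (hC : 0 ≤ C)
    (hb : ∀ y : GL (Fin n) ℚ_[p], EntriesLE 1 y.val →
      ‖W (blockDiag y 1)‖ ≤ C * (‖y.val.det‖⁻¹) ^ A) {s : ℂ}
    (hs : (A : ℝ) + n * n + 1 / 2 < s.re) :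
    Integrable (zetaIntegrand (rightTranslation (G2 p n)
      ((uMat p n)⁻¹ * tMat p n ^ β) W) χ s) μ := by
  set g := longestWeyl p n * zMat p n ^ (2 * β)
  have hg : Measure.modularCharacter g = 1 := by
    rw [map_mul, map_pow, modularCharacter_longestWeyl, modularCharacter_zMat, one_pow, one_mul]
  have hFc : Continuous fun y : GL (Fin n) ℚ_[p] => W (blockDiag y 1) :=
    continuous_of_mul_right_invariant (isOpen_congruenceSubgroup p (Fin n) 1) fun y k hk =>
      IsShalika.apply_mul_iwahori hI y (congruenceSubgroup_subset_iwahori _ hk)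
  rw [← (measurePreserving_shiftEquiv μ β).integrable_comp_emb
    (shiftEquiv p n β).measurableEmbedding]
  refine Integrable.congr (Integrable.const_mul ?_ _) (Filter.Eventually.of_forall fun x =>
    (zetaIntegrand_shiftEquiv hn hη hW hI hχp β s x).symm)
  have h1 := ((measurePreserving_mul_right μ hg).integrable_comp
    (integrable_norm_mul_rpow μ hFc hC hb (fun y => IsShalika.apply_eq_zero hψ hW hI)
      (t := s.re - 1 / 2) (by linarith)).aestronglyMeasurable).2
    (integrable_norm_mul_rpow μ hFc hC hb (fun y => IsShalika.apply_eq_zero hψ hW hI)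
      (t := s.re - 1 / 2) (by linarith))
  have hgdet : 0 < ‖g.val.det‖ := norm_pos_iff.2 (det_ne_zero_GL g)
  refine Integrable.mono' (h1.const_mul ((‖g.val.det‖ ^ (s.re - 1 / 2))⁻¹))
    (Continuous.aestronglyMeasurable ?_) (Filter.Eventually.of_forall fun x => ?_)
  · refine (((continuous_psi hψ).comp (continuous_const.mul Units.continuous_val.matrix_trace)).mul
      (continuous_extendZero_det hχ)).mul ?_ |>.mul (hFc.comp (continuous_mul_const g))
    refine Continuous.cpow (Complex.continuous_ofReal.comp continuous_det_GL.norm)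
      continuous_const fun x => ?_
    exact Complex.ofReal_mem_slitPlane.2 (norm_pos_iff.2 (det_ne_zero_GL x))
  · have hx : 0 < ‖x.val.det‖ := norm_pos_iff.2 (det_ne_zero_GL x)
    have h2 : ‖extendZero χ x.val.det‖ = 1 := by
      rw [← norm_character hχ hχp (Matrix.GeneralLinearGroup.det x), ← extendZero_units]
      simp
    rw [twistedIntegrand, norm_mul, norm_mul, norm_mul, norm_psi hψ, h2,
      Complex.norm_cpow_eq_rpow_re_of_pos hx]
    simp only [Function.comp_apply, Units.val_mul, Matrix.det_mul, norm_mul,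
      Real.mul_rpow (norm_nonneg _) (norm_nonneg _)]
    have h3 : ‖g.val.det‖ ^ (s.re - 1 / 2) ≠ 0 := (Real.rpow_pos_of_pos hgdet _).ne'
    have h4 : (s - 1 / 2).re = s.re - 1 / 2 := by simp
    rw [h4]
    refine le_of_eq ?_
    change _ = (‖g.val.det‖ ^ (s.re - 1 / 2))⁻¹ * (‖W (blockDiag (x * g) 1)‖ *
      (‖x.val.det‖ ^ (s.re - 1 / 2) * ‖g.val.det‖ ^ (s.re - 1 / 2)))
    field_simp
    rfl

end Evaluation

end ShalikaZeta

theorem mainTheorem6 (p : ℕ) [Fact p.Prime] (n : ℕ) (hn : 1 ≤ n)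
    [MeasurableSpace (GL (Fin n) ℚ_[p])] [BorelSpace (GL (Fin n) ℚ_[p])]
    (μ : MeasureTheory.Measure (GL (Fin n) ℚ_[p])) [μ.IsHaarMeasure]
    (ψ : AddChar ℚ_[p] ℂ) (hψ : ShalikaZeta.HasConductorOne ψ)
    (η : ℚ_[p]ˣ →* ℂˣ) (hη : Continuous η)
    (θ : Fin n ⊕ Fin n → ℚ_[p]ˣ →* ℂˣ) (hθ : ∀ i, ShalikaZeta.IsUnramified (θ i))
    (S : Representation.IntertwiningMap
      (ShalikaZeta.principalSeries θ).toRepresentation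
      (ShalikaZeta.shalikaInduction n η ψ).toRepresentation)
    (hS : Function.Injective S)
    (f : (ShalikaZeta.principalSeries θ).toSubmodule)
    (hf : ∀ k ∈ ShalikaZeta.Iw2 p n, (ShalikaZeta.principalSeries θ).toRepresentation k f = f)
    (W : ShalikaZeta.G2 p n → ℂ) (hW : W = (S f).val)
    (χ : ℚ_[p]ˣ →* ℂˣ) (hχp : χ (ShalikaZeta.pUnit p) = 1)
    (β : ℕ) (hχ : ShalikaZeta.HasConductor χ β) (hβ : 1 ≤ β)
    (W' : ShalikaZeta.G2 p n → ℂ)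
    (hW' : W' = ShalikaZeta.rightTranslation (ShalikaZeta.G2 p n)
      ((ShalikaZeta.uMat p n)⁻¹ * ShalikaZeta.tMat p n ^ β) W) :
    (∃ Z : ℂ → ℂ, ShalikaZeta.IsZetaFunction μ W' χ Z) ∧
    (∀ s : ℂ, ShalikaZeta.zeta μ s W' χ = ShalikaZeta.zetaValue μ η ψ χ β W s) ∧
    (∀ s : ℂ, MeasureTheory.Integrable (ShalikaZeta.zetaIntegrand W' χ s) μ →
      ∫ x, ShalikaZeta.zetaIntegrand W' χ s x ∂μ =
        ShalikaZeta.zetaValue μ η ψ χ β W s) := by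
  subst hW hW'
  have hI : ∀ k ∈ ShalikaZeta.Iw2 p n, ∀ g, (S f).val (g * k) = (S f).val g := fun k hk g => by
    have h := S.isIntertwining _ _ k f
    rw [hf k hk] at h
    conv_rhs => rw [h]
    rfl
  have hSh : ∀ f, ShalikaZeta.IsShalika η ψ (S f).val := fun f h X g => (S f).prop.1 (h, X) g
  have hzeta : ShalikaZeta.IsZetaFunction μ
      (ShalikaZeta.rightTranslation (ShalikaZeta.G2 p n)
        ((ShalikaZeta.uMat p n)⁻¹ * ShalikaZeta.tMat p n ^ β) (S f).val) χ
      (ShalikaZeta.zetaValue μ η ψ χ β (S f).val) ∧ ∀ s : ℂ,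
      MeasureTheory.Integrable (ShalikaZeta.zetaIntegrand (ShalikaZeta.rightTranslation
        (ShalikaZeta.G2 p n) ((ShalikaZeta.uMat p n)⁻¹ * ShalikaZeta.tMat p n ^ β) (S f).val) χ s) μ →
      ∫ x, ShalikaZeta.zetaIntegrand (ShalikaZeta.rightTranslation
        (ShalikaZeta.G2 p n) ((ShalikaZeta.uMat p n)⁻¹ * ShalikaZeta.tMat p n ^ β) (S f).val) χ s x ∂μ =
      ShalikaZeta.zetaValue μ η ψ χ β (S f).val s := by
    -- In the second case both the integrand and the claimed value vanish identically, so no growth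
    -- estimate is needed.
    rcases (hSh f).isUnramified_or_apply_eq_zero hn hI with hη' | h0
    · have hfin := ShalikaZeta.finiteDimensional_principalSeries (p := p) (n := n) θ
      obtain ⟨C, A, hC, hb⟩ := ShalikaZeta.exists_growth_bound
        (ρ := (ShalikaZeta.principalSeries θ).toRepresentation)
        (L := (ShalikaZeta.shalikaInduction n η ψ).toSubmodule.subtype ∘ₗ S.toLinearMap)
        (η := η) (ψ := ψ) (f := f)
        (fun g f x => congrFun (congrArg Subtype.val (S.isIntertwining _ _ g f)) x) hSh hη' hψ
        (fun k hk => hf k (ShalikaZeta.congruenceSubgroup_subset_iwahori _ hk))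
      have key := fun s hs => ShalikaZeta.integral_zetaIntegrand μ hn hψ hη' (hSh f) hI hχp hχ hβ
        (s := s) hs
      refine ⟨⟨ShalikaZeta.meromorphicNFOn_zetaValue η ψ β, (A : ℝ) + n * n + 1 / 2,
        fun s hs => ?_⟩, key⟩
      have hint := ShalikaZeta.integrable_zetaIntegrand μ hn hψ hη' (hSh f) hI hχp hχ hC hb hs
      exact ⟨hint, (key s hint).symm⟩
    · have h1 := ShalikaZeta.zetaIntegrand_eq_zero (χ := χ) (β := β) (hSh f) h0
      have h2 := ShalikaZeta.zetaValue_eq_zero μ (η := η) (χ := χ) (ψ := ψ) (β := β) h0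
      refine ⟨⟨ShalikaZeta.meromorphicNFOn_zetaValue η ψ β, 0, fun s _ => ?_⟩, fun s _ => ?_⟩
      · rw [h1, h2]
        exact ⟨MeasureTheory.integrable_zero _ _ _, by simp⟩
      · rw [h1, h2]; simp
  exact ⟨⟨_, hzeta.1⟩, ShalikaZeta.zeta_eq_of_isZetaFunction hzeta.1, hzeta.2⟩
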